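/- Let $P$ be a simple polygon in the Euclidean plane, regarded as the closed region bounded by its boundary polygon $\partial P$; straight vertices (interior angle $\pi$) are allowed, and a vertex is called reflex if its interior angle is at least $\pi$. Let $m \ge 4$, and let $\partial P$ be partitioned into polygonal paths $B_1, \dots, B_m$ with $\bigcup_{k=1}^m B_k = \partial P$, $B_k \cap B_{k+1} = \{v_k\}$ for $1 \le k \le m-1$ and $B_m \cap B_1 = \{v_m\}$ for distinct vertices $v_1, \dots, v_m$ of $P$, any two distinct paths that are not cyclically consecutive being disjoint. Suppose that each $B_k$ is outward convex, i.e. that every vertex of $P$ on $B_k$ other than the two endpoints of $B_k$ is reflex. Let $(B_i, B_j)$ be a non-adjacent pair, i.e. $B_i \cap B_j = \emptyset$, that is strongly mutually visible in $P$: there are a point $p' \in B_i$ and a point $p'' \in B_j$, neither of them an endpoint of its path, such that the line segment $\overline{p'p''}$ is contained in $P$ and meets $\partial P$ only in $p'$ and $p''$. Orient $B_i$ and $B_j$ consistently with the counterclockwise orientation of $\partial P$. Let $\beta_1$ be the shortest path in $P$ between the initial points of $B_i$ and $B_j$, and let $\beta_2$ be the shortest path in $P$ between the terminal points of $B_i$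 and $B_j$. Then $\beta_1$ and $\beta_2$ intersect in exactly one point, which is either an interior point of $P$ or a vertex of $P$. -/

import Mathlib

open Set Filter Topology

/-- The Euclidean plane. -/
abbrev Plane : Type := EuclideanSpace ℝ (Fin 2)

namespace Polygon

/-- A simple polygon: at least three vertices, adjacent vertices are distinct, two consecutive
edges meet only in their common vertex, and two distinct non-consecutive edges are disjoint.
Vertices with a straight angle are allowed, and the vertices may be listed in either sense. -/
structure IsSimple {n : ℕ} [NeZero n] (P : Polygon Plane n) : Prop where
  three_le : 3 ≤ n
  nondegenerate : P.HasNondegenerateEdges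
  consecutive : ∀ i : Fin n, P.edgeSet ℝ i ∩ P.edgeSet ℝ (i + 1) = {P (i + 1)}
  nonconsecutive : ∀ i j : Fin n, j ≠ i → j ≠ i + 1 → i ≠ j + 1 →
    Disjoint (P.edgeSet ℝ i) (P.edgeSet ℝ j)

/-- The open region enclosed by the polygon: the points off the boundary whose connected
component in the complement of the boundary is bounded. -/
def inside {n : ℕ} (P : Polygon Plane n) : Set Plane :=
  {x | x ∉ P.boundary ℝ ∧ Bornology.IsBounded (connectedComponentIn (P.boundary ℝ)ᶜ x)}

/-- The polygon as a closed region of the plane: its boundary together with its inside. -/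
def region {n : ℕ} (P : Polygon Plane n) : Set Plane :=
  P.boundary ℝ ∪ P.inside

open Classical in
/-- The interior angle at the vertex `P k`: of the two angles `∠` and `2π - ∠` between the
edges at `P k`, the one facing the inside. The smaller angle `∠ ≤ π` faces the inside when
the points close to `P k` on the way to the midpoint of its two neighbours (they lie in the
smaller sector) are inside `P`. For a straight angle both alternatives give `π`. -/
noncomputable def interiorAngle {n : ℕ} [NeZero n] (P : Polygon Plane n) (k : Fin n) : ℝ :=
  if ∀ᶠ t in 𝓝[>] (0 : ℝ),
      AffineMap.lineMap (P k) (midpoint ℝ (P (k - 1)) (P (k + 1))) t ∈ P.inside then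
    EuclideanGeometry.angle (P (k - 1)) (P k) (P (k + 1))
  else
    2 * Real.pi - EuclideanGeometry.angle (P (k - 1)) (P k) (P (k + 1))

/-- A vertex is reflex if its interior angle is at least `π` (equality is allowed). -/
def IsReflex {n : ℕ} [NeZero n] (P : Polygon Plane n) (k : Fin n) : Prop :=
  Real.pi ≤ P.interiorAngle k

end Polygon

/-- A polygonal path in the boundary of an `n`-gon that joins two distinct vertices: it starts
at the vertex with index `start` and runs along `len` consecutive edges, in the direction in
which the vertices of the polygon are listed. -/
structure BoundaryPath (n : ℕ) where
  start : Fin n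
  len : ℕ
  len_pos : 0 < len
  len_lt : len < n

namespace BoundaryPath

/-- The index of the `t`-th vertex of the path. -/
def vertexIndex {n : ℕ} [NeZero n] (B : BoundaryPath n) (t : ℕ) : Fin n :=
  B.start + Fin.ofNat n t

/-- The initial point of the path. -/
def initial {n : ℕ} [NeZero n] (B : BoundaryPath n) (P : Polygon Plane n) : Plane :=
  P (B.vertexIndex 0)

/-- The terminal point of the path. -/
def terminal {n : ℕ} [NeZero n] (B : BoundaryPath n) (P : Polygon Plane n) : Plane :=
  P (B.vertexIndex B.len)

/-- The path as a set of points: the union of its edges. -/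
def carrier {n : ℕ} [NeZero n] (B : BoundaryPath n) (P : Polygon Plane n) : Set Plane :=
  ⋃ t : Fin B.len, P.edgeSet ℝ (B.vertexIndex t)

/-- The interior of the path: the path without its two endpoints. -/
def pathInterior {n : ℕ} [NeZero n] (B : BoundaryPath n) (P : Polygon Plane n) : Set Plane :=
  B.carrier P \ {B.initial P, B.terminal P}

/-- A boundary path is outward convex if each of its interior vertices is a reflex vertex of
the polygon. -/
def IsOutwardConvex {n : ℕ} [NeZero n] (B : BoundaryPath n) (P : Polygon Plane n) : Prop :=
  ∀ t : ℕ, 0 < t → t < B.len → P.IsReflex (B.vertexIndex t)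

end BoundaryPath

/-- Two boundary paths are strongly mutually visible in `P` if some interior point of the one
and some interior point of the other are joined by a line segment that is contained in `P`
and meets the boundary of `P` only at its endpoints. -/
def StronglyMutuallyVisible {n : ℕ} [NeZero n] (P : Polygon Plane n)
    (B' B'' : BoundaryPath n) : Prop :=
  ∃ p' ∈ B'.pathInterior P, ∃ p'' ∈ B''.pathInterior P,
    segment ℝ p' p'' ⊆ P.region ∧ segment ℝ p' p'' ∩ P.boundary ℝ = {p', p''}

/-- The boundary of `P` is partitioned into the paths `B k`, cyclically indexed, so that
consecutive paths `B k` and `B (k + 1)` share exactly one point, the vertex with index `v k`,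
these vertices are distinct, and two distinct paths that are not consecutive are disjoint. -/
structure IsBoundaryPartition {n m : ℕ} [NeZero n] [NeZero m] (P : Polygon Plane n)
    (B : Fin m → BoundaryPath n) (v : Fin m → Fin n) : Prop where
  injective : Function.Injective v
  iUnion_eq : ⋃ k, (B k).carrier P = P.boundary ℝ
  consecutive : ∀ k : Fin m, (B k).carrier P ∩ (B (k + 1)).carrier P = {P (v k)}
  nonconsecutive : ∀ k l : Fin m, l ≠ k → l ≠ k + 1 → k ≠ l + 1 →
    Disjoint ((B k).carrier P) ((B l).carrier P)

/-- `γ` is a shortest path in `S` between its endpoints: it is a continuous path in `S`, and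
its length is minimal among all continuous paths in `S` with the same endpoints. -/
def IsShortestPathIn (S : Set Plane) {x y : Plane} (γ : Path x y) : Prop :=
  range γ ⊆ S ∧
    ∀ γ' : Path x y, range γ' ⊆ S → eVariationOn γ univ ≤ eVariationOn γ' univ

/-! Let a, b be the initial and terminal points of the first path and c, d those of the second.
Along the boundary they occur in the order a, b, c, d, so the endpoints of β₁ (a to c) and of β₂ (b
to d) interlace. That β₁ and β₂ meet is then a Jordan-type statement (`SimpleCycle.crossing`); that
they meet only once is a matter of geodesics.

The geodesic notion used is local. A polygonal line in the region is taut if no triangle of the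
region cuts off one of its corners (`Turn`, `Taut`, `Link`). Shortest paths are taut
(`exists_link_of_shortest`), outward convex boundary paths are taut because a corner can be cut only
at an interior angle below π (`turn_of_isReflex`), and two taut lines sharing an edge can be spliced
along it (`Link.splice`). Taut lines with the same endpoints have the same point set
(`Link.carrier_unique`). Indeed, unless both fill the segment between their endpoints, some exposed
vertex of their union differs from both endpoints. If only one line visited it, the cycle formed by
the two lines would wind around the points just inside that corner; a closed line in the region does
not wind around points off the region, so a small triangle there would lie in the region and cut the
corner. Hence both lines pass through the exposed vertex, and induction applies to the two halves.

If β₁ and β₂ had two common points, uniqueness would give a common edge XY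
(`Link.exists_common_edge`). If they traverse it in opposite directions, splicing gives a taut line
from a to b and one from c to d, both through X; by uniqueness these are the two boundary paths,
which are disjoint. If they traverse it in the same direction, splicing also gives taut lines a to d
and b to c. The chord p'p'' separates enough endpoints to force X and Y onto the chord
(`ChordedArcs.mem_chord`). Traced backwards, the lines from a and b then run along the chord to one
of its ends. If this is p', both turn tautly from the boundary path into the chord, one from each
side, which is impossible at a corner (`Corner.not_turn_both`). If it is p'', prolonging the line
from a to p' gives a taut line through p'' with the endpoints of a piece of the first path, so p''
would lie on that path.

Finally, a taut line through an interior point of a polygon edge runs along that edge on both sides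
(`SimpleCycle.eventually_mem_carrier`), so a common point there would not be the only one.

The topology rests on winding numbers, defined as sums of principal arguments (`angSum`): they are
locally constant, vanish far away and jump by 2π across an edge. This suffices for the Jordan curve
theorem in the form of `SimpleCycle.jordan`. -/

namespace PlaneGeom

/-! ### The angle under which a segment is seen -/

/-- The identification of the plane with `ℂ`. -/
noncomputable def toC : Plane ≃ₗᵢ[ℝ] ℂ := Complex.orthonormalBasisOneI.repr.symm

lemma toC_re (x : Plane) : (toC x).re = x 0 := by
  simp [toC]

lemma toC_im (x : Plane) : (toC x).im = x 1 := by
  simp [toC]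

/-- The determinant of two plane vectors. -/
def det (u v : Plane) : ℝ := u 0 * v 1 - u 1 * v 0

lemma plane_ext {u v : Plane} (h0 : u 0 = v 0) (h1 : u 1 = v 1) : u = v := by
  ext i; fin_cases i <;> assumption

@[fun_prop]
lemma continuous_det {X : Type*} [TopologicalSpace X] {f g : X → Plane} (hf : Continuous f)
    (hg : Continuous g) : Continuous fun x => det (f x) (g x) := by
  unfold det; fun_prop

/-- The oriented angle in `(-π, π]` at `x` from `a` to `b`. -/
noncomputable def ang (a b x : Plane) : ℝ := Complex.arg (toC (b - x) / toC (a - x))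

lemma toC_sub_ne {a x : Plane} (h : a ≠ x) : toC (a - x) ≠ 0 := by
  simpa [sub_eq_zero] using h

lemma continuousAt_ang_quot {a b x : Plane} (h : a ≠ x) :
    ContinuousAt (fun y => toC (b - y) / toC (a - y)) x := by
  have h1 : Continuous fun y => toC (b - y) := toC.continuous.comp (by fun_prop)
  have h2 : Continuous fun y => toC (a - y) := toC.continuous.comp (by fun_prop)
  exact h1.continuousAt.div h2.continuousAt (toC_sub_ne h)

/-- The principal argument is discontinuous only on the nonpositive real axis, and the quotient lies
there only when x lies between a and b. -/
lemma continuousAt_ang {a b x : Plane} (hx : x ∉ segment ℝ a b) : ContinuousAt (ang a b) x := by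
  have hax : a ≠ x := by rintro rfl; exact hx (left_mem_segment _ _ _)
  have hax' := toC_sub_ne hax
  refine ContinuousAt.comp (f := fun y => toC (b - y) / toC (a - y)) ?_ (continuousAt_ang_quot hax)
  apply Complex.continuousAt_arg
  rw [Complex.mem_slitPlane_iff_not_le_zero]
  intro hle
  apply hx
  obtain ⟨r, hr0, hr⟩ : ∃ r : ℝ, r ≤ 0 ∧ toC (b - x) / toC (a - x) = r := by
    rw [Complex.le_def] at hle
    exact ⟨_, hle.1, Complex.ext rfl (by simpa using hle.2)⟩
  rw [div_eq_iff hax'] at hr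
  have h3 : b - x = r • (a - x) := by
    apply toC.injective
    rw [hr, map_smul]; simp
  have h1r : (0:ℝ) < 1 - r := by linarith
  -- Solving `b - x = r • (a - x)` for x gives these weights; they are nonnegative because r ≤ 0.
  refine ⟨-r / (1 - r), 1 / (1 - r), div_nonneg (by linarith) h1r.le, by positivity, by
    field_simp; ring, ?_⟩
  have hb : b = x + r • (a - x) := by rw [← h3]; abel
  rw [hb]
  have hn : (1 - r) ≠ 0 := h1r.ne'
  apply plane_ext <;> simp <;> field_simp <;> ring

/-- The direction from `x` to `a` as a complex number of norm one. -/
noncomputable def dir (a x : Plane) : ℂ := toC (a - x) / ‖toC (a - x)‖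

lemma dir_ne_zero {a x : Plane} (h : a ≠ x) : dir a x ≠ 0 := by
  have := toC_sub_ne h
  unfold dir
  simp [sub_eq_zero, h]

/-- Modulo 2π the angle is the difference of two directions, so it telescopes along a polygonal line
and closed lines receive integer multiples of 2π. -/
lemma exp_ang {a b x : Plane} (ha : a ≠ x) (hb : b ≠ x) :
    Complex.exp (ang a b x * Complex.I) * dir a x = dir b x := by
  have ha' := toC_sub_ne ha
  have hb' := toC_sub_ne hb
  have key := Complex.norm_mul_exp_arg_mul_I (toC (b - x) / toC (a - x))
  have hna : (‖toC (a - x)‖ : ℂ) ≠ 0 := by simpa [sub_eq_zero] using ha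
  have hnb : (‖toC (b - x)‖ : ℂ) ≠ 0 := by simpa [sub_eq_zero] using hb
  unfold dir ang
  rw [norm_div, Complex.ofReal_div] at key
  generalize Complex.exp _ = E at *
  field_simp at key ⊢
  linear_combination key

lemma tendsto_ang (a b : Plane) : Tendsto (ang a b) (Bornology.cobounded Plane) (𝓝 0) := by
  have h1 : Tendsto (fun x => toC (a - x)) (Bornology.cobounded Plane) (Bornology.cobounded ℂ) := by
    rw [← tendsto_norm_atTop_iff_cobounded]
    have : Tendsto (fun x : Plane => ‖x‖ - ‖a‖) (Bornology.cobounded Plane) atTop :=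
      tendsto_atTop_add_const_right _ _ tendsto_norm_cobounded_atTop
    refine tendsto_atTop_mono (fun x => ?_) this
    simp only [LinearIsometryEquiv.norm_map]
    have := norm_sub_norm_le x a
    rwa [norm_sub_rev] at this
  have h2 : Tendsto (fun x => 1 + toC (b - a) * (toC (a - x))⁻¹) (Bornology.cobounded Plane)
      (𝓝 (1 + toC (b - a) * 0)) :=
    ((Filter.tendsto_inv₀_cobounded.comp h1).const_mul _).const_add _
  have h3 : Tendsto (fun x => toC (b - x) / toC (a - x)) (Bornology.cobounded Plane) (𝓝 1) := by
    simp only [mul_zero, add_zero] at h2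
    refine h2.congr' ?_
    have hne : ∀ᶠ x in Bornology.cobounded Plane, x ≠ a :=
      by
      have : Bornology.IsBounded ({a} : Set Plane) := Bornology.isBounded_singleton
      rw [Bornology.isBounded_def] at this
      exact this
    filter_upwards [hne] with x hx
    have := toC_sub_ne (Ne.symm hx)
    field_simp
    rw [← map_add]; congr 1; abel
  have h4 : Tendsto Complex.arg (𝓝 1) (𝓝 0) := by
    have := (Complex.continuousAt_arg Complex.one_mem_slitPlane).tendsto
    rwa [Complex.arg_one] at this
  exact h4.comp h3

lemma ang_quot_im (a b y : Plane) :
    (toC (b - y) / toC (a - y)).im = det (a - y) (b - y) / Complex.normSq (toC (a - y)) := by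
  rw [Complex.div_im]
  simp only [toC_re, toC_im, det]
  ring

lemma ang_quot_neg {a b m : Plane} (hm : m ∈ openSegment ℝ a b) (hab : a ≠ b) :
    a ≠ m ∧ (toC (b - m) / toC (a - m)).re < 0 ∧ (toC (b - m) / toC (a - m)).im = 0 := by
  obtain ⟨s, t, hs, ht, hst, rfl⟩ := hm
  have h1 : a - (s • a + t • b) = t • (a - b) := by
    obtain rfl : s = 1 - t := by linarith
    module
  have h2 : b - (s • a + t • b) = (-s) • (a - b) := by
    obtain rfl : s = 1 - t := by linarith
    module
  have h3 : toC (a - b) ≠ 0 := toC_sub_ne hab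
  have h4 : toC (b - (s • a + t • b)) / toC (a - (s • a + t • b)) = ((-s / t : ℝ) : ℂ) := by
    rw [h1, h2, map_smul, map_smul]
    simp only [Complex.real_smul]
    push_cast
    have : (t : ℂ) ≠ 0 := by exact_mod_cast ht.ne'
    field_simp
  refine ⟨?_, ?_, ?_⟩
  · intro h
    rw [← sub_eq_zero, h1, smul_eq_zero, sub_eq_zero] at h
    exact h.elim ht.ne' hab
  · rw [h4, Complex.ofReal_re]
    exact div_neg_of_neg_of_pos (by linarith) ht
  · rw [h4, Complex.ofReal_im]

/-- Both sides are twice the signed area of the triangle a, b, y. Hence the sign of the angle tells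
the side of the line on which y lies. -/
lemma det_sub_sub {a b m : Plane} (hm : m ∈ segment ℝ a b) (y : Plane) :
    det (a - y) (b - y) = det (b - a) (y - m) := by
  obtain ⟨s, t, hs, ht, hst, rfl⟩ := hm
  obtain rfl : s = 1 - t := by linarith
  simp [det]; ring

/-- At m the quotient is a negative real, and from the left it is approached with nonnegative
imaginary part. With the limit -π from the right this is the jump of 2π across a segment. -/
lemma tendsto_ang_left {a b m : Plane} (hm : m ∈ openSegment ℝ a b) (hab : a ≠ b) :
    Tendsto (ang a b) (𝓝[{y | 0 < det (b - a) (y - m)}] m) (𝓝 Real.pi) := by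
  obtain ⟨ham, hre, him⟩ := ang_quot_neg hm hab
  have h1 := Complex.continuousWithinAt_arg_of_re_neg_of_im_zero hre him
  have h2 : Complex.arg (toC (b - m) / toC (a - m)) = Real.pi :=
    Complex.arg_eq_pi_iff.2 ⟨hre, him⟩
  unfold ContinuousWithinAt at h1
  rw [h2] at h1
  refine h1.comp (f := fun y => toC (b - y) / toC (a - y)) ?_
  refine tendsto_nhdsWithin_iff.2 ⟨(continuousAt_ang_quot ham).tendsto.mono_left
    nhdsWithin_le_nhds, ?_⟩
  filter_upwards [self_mem_nhdsWithin] with y hy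
  have hy : 0 < det (b - a) (y - m) := hy
  change 0 ≤ (toC (b - y) / toC (a - y)).im
  rw [ang_quot_im, det_sub_sub (openSegment_subset_segment _ _ _ hm)]
  exact div_nonneg hy.le (Complex.normSq_nonneg _)

lemma tendsto_ang_right {a b m : Plane} (hm : m ∈ openSegment ℝ a b) (hab : a ≠ b) :
    Tendsto (ang a b) (𝓝[{y | det (b - a) (y - m) < 0}] m) (𝓝 (-Real.pi)) := by
  obtain ⟨ham, hre, him⟩ := ang_quot_neg hm hab
  have h1 := Complex.tendsto_arg_nhdsWithin_im_neg_of_re_neg_of_im_zero hre him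
  refine h1.comp (f := fun y => toC (b - y) / toC (a - y)) ?_
  refine tendsto_nhdsWithin_iff.2 ⟨(continuousAt_ang_quot ham).tendsto.mono_left
    nhdsWithin_le_nhds, ?_⟩
  have hne : ∀ᶠ y in 𝓝[{y | det (b - a) (y - m) < 0}] m, y ≠ a :=
    nhdsWithin_le_nhds (isOpen_ne.mem_nhds ham.symm)
  filter_upwards [self_mem_nhdsWithin, hne] with y hy hya
  have hy : det (b - a) (y - m) < 0 := hy
  change (toC (b - y) / toC (a - y)).im < 0
  rw [ang_quot_im, det_sub_sub (openSegment_subset_segment _ _ _ hm)]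
  exact div_neg_of_neg_of_pos hy (Complex.normSq_pos.2 (toC_sub_ne hya.symm))

/-! ### Polygonal lines given by lists of points -/

/-- The polygonal line through the points of a list, as a set. -/
def carrier (l : List Plane) : Set Plane :=
  {x | x ∈ l ∨ ∃ p q, [p, q] <:+: l ∧ x ∈ segment ℝ p q}

@[simp] lemma carrier_nil : carrier [] = ∅ := by
  ext x; simp [carrier]

@[simp] lemma carrier_singleton (a : Plane) : carrier [a] = {a} := by
  ext x
  simp only [carrier, List.mem_singleton, mem_ofPred_eq, mem_singleton_iff, or_iff_left_iff_imp]
  rintro ⟨p, q, h, -⟩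
  have := h.length_le
  simp at this

lemma carrier_cons_cons (a b : Plane) (l : List Plane) :
    carrier (a :: b :: l) = segment ℝ a b ∪ carrier (b :: l) := by
  ext x
  simp only [carrier, mem_ofPred_eq, mem_union]
  constructor
  · rintro (h | ⟨p, q, h, hx⟩)
    · rcases List.mem_cons.1 h with rfl | h
      · exact Or.inl (left_mem_segment _ _ _)
      · exact Or.inr (Or.inl h)
    · rcases List.infix_cons_iff.1 h with h | h
      · simp only [List.cons_prefix_cons, List.nil_prefix, and_true] at h
        obtain ⟨rfl, rfl⟩ := h
        exact Or.inl hx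
      · exact Or.inr (Or.inr ⟨p, q, h, hx⟩)
  · rintro (h | h | ⟨p, q, h, hx⟩)
    · exact Or.inr ⟨a, b, ⟨[], l, by simp⟩, h⟩
    · exact Or.inl (List.mem_cons_of_mem _ h)
    · exact Or.inr ⟨p, q, List.infix_cons h, hx⟩

lemma mem_carrier_of_mem {l : List Plane} {x : Plane} (h : x ∈ l) : x ∈ carrier l := Or.inl h

lemma carrier_append (A B : List Plane) (z : Plane) :
    carrier (A ++ z :: B) = carrier (A ++ [z]) ∪ carrier (z :: B) := by
  induction A with
  | nil =>
    simp only [List.nil_append, carrier_singleton]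
    rw [eq_comm, union_eq_right, singleton_subset_iff]
    exact mem_carrier_of_mem (by simp)
  | cons a A ih =>
    cases A with
    | nil =>
      have : z ∈ segment ℝ a z := right_mem_segment _ _ _
      simp [carrier_cons_cons, insert_eq_of_mem this]
    | cons b A =>
      simp only [List.cons_append, carrier_cons_cons] at ih ⊢
      rw [ih, union_assoc]

lemma carrier_reverse (l : List Plane) : carrier l.reverse = carrier l := by
  ext x
  simp only [carrier, mem_ofPred_eq, List.mem_reverse]
  have : ∀ l : List Plane, (∃ p q, [p, q] <:+: l ∧ x ∈ segment ℝ p q) →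
      ∃ p q, [p, q] <:+: l.reverse ∧ x ∈ segment ℝ p q := by
    rintro l ⟨p, q, h, hx⟩
    refine ⟨q, p, ?_, segment_symm ℝ p q ▸ hx⟩
    have := List.reverse_infix.2 h
    simpa using this
  refine or_congr_right ⟨fun h => ?_, this l⟩
  simpa using this _ h

lemma isCompact_carrier (l : List Plane) : IsCompact (carrier l) := by
  induction l with
  | nil => simp
  | cons a l ih =>
    cases l with
    | nil => simp
    | cons b l =>
      rw [carrier_cons_cons]
      refine IsCompact.union ?_ ih
      rw [segment_eq_image_lineMap]
      exact isCompact_Icc.image (by fun_prop)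

lemma carrier_mono {l l' : List Plane} (h : l <:+: l') : carrier l ⊆ carrier l' := by
  rintro x (hx | ⟨p, q, h', hx⟩)
  · exact Or.inl (h.subset hx)
  · exact Or.inr ⟨p, q, h'.trans h, hx⟩

/-- The total angle under which a polygonal line is seen from a point. -/
noncomputable def angSum : List Plane → Plane → ℝ
  | [], _ => 0
  | [_], _ => 0
  | a :: b :: l, x => ang a b x + angSum (b :: l) x

lemma angSum_append (A B : List Plane) (z x : Plane) :
    angSum (A ++ z :: B) x = angSum (A ++ [z]) x + angSum (z :: B) x := by
  induction A with
  | nil => simp [angSum]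
  | cons a A ih =>
    cases A with
    | nil => simp [angSum]
    | cons b A =>
      simp only [List.cons_append, angSum] at ih ⊢
      rw [ih, add_assoc]

lemma continuousAt_angSum {l : List Plane} {x : Plane} (hx : x ∉ carrier l) :
    ContinuousAt (angSum l) x := by
  induction l with
  | nil => exact continuousAt_const
  | cons a l ih =>
    cases l with
    | nil => exact continuousAt_const
    | cons b l =>
      rw [carrier_cons_cons, mem_union, not_or] at hx
      exact (continuousAt_ang hx.1).add (ih hx.2)

lemma tendsto_angSum (l : List Plane) : Tendsto (angSum l) (Bornology.cobounded Plane) (𝓝 0) := by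
  induction l with
  | nil => exact tendsto_const_nhds
  | cons a l ih =>
    cases l with
    | nil => exact tendsto_const_nhds
    | cons b l =>
      have := (tendsto_ang a b).add ih
      rw [add_zero] at this
      exact this

lemma exp_angSum {l : List Plane} {p q x : Plane} (hp : l.head? = some p)
    (hq : l.getLast? = some q) (hx : x ∉ carrier l) :
    Complex.exp (angSum l x * Complex.I) * dir p x = dir q x := by
  induction l generalizing p with
  | nil => simp at hp
  | cons a l ih =>
    obtain rfl : a = p := by simpa using hp
    cases l with
    | nil =>
      obtain rfl : a = q := by simpa using hq
      simp [angSum]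
    | cons b l =>
      have hmem : ∀ y ∈ a :: b :: l, y ≠ x := by
        rintro y hy rfl; exact hx (mem_carrier_of_mem hy)
      have := ih (p := b) rfl (by simpa using hq)
        (fun h => hx (by rw [carrier_cons_cons]; exact Or.inr h))
      rw [← this, ← exp_ang (hmem a (by simp)) (hmem b (by simp)), angSum]
      push_cast
      rw [add_mul, Complex.exp_add]
      ring

/-! ### Winding functions -/

/-- A function with the properties of (`2π` times) the winding number of a cycle with support
in `C`. -/
structure IsWind (W : Plane → ℝ) (C : Set Plane) : Prop where
  cont : ∀ x ∉ C, ContinuousAt W x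
  int : ∀ x ∉ C, ∃ z : ℤ, W x = 2 * Real.pi * z
  lim : Tendsto W (Bornology.cobounded Plane) (𝓝 0)

lemma int_of_exp {r : ℝ} {d : ℂ} (hd : d ≠ 0) (h : Complex.exp (r * Complex.I) * d = d) :
    ∃ z : ℤ, r = 2 * Real.pi * z := by
  have h1 : Complex.exp (r * Complex.I) = 1 := mul_right_cancel₀ hd (by simpa using h)
  obtain ⟨z, hz⟩ := Complex.exp_eq_one_iff.1 h1
  refine ⟨z, ?_⟩
  have : (r : ℂ) = ((2 * Real.pi * z : ℝ) : ℂ) := by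
    have hI := Complex.I_ne_zero
    apply mul_right_cancel₀ hI
    push_cast; rw [hz]; ring
  exact_mod_cast this

/-- The cycle runs along l and back along l'. Subtracting angles avoids reversing l', where
principal arguments could change by 2π. -/
lemma isWind_sub {l l' : List Plane} {p q : Plane} (hp : l.head? = some p)
    (hq : l.getLast? = some q) (hp' : l'.head? = some p) (hq' : l'.getLast? = some q) :
    IsWind (fun x => angSum l x - angSum l' x) (carrier l ∪ carrier l') where
  cont x hx := (continuousAt_angSum fun h => hx (Or.inl h)).sub
    (continuousAt_angSum fun h => hx (Or.inr h))
  int x hx := by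
    rw [mem_union, not_or] at hx
    have hpx : p ≠ x := by
      rintro rfl; exact hx.1 (mem_carrier_of_mem (List.mem_of_mem_head? hp))
    have h1 := exp_angSum hp hq hx.1
    have h2 := exp_angSum hp' hq' hx.2
    apply int_of_exp (dir_ne_zero hpx)
    push_cast
    rw [sub_mul, Complex.exp_sub, div_mul_eq_mul_div, h1, ← h2]
    field_simp
  lim := by simpa using (tendsto_angSum l).sub (tendsto_angSum l')

lemma isWind_add {l l' : List Plane} {p q : Plane} (hp : l.head? = some p)
    (hq : l.getLast? = some q) (hp' : l'.head? = some q) (hq' : l'.getLast? = some p) :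
    IsWind (fun x => angSum l x + angSum l' x) (carrier l ∪ carrier l') where
  cont x hx := (continuousAt_angSum fun h => hx (Or.inl h)).add
    (continuousAt_angSum fun h => hx (Or.inr h))
  int x hx := by
    rw [mem_union, not_or] at hx
    have hpx : p ≠ x := by
      rintro rfl; exact hx.1 (mem_carrier_of_mem (List.mem_of_mem_head? hp))
    have h1 := exp_angSum hp hq hx.1
    have h2 := exp_angSum hp' hq' hx.2
    apply int_of_exp (dir_ne_zero hpx)
    push_cast
    rw [add_mul, Complex.exp_add, mul_comm (Complex.exp _), mul_assoc, h1, h2]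
  lim := by simpa using (tendsto_angSum l).add (tendsto_angSum l')

lemma isWind_closed {l : List Plane} {p : Plane} (hp : l.head? = some p)
    (hq : l.getLast? = some p) : IsWind (angSum l) (carrier l) := by
  have := isWind_sub hp hq (l' := [p]) rfl rfl
  have h2 : carrier l ∪ carrier [p] = carrier l := by
    rw [carrier_singleton, union_eq_left, singleton_subset_iff]
    exact mem_carrier_of_mem (List.mem_of_mem_head? hp)
  rw [h2] at this
  simpa [angSum] using this

/-- A continuous function with values in 2πℤ is constant on a connected set, by the intermediate
value theorem. -/
lemma IsWind.eq_of_isPreconnected {W : Plane → ℝ} {C S : Set Plane} (hW : IsWind W C)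
    (hS : IsPreconnected S) (hSC : Disjoint S C) {x y : Plane} (hx : x ∈ S) (hy : y ∈ S) :
    W x = W y := by
  have hc : ContinuousOn W S := fun z hz =>
    (hW.cont z (fun h => hSC.le_bot ⟨hz, h⟩)).continuousWithinAt
  have key : ∀ x ∈ S, ∀ y ∈ S, ¬ W x < W y := by
    intro x hx y hy hlt
    obtain ⟨a, ha⟩ := hW.int x (fun h => hSC.le_bot ⟨hx, h⟩)
    obtain ⟨b, hb⟩ := hW.int y (fun h => hSC.le_bot ⟨hy, h⟩)
    have hpi := Real.pi_pos
    have hab : a < b := by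
      have : (a : ℝ) < b := by
        rw [ha, hb] at hlt
        exact lt_of_mul_lt_mul_left hlt (by positivity)
      exact_mod_cast this
    have hab' : (a : ℝ) + 1 ≤ b := by exact_mod_cast hab
    -- An odd multiple of π lies between the two values and can never be attained.
    have hmem : 2 * Real.pi * a + Real.pi ∈ Icc (W x) (W y) := by
      rw [ha, hb]; constructor <;> nlinarith
    obtain ⟨z, hz, hzz⟩ := hS.intermediate_value hx hy hc hmem
    obtain ⟨c, hcz⟩ := hW.int z (fun h => hSC.le_bot ⟨hz, h⟩)
    rw [hcz] at hzz
    have : (2 * c : ℝ) = 2 * a + 1 := by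
      apply mul_left_cancel₀ hpi.ne'; linarith
    have : (2 * c : ℤ) = 2 * a + 1 := by exact_mod_cast this
    omega
  exact le_antisymm (not_lt.1 (key y hy x hx)) (not_lt.1 (key x hx y hy))

lemma IsWind.eq_zero {W : Plane → ℝ} {C S : Set Plane} (hW : IsWind W C)
    (hS : IsPreconnected S) (hSC : Disjoint S C) (hb : ¬ Bornology.IsBounded S)
    {x : Plane} (hx : x ∈ S) : W x = 0 := by
  have hpi := Real.pi_pos
  have h1 : ∀ᶠ y in Bornology.cobounded Plane, W y ∈ Ioo (-Real.pi) Real.pi :=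
    hW.lim (Ioo_mem_nhds (by linarith) hpi)
  obtain ⟨y, hyS, hy⟩ : ∃ y ∈ S, W y ∈ Ioo (-Real.pi) Real.pi := by
    by_contra! hcon
    apply hb
    refine Bornology.IsBounded.subset (t := {y | W y ∈ Ioo (-Real.pi) Real.pi}ᶜ) ?_ hcon
    rw [Bornology.isBounded_def, compl_compl]; exact h1
  rw [hW.eq_of_isPreconnected hS hSC hx hyS]
  obtain ⟨a, ha⟩ := hW.int y (fun h => hSC.le_bot ⟨hyS, h⟩)
  rw [ha] at hy ⊢
  obtain ⟨h1, h2⟩ := hy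
  have h3 : (a : ℝ) < 1 := by nlinarith
  have h4 : (-1 : ℝ) < a := by nlinarith
  have h3 : a < 1 := by exact_mod_cast h3
  have h4 : -1 < a := by exact_mod_cast h4
  obtain rfl : a = 0 := by omega
  simp

/-- If a function is the sum of the angle of an edge and a function that is continuous at a point
of that edge, then its limits on the two sides of the edge differ. -/
lemma ang_jump {a b m : Plane} (hm : m ∈ openSegment ℝ a b) (hab : a ≠ b) {W G : Plane → ℝ}
    (hW : ∀ x, W x = ang a b x + G x) (hG : ContinuousAt G m) {c c' : ℝ}
    (hc : ∃ᶠ y in 𝓝[{y | 0 < det (b - a) (y - m)}] m, W y = c)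
    (hc' : ∃ᶠ y in 𝓝[{y | det (b - a) (y - m) < 0}] m, W y = c') : c ≠ c' := by
  have h1 : Tendsto W (𝓝[{y | 0 < det (b - a) (y - m)}] m) (𝓝 (Real.pi + G m)) := by
    simp only [funext hW]
    exact (tendsto_ang_left hm hab).add (hG.tendsto.mono_left nhdsWithin_le_nhds)
  have h2 : Tendsto W (𝓝[{y | det (b - a) (y - m) < 0}] m) (𝓝 (-Real.pi + G m)) := by
    simp only [funext hW]
    exact (tendsto_ang_right hm hab).add (hG.tendsto.mono_left nhdsWithin_le_nhds)
  have aux : ∀ {F : Filter Plane} {c L : ℝ}, Tendsto W F (𝓝 L) → (∃ᶠ y in F, W y = c) → c = L := by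
    intro F c L h hf
    by_contra hne
    have := h (isOpen_ne.mem_nhds (Ne.symm hne))
    obtain ⟨y, hy1, hy2⟩ := (hf.and_eventually this).exists
    exact hy2 hy1
  rw [aux h1 hc, aux h2 hc']
  have := Real.pi_pos
  intro h; linarith

/-! ### The region enclosed by a closed set -/

/-- The points off `S` whose component in the complement of `S` is bounded. -/
def insideOf (S : Set Plane) : Set Plane :=
  {x | x ∉ S ∧ Bornology.IsBounded (connectedComponentIn Sᶜ x)}

/-- The set `S` together with all bounded components of its complement. -/
def regionOf (S : Set Plane) : Set Plane := S ∪ insideOf S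

lemma subset_regionOf (S : Set Plane) : S ⊆ regionOf S := subset_union_left

lemma insideOf_subset_regionOf (S : Set Plane) : insideOf S ⊆ regionOf S := subset_union_right

lemma mem_insideOf_of_isPreconnected {S T : Set Plane} (hT : IsPreconnected T)
    (hTS : Disjoint T S) {x y : Plane} (hx : x ∈ T) (hy : y ∈ T) (hin : x ∈ insideOf S) :
    y ∈ insideOf S := by
  have hsub : T ⊆ Sᶜ := hTS.subset_compl_right
  have h1 : y ∈ connectedComponentIn Sᶜ x := hT.subset_connectedComponentIn hx hsub hy
  refine ⟨hsub hy, ?_⟩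
  rw [← connectedComponentIn_eq h1]
  exact hin.2

lemma isOpen_insideOf {S : Set Plane} (hS : IsClosed S) : IsOpen (insideOf S) := by
  rw [isOpen_iff_mem_nhds]
  intro x hx
  have hx' : x ∈ Sᶜ := hx.1
  filter_upwards [(hS.isOpen_compl.connectedComponentIn (x := x)).mem_nhds
    (mem_connectedComponentIn hx')] with y hy
  refine ⟨connectedComponentIn_subset _ _ hy, ?_⟩
  rw [← connectedComponentIn_eq hy]
  exact hx.2

lemma exists_unbounded_of_notMem {S : Set Plane} {x : Plane} (hx : x ∉ regionOf S) :
    ∃ T, IsPreconnected T ∧ ¬ Bornology.IsBounded T ∧ x ∈ T ∧ Disjoint T (regionOf S) := by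
  have hxS : x ∈ Sᶜ := fun h => hx (Or.inl h)
  refine ⟨connectedComponentIn Sᶜ x, isPreconnected_connectedComponentIn,
    fun h => hx (Or.inr ⟨hxS, h⟩), mem_connectedComponentIn hxS, ?_⟩
  rw [Set.disjoint_left]
  rintro y hy (hyS | hyi)
  · exact connectedComponentIn_subset _ _ hy hyS
  · have := hyi.2
    rw [← connectedComponentIn_eq hy] at this
    exact hx (Or.inr ⟨hxS, this⟩)

lemma notMem_regionOf {S T : Set Plane} (hT : IsPreconnected T) (hTS : Disjoint T S)
    (hb : ¬ Bornology.IsBounded T) {x : Plane} (hx : x ∈ T) : x ∉ regionOf S := by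
  rintro (h | h)
  · exact hTS.le_bot ⟨hx, h⟩
  · exact hb (h.2.subset (hT.subset_connectedComponentIn hx hTS.subset_compl_right))

/-- The complement consists of the unbounded components of the complement of S, and components of an
open set in the plane are open. -/
lemma isClosed_regionOf {S : Set Plane} (hS : IsClosed S) : IsClosed (regionOf S) := by
  rw [← isOpen_compl_iff, isOpen_iff_mem_nhds]
  intro x hx
  have hx' : x ∈ Sᶜ := fun h => hx (Or.inl h)
  filter_upwards [(hS.isOpen_compl.connectedComponentIn (x := x)).mem_nhds
    (mem_connectedComponentIn hx')] with y hy
  rintro (h | h)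
  · exact connectedComponentIn_subset _ _ hy h
  · refine hx (Or.inr ⟨hx', ?_⟩)
    rw [connectedComponentIn_eq hy]
    exact h.2

lemma exists_notMem_regionOf {S : Set Plane} (hS : Bornology.IsBounded S) :
    ∃ x, x ∉ regionOf S := by
  obtain ⟨r, hr⟩ := hS.subset_closedBall (0 : Plane)
  have hlin : IsLinearMap ℝ (fun x : Plane => x 0) := ⟨fun _ _ => rfl, fun _ _ => rfl⟩
  have hcoord : ∀ y : Plane, y 0 ≤ ‖y‖ := fun y =>
    (le_abs_self _).trans (by simpa using PiLp.norm_apply_le y 0)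
  let e : ℝ → Plane := fun s => EuclideanSpace.single 0 s
  have he : ∀ s, (e s) 0 = s := fun s => by simp [e]
  refine ⟨e (r + 1), notMem_regionOf (T := {y | r < y 0})
    (convex_halfSpace_gt hlin r).isPreconnected ?_ ?_ (by change r < _; rw [he]; linarith)⟩
  · rw [Set.disjoint_left]
    intro y (hy : r < y 0) hyS
    have := hr hyS
    rw [mem_closedBall_zero_iff] at this
    linarith [hcoord y]
  · intro hb
    obtain ⟨M, hM⟩ := hb.exists_norm_le
    have h1 : e (max M r + 1) ∈ {y : Plane | r < y 0} := by
      change r < _; rw [he]; linarith [le_max_right M r]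
    have h2 := hM _ h1
    have h3 := hcoord (e (max M r + 1))
    rw [he] at h3
    linarith [le_max_left M r]

/-- The region has no holes: every point off it lies in an unbounded connected set avoiding it. All
simple connectivity used below enters here. -/
lemma IsWind.eq_zero_of_notMem {W : Plane → ℝ} {C S : Set Plane} (hW : IsWind W C)
    (hC : C ⊆ regionOf S) {x : Plane} (hx : x ∉ regionOf S) : W x = 0 := by
  obtain ⟨T, hT, hb, hxT, hd⟩ := exists_unbounded_of_notMem hx
  exact hW.eq_zero hT (hd.mono_right hC) hb hxT

/-! ### Two half planes at a corner -/

lemma det_add_smul (u v w : Plane) (r : ℝ) : det u (v + r • w) = det u v + r * det u w := by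
  simp [det]; ring

lemma det_smul_right (u v : Plane) (r : ℝ) : det u (r • v) = r * det u v := by
  simp [det]; ring

lemma det_smul_left (u v : Plane) (r : ℝ) : det (r • u) v = r * det u v := by
  simp [det]; ring

lemma det_self (u : Plane) : det u u = 0 := by simp [det]; ring

lemma det_swap (u v : Plane) : det u v = - det v u := by simp only [det]; ring

lemma isLinearMap_det (σ : ℝ) (u : Plane) : IsLinearMap ℝ (fun p => σ * det u p) :=
  ⟨fun x y => by simp [det]; ring, fun c x => by simp [det]; ring⟩

lemma exists_smul_of_det_eq_zero {u p : Plane} (hu : u ≠ 0) (h : det u p = 0) :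
    ∃ r : ℝ, p = r • u := by
  unfold det at h
  by_cases h0 : u 0 = 0
  · have h1 : u 1 ≠ 0 := fun h1 => hu (plane_ext (by simpa using h0) (by simpa using h1))
    refine ⟨p 1 / u 1, plane_ext ?_ ?_⟩
    · have : u 1 * p 0 = 0 := by rw [h0] at h; linarith
      have : p 0 = 0 := (mul_eq_zero.1 this).resolve_left h1
      simp [h0, this]
    · simp [h1]
  · refine ⟨p 0 / u 0, plane_ext ?_ ?_⟩
    · simp [h0]
    · simp; field_simp; linarith

/-- The quarter turn. -/
noncomputable def rot (u : Plane) : Plane := !₂[- u 1, u 0]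

lemma det_rot_pos {u : Plane} (hu : u ≠ 0) : 0 < det u (rot u) := by
  have : u 0 ≠ 0 ∨ u 1 ≠ 0 := by
    by_contra! h
    exact hu (plane_ext (by simpa using h.1) (by simpa using h.2))
  have h : det u (rot u) = u 0 * u 0 + u 1 * u 1 := by simp [det, rot]
  rw [h]
  rcases this with h | h <;>
    nlinarith [mul_self_pos.2 h, mul_self_nonneg (u 0), mul_self_nonneg (u 1)]

/-- The side with sign `σ` of a path that arrives at the origin in direction `u` and leaves in
direction `w`. -/
def sector (σ : ℝ) (u w : Plane) : Set Plane :=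
  {p | (0 < σ * det u w ∧ 0 < σ * det u p ∧ 0 < σ * det w p) ∨
    (σ * det u w ≤ 0 ∧ (0 < σ * det u p ∨ 0 < σ * det w p))}

lemma notMem_sector_left {σ : ℝ} {u w : Plane} {r : ℝ} (hr : 0 ≤ r) :
    -(r • u) ∉ sector σ u w := by
  have h1 : det u (-(r • u)) = 0 := by simp [det]; ring
  have h2 : det w (-(r • u)) = r * det u w := by simp [det]; ring
  rintro (⟨-, h, -⟩ | ⟨h, h' | h'⟩)
  · simp [h1] at h
  · simp [h1] at h'
  · rw [h2] at h'
    have : 0 ≤ r * -(σ * det u w) := mul_nonneg hr (by linarith)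
    linarith

lemma notMem_sector_right {σ : ℝ} {u w : Plane} {r : ℝ} (hr : 0 ≤ r) :
    r • w ∉ sector σ u w := by
  have h1 : det w (r • w) = 0 := by simp [det]; ring
  have h2 : det u (r • w) = r * det u w := by simp [det]; ring
  rintro (⟨-, -, h⟩ | ⟨h, h' | h'⟩)
  · simp [h1] at h
  · rw [h2] at h'
    have : 0 ≤ r * -(σ * det u w) := mul_nonneg hr (by linarith)
    linarith
  · simp [h1] at h'

/-- The two sectors and the two rays cover the plane. The hypothesis `huw` excludes a path that
turns straight back. -/
lemma mem_sector_or {u w p : Plane} (hu : u ≠ 0) (hw : w ≠ 0)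
    (huw : det u w = 0 → ∃ μ : ℝ, 0 < μ ∧ w = μ • u) :
    p ∈ sector 1 u w ∨ p ∈ sector (-1) u w ∨ (∃ r : ℝ, 0 ≤ r ∧ p = -(r • u)) ∨
      ∃ r : ℝ, 0 ≤ r ∧ p = r • w := by
  by_contra! hcon
  obtain ⟨h1, h2, h3, h4⟩ := hcon
  have key : (det u p = 0 ∧ 0 ≤ det u w * det w p) ∨ (det w p = 0 ∧ 0 ≤ det u w * det u p) := by
    rcases lt_trichotomy (det u w) 0 with h | h | h
    · have a1 : ¬ (0 < det u p ∨ 0 < det w p) := fun hh => h1 (Or.inr ⟨by linarith, by simpa using hh⟩)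
      have a2 : ¬ (det u p < 0 ∧ det w p < 0) := fun hh =>
        h2 (Or.inl ⟨by linarith, by linarith [hh.1], by linarith [hh.2]⟩)
      push Not at a1
      by_cases hp : det u p < 0
      · have : det w p = 0 := le_antisymm a1.2 (not_lt.1 fun hh => a2 ⟨hp, hh⟩)
        exact Or.inr ⟨this, by nlinarith⟩
      · exact Or.inl ⟨by linarith [a1.1], by nlinarith [a1.2]⟩
    · have a1 : ¬ (0 < det u p ∨ 0 < det w p) := fun hh => h1 (Or.inr ⟨by linarith, by simpa using hh⟩)
      have a2 : ¬ (det u p < 0 ∨ det w p < 0) := fun hh => h2 (Or.inr ⟨by linarith, by simpa using hh⟩)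
      push Not at a1 a2
      exact Or.inl ⟨by linarith, by rw [h]; simp⟩
    · have a1 : ¬ (det u p < 0 ∨ det w p < 0) := fun hh => h2 (Or.inr ⟨by linarith, by simpa using hh⟩)
      have a2 : ¬ (0 < det u p ∧ 0 < det w p) := fun hh =>
        h1 (Or.inl ⟨by linarith, by linarith [hh.1], by linarith [hh.2]⟩)
      push Not at a1
      by_cases hp : 0 < det u p
      · have : det w p = 0 := le_antisymm (not_lt.1 fun hh => a2 ⟨hp, hh⟩) a1.2
        exact Or.inr ⟨this, by nlinarith⟩
      · exact Or.inl ⟨by linarith [a1.1], by nlinarith [a1.2]⟩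
  rcases key with ⟨h, h'⟩ | ⟨h, h'⟩
  · obtain ⟨r, rfl⟩ := exists_smul_of_det_eq_zero hu h
    rcases le_or_gt r 0 with hr | hr
    · exact h3 (-r) (by linarith) (by simp)
    · rw [det_smul_right, det_swap w u] at h'
      have h0 : det u w = 0 := by
        by_contra hne
        have : 0 < r * (det u w * det u w) := mul_pos hr (mul_self_pos.2 hne)
        linarith
      obtain ⟨μ, hμ, rfl⟩ := huw h0
      exact h4 (r / μ) (by positivity) (by rw [smul_smul]; field_simp)
  · obtain ⟨r, rfl⟩ := exists_smul_of_det_eq_zero hw h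
    rcases le_or_gt 0 r with hr | hr
    · exact h4 r hr rfl
    · rw [det_smul_right] at h'
      have h0 : det u w = 0 := by
        by_contra hne
        have : 0 < -r * (det u w * det u w) := mul_pos (by linarith) (mul_self_pos.2 hne)
        linarith
      obtain ⟨μ, hμ, rfl⟩ := huw h0
      exact h3 (-r * μ) (mul_nonneg (by linarith) hμ.le) (by rw [smul_smul]; simp)

/-- A convex sector is an intersection of two half planes; any other sector is a union of two half
planes, which share arbitrarily small vectors. -/
lemma isPreconnected_sector {σ : ℝ} (hσ : σ ≠ 0) {u w : Plane} (hu : u ≠ 0)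
    (huw : det u w = 0 → ∃ μ : ℝ, 0 < μ ∧ w = μ • u) (r : ℝ) :
    IsPreconnected (sector σ u w ∩ Metric.ball 0 r) := by
  have c1 := convex_halfSpace_gt (isLinearMap_det σ u) 0
  have c2 := convex_halfSpace_gt (isLinearMap_det σ w) 0
  have c3 := convex_ball (0 : Plane) r
  rcases lt_or_ge 0 (σ * det u w) with h | h
  · have : sector σ u w = {p | 0 < σ * det u p} ∩ {p | 0 < σ * det w p} := by
      ext p
      constructor
      · rintro (⟨-, h1⟩ | ⟨h1, -⟩)
        · exact h1
        · linarith
      · exact fun h1 => Or.inl ⟨h, h1.1, h1.2⟩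
    rw [this]
    exact ((c1.inter c2).inter c3).isPreconnected
  · have : sector σ u w = {p | 0 < σ * det u p} ∪ {p | 0 < σ * det w p} := by
      ext p
      constructor
      · rintro (⟨h1, -⟩ | ⟨-, h1⟩)
        · linarith
        · exact h1
      · exact fun h1 => Or.inr ⟨h, h1⟩
    rw [this, union_inter_distrib_right]
    rcases le_or_gt r 0 with hr | hr
    · rw [Metric.ball_eq_empty.2 hr]; simp [isPreconnected_empty]
    obtain ⟨p, hp1, hp2⟩ : ∃ p, 0 < σ * det u p ∧ 0 < σ * det w p := by
      by_cases h0 : det u w = 0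
      · obtain ⟨μ, hμ, rfl⟩ := huw h0
        refine ⟨σ • rot u, ?_, ?_⟩
        · rw [det_smul_right]
          have := det_rot_pos hu
          have : 0 < σ * σ * det u (rot u) := mul_pos (mul_self_pos.2 hσ) this
          linarith
        · rw [det_smul_right, det_smul_left]
          have := det_rot_pos hu
          have : 0 < μ * (σ * σ * det u (rot u)) :=
            mul_pos hμ (mul_pos (mul_self_pos.2 hσ) this)
          linarith
      · have hlt : σ * det u w < 0 := lt_of_le_of_ne h (mul_ne_zero hσ h0)
        -- Both determinants of `u - w`, with u and with w, equal `-det u w`.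
        refine ⟨u - w, ?_, ?_⟩
        · have : det u (u - w) = - det u w := by simp [det]; ring
          rw [this]; linarith
        · have : det w (u - w) = - det u w := by simp [det]; ring
          rw [this]; linarith
    obtain ⟨ε, hε, hεr⟩ : ∃ ε : ℝ, 0 < ε ∧ ‖ε • p‖ < r := by
      refine ⟨r / (2 * (‖p‖ + 1)), by positivity, ?_⟩
      rw [norm_smul, Real.norm_of_nonneg (by positivity), div_mul_eq_mul_div,
        div_lt_iff₀ (by positivity)]
      nlinarith [norm_nonneg p]
    refine IsPreconnected.union (ε • p) ⟨?_, by simpa using hεr⟩ ⟨?_, by simpa using hεr⟩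
      (c1.inter c3).isPreconnected (c2.inter c3).isPreconnected
    · change 0 < σ * det u (ε • p)
      rw [det_smul_right]; have := mul_pos hε hp1; linarith
    · change 0 < σ * det w (ε • p)
      rw [det_smul_right]; have := mul_pos hε hp2; linarith

/-! ### Corners of a set -/

lemma mem_segment_split {A B m y : Plane} (hm : m ∈ segment ℝ A B) (hy : y ∈ segment ℝ A B) :
    y ∈ segment ℝ A m ∨ y ∈ segment ℝ m B := by
  obtain ⟨a, s1, ha, hs0, hab, rfl⟩ := hy
  obtain ⟨b, s2, hb, hs2, hbb, rfl⟩ := hm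
  obtain rfl : a = 1 - s1 := by linarith
  obtain rfl : b = 1 - s2 := by linarith
  rcases le_total s1 s2 with hle | hle
  · left
    rcases eq_or_lt_of_le hs2 with rfl | hpos
    · obtain rfl : s1 = 0 := le_antisymm hle hs0
      exact right_mem_segment _ _ _
    · refine ⟨1 - s1 / s2, s1 / s2, ?_, by positivity, by ring, ?_⟩
      · rw [sub_nonneg, div_le_one hpos]; exact hle
      · apply plane_ext <;> simp <;> field_simp <;> ring
  · right
    rcases eq_or_lt_of_le hb with h0 | hpos
    · obtain rfl : s2 = 1 := by linarith
      obtain rfl : s1 = 1 := le_antisymm (by linarith) hle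
      exact left_mem_segment _ _ _
    · refine ⟨(1 - s1) / (1 - s2), 1 - (1 - s1) / (1 - s2), by
        apply div_nonneg <;> linarith, ?_, by ring, ?_⟩
      · rw [sub_nonneg, div_le_one hpos]; linarith
      · apply plane_ext <;> simp <;> field_simp <;> ring

/-- In a neighbourhood of `V` the set `S` consists of the two segments from `V` to `A` and
to `B`, and these do not overlap. -/
structure Corner (S : Set Plane) (V A B : Plane) : Prop where
  left_ne : A ≠ V
  right_ne : B ≠ V
  left_subset : segment ℝ A V ⊆ S
  right_subset : segment ℝ V B ⊆ S
  near : ∀ᶠ y in 𝓝 V, y ∈ S → y ∈ segment ℝ A V ∪ segment ℝ V B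
  ray : det (V - A) (B - V) = 0 → ∃ μ : ℝ, 0 < μ ∧ B - V = μ • (V - A)

lemma sub_eq_of_mem_segment_left {A V y : Plane} (h : y ∈ segment ℝ A V) :
    ∃ r : ℝ, 0 ≤ r ∧ y - V = -(r • (V - A)) := by
  obtain ⟨s, t, hs, ht, hst, rfl⟩ := h
  refine ⟨s, hs, ?_⟩
  obtain rfl : t = 1 - s := by linarith
  module

lemma sub_eq_of_mem_segment_right {V B y : Plane} (h : y ∈ segment ℝ V B) :
    ∃ r : ℝ, 0 ≤ r ∧ y - V = r • (B - V) := by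
  obtain ⟨s, t, hs, ht, hst, rfl⟩ := h
  refine ⟨t, ht, ?_⟩
  obtain rfl : s = 1 - t := by linarith
  module

lemma mem_segment_of_sub_eq {V B y : Plane} {r : ℝ} (h0 : 0 ≤ r) (h1 : r ≤ 1)
    (h : y - V = r • (B - V)) : y ∈ segment ℝ V B := by
  refine ⟨1 - r, r, by linarith, h0, by ring, ?_⟩
  rw [← sub_eq_zero] at h ⊢
  rw [← neg_eq_zero, ← h]
  module

/-- Near V a ray cannot be told from its initial segment of direction vector u, so ray conditions
turn into membership in an edge. -/
lemma eventually_lt_one {u : Plane} (hu : u ≠ 0) (V : Plane) :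
    ∀ᶠ y in 𝓝 V, ∀ r : ℝ, y - V = r • u → |r| < 1 := by
  filter_upwards [Metric.ball_mem_nhds V (norm_pos_iff.2 hu)] with y hy r hr
  rw [mem_ball_iff_norm, hr, norm_smul, Real.norm_eq_abs] at hy
  by_contra! h
  nlinarith [norm_pos_iff.2 hu]

namespace Corner

variable {S : Set Plane} {V A B : Plane}

lemma symm (h : Corner S V A B) : Corner S V B A where
  left_ne := h.right_ne
  right_ne := h.left_ne
  left_subset := segment_symm ℝ V B ▸ h.right_subset
  right_subset := segment_symm ℝ A V ▸ h.left_subset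
  near := by
    filter_upwards [h.near] with y hy hyS
    rw [union_comm, segment_symm ℝ V A, segment_symm ℝ B V]
    exact hy hyS
  ray := by
    intro h0
    have h1 : det (V - A) (B - V) = 0 := by
      have : det (V - A) (B - V) = - det (V - B) (A - V) := by simp [det]; ring
      rw [this, h0, neg_zero]
    obtain ⟨μ, hμ, hr⟩ := h.ray h1
    refine ⟨μ⁻¹, by positivity, ?_⟩
    rw [← neg_sub B V, hr, smul_neg, smul_smul, inv_mul_cancel₀ hμ.ne', one_smul, neg_sub]

lemma mem (h : Corner S V A B) : V ∈ S := h.left_subset (right_mem_segment _ _ _)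

lemma sub_left_ne (h : Corner S V A B) : V - A ≠ 0 := sub_ne_zero.2 h.left_ne.symm

lemma sub_right_ne (h : Corner S V A B) : B - V ≠ 0 := sub_ne_zero.2 h.right_ne

lemma notMem_of_sector (h : Corner S V A B) (σ : ℝ) :
    ∀ᶠ y in 𝓝 V, y - V ∈ sector σ (V - A) (B - V) → y ∉ S := by
  filter_upwards [h.near] with y hy hsec hyS
  rcases hy hyS with h1 | h1
  · obtain ⟨r, hr, he⟩ := sub_eq_of_mem_segment_left h1
    rw [he] at hsec
    exact notMem_sector_left hr hsec
  · obtain ⟨r, hr, he⟩ := sub_eq_of_mem_segment_right h1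
    rw [he] at hsec
    exact notMem_sector_right hr hsec

lemma mem_sector_of_notMem (h : Corner S V A B) :
    ∀ᶠ y in 𝓝 V, y ∉ S →
      y - V ∈ sector 1 (V - A) (B - V) ∨ y - V ∈ sector (-1) (V - A) (B - V) := by
  filter_upwards [eventually_lt_one h.sub_left_ne V, eventually_lt_one h.sub_right_ne V]
    with y h1 h2 hyS
  rcases mem_sector_or (p := y - V) h.sub_left_ne h.sub_right_ne h.ray with
    hp | hp | ⟨r, hr, hp⟩ | ⟨r, hr, hp⟩
  · exact Or.inl hp
  · exact Or.inr hp
  · refine absurd (h.left_subset ?_) hyS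
    rw [segment_symm]
    have h3 := h1 (-r) (by rw [hp, neg_smul])
    rw [abs_neg, abs_of_nonneg hr] at h3
    exact mem_segment_of_sub_eq hr h3.le (by rw [hp, ← smul_neg, neg_sub])
  · refine absurd (h.right_subset ?_) hyS
    have h3 := h2 r hp
    rw [abs_of_nonneg hr] at h3
    exact mem_segment_of_sub_eq hr h3.le hp

end Corner

/-! ### One-sided values near a corner or a segment -/

/-- `f` takes the value `c` near `m` on the side `σ` of the line through `m` in
direction `d`. -/
def HalfGerm {α : Type*} (f : Plane → α) (d m : Plane) (σ : ℝ) (c : α) : Prop :=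
  ∀ᶠ y in 𝓝 m, 0 < σ * det d (y - m) → f y = c

lemma frequently_half {d : Plane} (hd : d ≠ 0) (m : Plane) {σ : ℝ} (hσ : σ ≠ 0) :
    ∃ᶠ y in 𝓝 m, 0 < σ * det d (y - m) := by
  have h1 : Tendsto (fun ε : ℝ => m + ε • (σ • rot d)) (𝓝[>] 0) (𝓝 m) := by
    have : Tendsto (fun ε : ℝ => m + ε • (σ • rot d)) (𝓝 0) (𝓝 (m + (0:ℝ) • (σ • rot d))) :=
      Continuous.tendsto (by fun_prop) _
    rw [zero_smul, add_zero] at this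
    exact this.mono_left nhdsWithin_le_nhds
  refine h1.frequently (Eventually.frequently ?_)
  filter_upwards [self_mem_nhdsWithin] with ε hε
  have hε : 0 < ε := hε
  rw [add_sub_cancel_left, det_smul_right, det_smul_right]
  have : 0 < ε * (σ * σ * det d (rot d)) :=
    mul_pos hε (mul_pos (mul_self_pos.2 hσ) (det_rot_pos hd))
  linarith

section Germ
variable {α : Type*} {f : Plane → α}

lemma HalfGerm.unique {d m : Plane} {σ : ℝ} {c c' : α}
    (hd : d ≠ 0) (hσ : σ ≠ 0) (h : HalfGerm f d m σ c) (h' : HalfGerm f d m σ c') : c = c' := by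
  obtain ⟨y, hy, h1, h2⟩ := ((frequently_half hd m hσ).and_eventually (h.and h')).exists
  rw [← h1 hy, h2 hy]

variable {S : Set Plane} {V A B : Plane}

/-- A sector cut down to a small ball is connected and misses S, so f is constant on it. -/
lemma Corner.exists_germ (h : Corner S V A B)
    (hf : ∀ T, IsPreconnected T → Disjoint T S → ∀ x ∈ T, ∀ y ∈ T, f x = f y)
    {σ : ℝ} (hσ : σ ≠ 0) :
    ∃ c, ∀ᶠ y in 𝓝 V, y - V ∈ sector σ (V - A) (B - V) → f y = c := by
  obtain ⟨r, hr, hball⟩ := Metric.eventually_nhds_iff_ball.1 (h.notMem_of_sector σ)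
  let T : Set Plane := (fun p => V + p) '' (sector σ (V - A) (B - V) ∩ Metric.ball 0 r)
  have hT : IsPreconnected T :=
    (isPreconnected_sector hσ h.sub_left_ne h.ray r).image _ (by fun_prop)
  have hmem : ∀ y, y ∈ T ↔ y - V ∈ sector σ (V - A) (B - V) ∧ y ∈ Metric.ball V r := by
    intro y
    constructor
    · rintro ⟨p, ⟨hp, hp'⟩, rfl⟩
      exact ⟨by simpa using hp, by
        rw [mem_ball_iff_norm, add_sub_cancel_left]; simpa using hp'⟩
    · rintro ⟨hp, hp'⟩
      exact ⟨y - V, ⟨hp, by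
        rw [mem_ball_iff_norm] at hp'; simpa using hp'⟩, by simp⟩
  have hd : Disjoint T S := by
    rw [Set.disjoint_left]
    intro y hy
    rw [hmem] at hy
    exact hball y hy.2 hy.1
  by_cases hne : T.Nonempty
  · obtain ⟨x, hx⟩ := hne
    refine ⟨f x, ?_⟩
    filter_upwards [Metric.ball_mem_nhds V hr] with y hy hsec
    exact hf T hT hd y ((hmem y).2 ⟨hsec, hy⟩) x hx
  · refine ⟨f V, ?_⟩
    filter_upwards [Metric.ball_mem_nhds V hr] with y hy hsec
    exact absurd ⟨y, (hmem y).2 ⟨hsec, hy⟩⟩ hne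

/-- A point m of the edge close to V has a half disc on side σ inside the sector at V, so the value
at the vertex passes to the edge. -/
lemma halfGerm_left_of_sector {c : α} {σ : ℝ}
    (hs : ∀ᶠ y in 𝓝 V, y - V ∈ sector σ (V - A) (B - V) → f y = c) :
    ∀ᶠ m in 𝓝 V, m ∈ openSegment ℝ A V → HalfGerm f (V - A) m σ c := by
  filter_upwards [eventually_eventually_nhds.2 hs] with m hm hmem
  obtain ⟨s, t, hs0, ht0, hst, hme⟩ := hmem
  have hmV : m - V = -(s • (V - A)) := by
    obtain rfl : t = 1 - s := by linarith
    rw [← hme]; module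
  have hdet : ∀ y, det (V - A) (y - V) = det (V - A) (y - m) := by
    intro y
    have : y - V = (y - m) + (-s) • (V - A) := by
      rw [neg_smul, ← hmV]; abel
    rw [this, det_add_smul, det_self]; ring
  rcases lt_or_ge 0 (σ * det (V - A) (B - V)) with h | h
  · have hopen : IsOpen {y : Plane | 0 < σ * det (B - V) (y - V)} :=
      isOpen_lt continuous_const (by fun_prop)
    have hm' : m ∈ {y : Plane | 0 < σ * det (B - V) (y - V)} := by
      change 0 < σ * det (B - V) (m - V)
      have : det (B - V) (-(s • (V - A))) = s * det (V - A) (B - V) := by simp [det]; ring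
      rw [hmV, this]
      have := mul_pos hs0 h
      linarith
    filter_upwards [hm, hopen.mem_nhds hm'] with y hy hy2 hy1
    exact hy (Or.inl ⟨h, by rwa [hdet], hy2⟩)
  · filter_upwards [hm] with y hy hy1
    exact hy (Or.inr ⟨h, Or.inl (by rwa [hdet])⟩)

lemma halfGerm_right_of_sector {c : α} {σ : ℝ}
    (hs : ∀ᶠ y in 𝓝 V, y - V ∈ sector σ (V - A) (B - V) → f y = c) :
    ∀ᶠ m in 𝓝 V, m ∈ openSegment ℝ V B → HalfGerm f (B - V) m σ c := by
  filter_upwards [eventually_eventually_nhds.2 hs] with m hm hmem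
  obtain ⟨s, t, hs0, ht0, hst, hme⟩ := hmem
  have hmV : m - V = t • (B - V) := by
    obtain rfl : s = 1 - t := by linarith
    rw [← hme]; module
  have hdet : ∀ y, det (B - V) (y - V) = det (B - V) (y - m) := by
    intro y
    have : y - V = (y - m) + t • (B - V) := by
      rw [← hmV]; abel
    rw [this, det_add_smul, det_self]; ring
  rcases lt_or_ge 0 (σ * det (V - A) (B - V)) with h | h
  · have hopen : IsOpen {y : Plane | 0 < σ * det (V - A) (y - V)} :=
      isOpen_lt continuous_const (by fun_prop)
    have hm' : m ∈ {y : Plane | 0 < σ * det (V - A) (y - V)} := by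
      change 0 < σ * det (V - A) (m - V)
      rw [hmV, det_smul_right]
      have := mul_pos ht0 h
      linarith
    filter_upwards [hm, hopen.mem_nhds hm'] with y hy hy2 hy1
    exact hy (Or.inl ⟨h, hy2, by rwa [hdet]⟩)
  · filter_upwards [hm] with y hy hy1
    exact hy (Or.inr ⟨h, Or.inr (by rwa [hdet])⟩)

lemma exists_near_openSegment_left {A V : Plane} {p : Plane → Prop} (hp : ∀ᶠ m in 𝓝 V, p m) :
    ∃ m ∈ openSegment ℝ A V, p m := by
  have h1 : V ∈ closure (openSegment ℝ A V) := by
    rw [closure_openSegment]; exact right_mem_segment _ _ _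
  obtain ⟨m, hm, hm'⟩ := ((mem_closure_iff_frequently.1 h1).and_eventually hp).exists
  exact ⟨m, hm, hm'⟩

/-- The values of `f` on one side of a segment of `S`. -/
lemma exists_halfGerm_edge (hAB : A ≠ B)
    (hc : ∀ m ∈ openSegment ℝ A B, Corner S m A B)
    (hf : ∀ T, IsPreconnected T → Disjoint T S → ∀ x ∈ T, ∀ y ∈ T, f x = f y)
    {σ : ℝ} (hσ : σ ≠ 0) :
    ∃ c, ∀ m ∈ openSegment ℝ A B, HalfGerm f (B - A) m σ c := by
  have hd : B - A ≠ 0 := sub_ne_zero.2 hAB.symm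
  have h1 : ∀ m : Plane, ∃ c, m ∈ openSegment ℝ A B → HalfGerm f (B - A) m σ c := by
    intro m
    by_cases hm : m ∈ openSegment ℝ A B
    · obtain ⟨c, hcc⟩ := (hc m hm).exists_germ hf hσ
      refine ⟨c, fun _ => ?_⟩
      filter_upwards [hcc] with y hy hy1
      obtain ⟨s, t, hs0, ht0, hst, hme⟩ := hm
      obtain rfl : t = 1 - s := by linarith
      have e1 : m - A = (1 - s) • (B - A) := by rw [← hme]; module
      have e2 : B - m = s • (B - A) := by rw [← hme]; module
      refine hy (Or.inr ⟨?_, Or.inl ?_⟩)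
      · rw [e1, e2, det_smul_left, det_smul_right, det_self]; simp
      · rw [e1, det_smul_left]
        have := mul_pos ht0 hy1
        linarith
    · exact ⟨f m, fun h => absurd h hm⟩
  choose g hg using h1
  have key : ∀ m ∈ openSegment ℝ A B, ∀ m' ∈ openSegment ℝ A B, g m = g m' := by
    -- With the discrete topology on the values, local constancy along the open segment becomes
    -- continuity on a connected set.
    let _ : TopologicalSpace α := ⊥
    have : DiscreteTopology α := ⟨rfl⟩
    have hcont : ContinuousOn g (openSegment ℝ A B) := by
      intro m hm
      refine ContinuousWithinAt.congr_of_eventuallyEq (f := fun _ => g m)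
        continuousWithinAt_const ?_ rfl
      filter_upwards [nhdsWithin_le_nhds (eventually_eventually_nhds.2 (hg m hm)),
        self_mem_nhdsWithin] with m' hm' hm's
      refine (hg m' hm's).unique hd hσ ?_
      filter_upwards [hm'] with y hy hy1
      apply hy
      obtain ⟨s, t, hs0, ht0, hst, rfl⟩ := hm
      obtain ⟨s', t', hs0', ht0', hst', rfl⟩ := hm's
      obtain rfl : t = 1 - s := by linarith
      obtain rfl : t' = 1 - s' := by linarith
      have : y - (s • A + (1 - s) • B) =
          (y - (s' • A + (1 - s') • B)) + (s - s') • (B - A) := by module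
      rw [this, det_add_smul, det_self, mul_zero, add_zero]
      exact hy1
    intro m hm m' hm'
    exact (convex_openSegment A B).isPreconnected.constant hcont hm hm'
  have hmid : midpoint ℝ A B ∈ openSegment ℝ A B :=
    ⟨1/2, 1/2, by norm_num, by norm_num, by norm_num, by
      rw [midpoint_eq_smul_add, smul_add]; norm_num⟩
  exact ⟨g (midpoint ℝ A B), fun m hm => key m hm _ hmid ▸ hg m hm⟩

end Germ

/-! ### Simple cycles -/

/-- The `t`-th edge of a sequence of points. -/
def edge (Q : ℕ → Plane) (t : ℕ) : Set Plane := segment ℝ (Q t) (Q (t + 1))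

/-- The union of all edges of a sequence of points. -/
def bd (Q : ℕ → Plane) : Set Plane := ⋃ t, edge Q t

/-- An `n`-periodic sequence of points that runs through the vertices of a simple polygon. -/
structure SimpleCycle (n : ℕ) (Q : ℕ → Plane) : Prop where
  three_le : 3 ≤ n
  periodic : ∀ t, Q (t + n) = Q t
  ne : ∀ t, Q t ≠ Q (t + 1)
  consecutive : ∀ t, edge Q t ∩ edge Q (t + 1) = {Q (t + 1)}
  nonconsecutive : ∀ s t, s + 1 < t → t + 1 < s + n → Disjoint (edge Q s) (edge Q t)

/-- The polygonal line that starts at `Q s` and has `k` edges. -/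
def arc (Q : ℕ → Plane) : ℕ → ℕ → List Plane
  | s, 0 => [Q s]
  | s, k + 1 => Q s :: arc Q (s + 1) k

lemma arc_cons (Q : ℕ → Plane) (s k : ℕ) : ∃ l, arc Q s k = Q s :: l := by
  cases k <;> simp [arc]

@[simp] lemma head?_arc (Q : ℕ → Plane) (s k : ℕ) : (arc Q s k).head? = some (Q s) := by
  obtain ⟨l, hl⟩ := arc_cons Q s k
  simp [hl]

@[simp] lemma getLast?_arc (Q : ℕ → Plane) (s k : ℕ) :
    (arc Q s k).getLast? = some (Q (s + k)) := by
  induction k generalizing s with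
  | zero => simp [arc]
  | succ k ih =>
    have := ih (s + 1)
    obtain ⟨l, hl⟩ := arc_cons Q (s + 1) k
    rw [arc, hl, List.getLast?_cons_cons, ← hl, this]
    congr 2; omega

lemma mem_carrier_arc {Q : ℕ → Plane} {s k : ℕ} {x : Plane} :
    x ∈ carrier (arc Q s k) ↔ x = Q s ∨ ∃ i < k, x ∈ edge Q (s + i) := by
  induction k generalizing s with
  | zero => simp [arc]
  | succ k ih =>
    obtain ⟨l, hl⟩ := arc_cons Q (s + 1) k
    rw [arc, hl, carrier_cons_cons, ← hl, mem_union, ih]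
    constructor
    · rintro (h | rfl | ⟨i, hi, h⟩)
      · exact Or.inr ⟨0, by omega, h⟩
      · exact Or.inr ⟨0, by omega, right_mem_segment _ _ _⟩
      · exact Or.inr ⟨i + 1, by omega, by rwa [show s + (i + 1) = s + 1 + i by omega]⟩
    · rintro (rfl | ⟨i, hi, h⟩)
      · exact Or.inl (left_mem_segment _ _ _)
      · rcases i with _ | i
        · exact Or.inl h
        · exact Or.inr (Or.inr ⟨i, by omega, by rwa [show s + 1 + i = s + (i + 1) by omega]⟩)

lemma arc_append (Q : ℕ → Plane) (s j k : ℕ) :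
    arc Q s (j + k) = (arc Q s j).dropLast ++ arc Q (s + j) k := by
  induction j generalizing s with
  | zero => simp [arc]
  | succ j ih =>
    rw [show j + 1 + k = (j + k) + 1 by omega, arc, ih, arc]
    obtain ⟨l, hl⟩ := arc_cons Q (s + 1) j
    rw [hl, List.dropLast_cons_cons, ← hl, show s + (j + 1) = s + 1 + j by omega]
    rfl

lemma arc_dropLast_append (Q : ℕ → Plane) (s j : ℕ) :
    (arc Q s j).dropLast ++ [Q (s + j)] = arc Q s j := by
  have := arc_append Q s j 0
  rw [add_zero] at this
  exact this.symm

lemma angSum_arc (Q : ℕ → Plane) (s j k : ℕ) (x : Plane) :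
    angSum (arc Q s (j + k)) x = angSum (arc Q s j) x + angSum (arc Q (s + j) k) x := by
  obtain ⟨l, hl⟩ := arc_cons Q (s + j) k
  rw [arc_append, hl, angSum_append, arc_dropLast_append]

lemma carrier_arc_subset (Q : ℕ → Plane) (s k : ℕ) : carrier (arc Q s k) ⊆ bd Q := by
  intro x hx
  rcases mem_carrier_arc.1 hx with rfl | ⟨i, -, h⟩
  · exact mem_iUnion.2 ⟨s, left_mem_segment _ _ _⟩
  · exact mem_iUnion.2 ⟨_, h⟩

namespace SimpleCycle

variable {n : ℕ} {Q : ℕ → Plane}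

lemma edge_periodic (h : SimpleCycle n Q) (t : ℕ) : edge Q (t + n) = edge Q t := by
  unfold edge
  rw [h.periodic, show t + n + 1 = t + 1 + n by omega, h.periodic]

lemma edge_mod (h : SimpleCycle n Q) (t k : ℕ) : edge Q (t + k * n) = edge Q t := by
  induction k with
  | zero => simp
  | succ k ih => rw [show t + (k + 1) * n = t + k * n + n by ring, h.edge_periodic, ih]

lemma shift (h : SimpleCycle n Q) (s : ℕ) : SimpleCycle n (fun t => Q (s + t)) where
  three_le := h.three_le
  periodic t := by rw [← add_assoc]; exact h.periodic (s + t)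
  ne t := h.ne (s + t)
  consecutive t := h.consecutive (s + t)
  nonconsecutive i j h1 h2 := h.nonconsecutive (s + i) (s + j) (by omega) (by omega)

lemma mem_bd (h : SimpleCycle n Q) (s : ℕ) {x : Plane} :
    x ∈ bd Q ↔ ∃ i < n, x ∈ edge Q (s + i) := by
  have hn := h.three_le
  constructor
  · intro hx
    obtain ⟨t, ht⟩ := mem_iUnion.1 hx
    -- The residue of t - s modulo n, with `s * n` added to stay within natural numbers.
    have h1 : t + s * n = s + (t + s * (n - 1)) % n + ((t + s * (n - 1)) / n) * n := by
      have h2 := Nat.mod_add_div' (t + s * (n - 1)) n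
      obtain ⟨k, rfl⟩ : ∃ k, n = k + 1 := ⟨n - 1, by omega⟩
      simp only [Nat.add_sub_cancel] at h2 ⊢
      linarith
    refine ⟨(t + s * (n - 1)) % n, Nat.mod_lt _ (by omega), ?_⟩
    rw [← h.edge_mod t s, h1, h.edge_mod] at ht
    exact ht
  · rintro ⟨i, -, hi⟩
    exact mem_iUnion.2 ⟨_, hi⟩

lemma bd_shift (h : SimpleCycle n Q) (s : ℕ) : bd (fun t => Q (s + t)) = bd Q := by
  ext x
  rw [(h.shift s).mem_bd 0, h.mem_bd s]
  simp [edge, add_assoc]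

lemma bd_eq (h : SimpleCycle n Q) (s : ℕ) : bd Q = carrier (arc Q s n) := by
  ext x
  rw [h.mem_bd s, mem_carrier_arc]
  refine ⟨Or.inr, ?_⟩
  rintro (rfl | h')
  · exact ⟨0, by have := h.three_le; omega, left_mem_segment _ _ _⟩
  · exact h'

lemma isCompact_bd (h : SimpleCycle n Q) : IsCompact (bd Q) := by
  rw [h.bd_eq 0]; exact isCompact_carrier _

lemma isClosed_bd (h : SimpleCycle n Q) : IsClosed (bd Q) := h.isCompact_bd.isClosed

lemma isClosed_edge (t : ℕ) : IsClosed (edge Q t) := by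
  unfold edge
  rw [segment_eq_image_lineMap]
  exact (isCompact_Icc.image (by fun_prop)).isClosed

/-- Two edges meet only when they are cyclically consecutive, in their common vertex. -/
lemma edge_inter (h : SimpleCycle n Q) {t i : ℕ} (hi0 : 0 < i) (hi : i < n) {x : Plane}
    (hx : x ∈ edge Q t) (hx' : x ∈ edge Q (t + i)) :
    (i = 1 ∧ x = Q (t + 1)) ∨ (i = n - 1 ∧ x = Q t) := by
  have hn := h.three_le
  by_cases h1 : i = 1
  · subst h1
    have : x ∈ edge Q t ∩ edge Q (t + 1) := ⟨hx, hx'⟩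
    rw [h.consecutive] at this
    exact Or.inl ⟨rfl, this⟩
  by_cases h2 : i = n - 1
  · subst h2
    rw [← h.edge_periodic t, show t + n = t + (n - 1) + 1 by omega] at hx
    have : x ∈ edge Q (t + (n - 1)) ∩ edge Q (t + (n - 1) + 1) := ⟨hx', hx⟩
    rw [h.consecutive, show t + (n - 1) + 1 = t + n by omega, h.periodic] at this
    exact Or.inr ⟨rfl, this⟩
  · exact absurd ⟨hx, hx'⟩ (fun hh =>
      (h.nonconsecutive t (t + i) (by omega) (by omega)).le_bot hh)

lemma eventually_edge (x : Plane) (s : ℕ) :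
    ∀ᶠ y in 𝓝 x, ∀ i ∈ Finset.range n, y ∈ edge Q (s + i) → x ∈ edge Q (s + i) := by
  rw [Filter.eventually_all_finset]
  intro i _
  by_cases hx : x ∈ edge Q (s + i)
  · exact Eventually.of_forall fun _ _ => hx
  · filter_upwards [(isClosed_edge (s + i)).isOpen_compl.mem_nhds hx] with y hy hy'
    exact absurd hy' hy

lemma left_mem_edge (t : ℕ) : Q t ∈ edge Q t := left_mem_segment _ _ _

lemma right_mem_edge (t : ℕ) : Q (t + 1) ∈ edge Q t := right_mem_segment _ _ _

lemma corner_edge (h : SimpleCycle n Q) {t : ℕ} {m : Plane}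
    (hm : m ∈ openSegment ℝ (Q t) (Q (t + 1))) : Corner (bd Q) m (Q t) (Q (t + 1)) := by
  have hn := h.three_le
  have hms : m ∈ edge Q t := openSegment_subset_segment _ _ _ hm
  have hne := h.ne t
  have hl : Q t ≠ m := by
    rintro rfl; exact hne (left_mem_openSegment_iff.1 hm)
  have hr : Q (t + 1) ≠ m := by
    rintro rfl; exact hne (right_mem_openSegment_iff.1 hm)
  have hsub : edge Q t ⊆ bd Q := subset_iUnion _ _
  refine ⟨hl, hr, ?_, ?_, ?_, ?_⟩
  · exact ((convex_segment _ _).segment_subset (left_mem_segment _ _ _) hms).trans hsub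
  · exact ((convex_segment _ _).segment_subset hms (right_mem_segment _ _ _)).trans hsub
  · filter_upwards [eventually_edge (n := n) (Q := Q) m t] with y hy hyS
    obtain ⟨i, hi, hyi⟩ := (h.mem_bd t).1 hyS
    have hmi := hy i (Finset.mem_range.2 hi) hyi
    have hi0 : i = 0 := by
      by_contra h0
      rcases h.edge_inter (Nat.pos_of_ne_zero h0) hi hms hmi with ⟨-, h1⟩ | ⟨-, h1⟩
      · exact hr h1.symm
      · exact hl h1.symm
    subst hi0
    have hyi : y ∈ segment ℝ (Q t) (Q (t + 1)) := hyi
    have hms : m ∈ segment ℝ (Q t) (Q (t + 1)) := hms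
    exact mem_segment_split hms hyi
  · intro _
    obtain ⟨a, b, ha, hb, hab, rfl⟩ := hm
    obtain rfl : b = 1 - a := by linarith
    refine ⟨a / (1 - a), by positivity, ?_⟩
    apply plane_ext <;> simp <;> field_simp <;> ring

lemma corner_vertex (h : SimpleCycle n Q) (t : ℕ) :
    Corner (bd Q) (Q (t + 1)) (Q t) (Q (t + 2)) := by
  have hn := h.three_le
  refine ⟨h.ne t, (h.ne (t + 1)).symm, subset_iUnion (edge Q) t,
    subset_iUnion (edge Q) (t + 1), ?_, ?_⟩
  · filter_upwards [eventually_edge (n := n) (Q := Q) (Q (t + 1)) t] with y hy hyS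
    obtain ⟨i, hi, hyi⟩ := (h.mem_bd t).1 hyS
    have hmi := hy i (Finset.mem_range.2 hi) hyi
    by_cases h0 : i = 0
    · subst h0; exact Or.inl hyi
    rcases h.edge_inter (Nat.pos_of_ne_zero h0) hi (right_mem_edge t) hmi with
      ⟨rfl, -⟩ | ⟨-, h1⟩
    · exact Or.inr hyi
    · exact absurd h1.symm (h.ne t)
  · intro h0
    have hu : Q (t + 1) - Q t ≠ 0 := sub_ne_zero.2 (h.ne t).symm
    obtain ⟨μ, hμ⟩ := exists_smul_of_det_eq_zero hu h0
    refine ⟨μ, ?_, hμ⟩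
    by_contra! hle
    have hμ0 : μ ≠ 0 := by
      rintro rfl
      rw [zero_smul, sub_eq_zero] at hμ
      exact h.ne (t + 1) hμ.symm
    have hneg : μ < 0 := lt_of_le_of_ne hle hμ0
    -- If the second edge folded back onto the first, going the fraction r along it would reach a
    -- point of both edges other than the vertex; this r makes both r and -μr at most 1.
    set r : ℝ := 1 / (1 - μ) with hr
    have hp : 0 < 1 - μ := by linarith
    have hr0 : 0 < r := by positivity
    have hr1 : r ≤ 1 := by rw [hr, div_le_one hp]; linarith
    have hr2 : -(μ * r) ≤ 1 := by
      rw [hr, mul_one_div, ← neg_div, div_le_one hp]; linarith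
    have hx : Q (t + 1) + (r * μ) • (Q (t + 1) - Q t) ∈ edge Q t ∩ edge Q (t + 1) := by
      constructor
      · unfold edge
        rw [segment_symm]
        refine mem_segment_of_sub_eq (r := -(r * μ)) (by nlinarith) (by linarith) ?_
        module
      · refine mem_segment_of_sub_eq (r := r) hr0.le hr1 ?_
        rw [show t + 1 + 1 = t + 2 from rfl, hμ]
        module
    rw [h.consecutive, mem_singleton_iff, add_eq_left, smul_eq_zero] at hx
    rcases hx with hx | hx
    · exact (mul_ne_zero hr0.ne' hμ0) hx
    · exact hu hx

/-! ### The two sides of a simple polygon -/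

/-- A function that is constant on connected sets off the polygon takes at most two values
there, one on each side of the boundary. -/
lemma exists_sides (h : SimpleCycle n Q) {α : Type*} {f : Plane → α}
    (hf : ∀ T, IsPreconnected T → Disjoint T (bd Q) → ∀ x ∈ T, ∀ y ∈ T, f x = f y) :
    ∃ c c' : α, (∀ t, ∀ m ∈ openSegment ℝ (Q t) (Q (t + 1)),
        HalfGerm f (Q (t + 1) - Q t) m 1 c ∧ HalfGerm f (Q (t + 1) - Q t) m (-1) c') ∧
      ∀ x ∉ bd Q, f x = c ∨ f x = c' := by
  have hd : ∀ t, Q (t + 1) - Q t ≠ 0 := fun t => sub_ne_zero.2 (h.ne t).symm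
  have main : ∀ σ : ℝ, σ ≠ 0 → ∃ c : α,
      (∀ t, ∀ m ∈ openSegment ℝ (Q t) (Q (t + 1)), HalfGerm f (Q (t + 1) - Q t) m σ c) ∧
      ∀ t, ∀ᶠ y in 𝓝 (Q (t + 1)),
        y - Q (t + 1) ∈ sector σ (Q (t + 1) - Q t) (Q (t + 2) - Q (t + 1)) → f y = c := by
    intro σ hσ
    have hE : ∀ t, ∃ c, ∀ m ∈ openSegment ℝ (Q t) (Q (t + 1)),
        HalfGerm f (Q (t + 1) - Q t) m σ c := fun t =>
      exists_halfGerm_edge (h.ne t) (fun m hm => h.corner_edge hm) hf hσ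
    choose c hc using hE
    have hV : ∀ t, ∃ c, ∀ᶠ y in 𝓝 (Q (t + 1)),
        y - Q (t + 1) ∈ sector σ (Q (t + 1) - Q t) (Q (t + 2) - Q (t + 1)) → f y = c := fun t =>
      (h.corner_vertex t).exists_germ hf hσ
    choose c' hc' using hV
    -- The value on side σ is transported from edge t to the vertex after it and on to edge t + 1,
    -- hence all around the polygon.
    have e1 : ∀ t, c t = c' t := by
      intro t
      obtain ⟨m, hm, hg⟩ := exists_near_openSegment_left (A := Q t)
        (halfGerm_left_of_sector (hc' t))
      exact (hc t m hm).unique (hd t) hσ (hg hm)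
    have e2 : ∀ t, c (t + 1) = c' t := by
      intro t
      obtain ⟨m, hm, hg⟩ := exists_near_openSegment_left (A := Q (t + 2))
        (halfGerm_right_of_sector (hc' t))
      rw [openSegment_symm] at hm
      exact (hc (t + 1) m hm).unique (hd (t + 1)) hσ (hg hm)
    have e3 : ∀ t, c t = c 0 := by
      intro t
      induction t with
      | zero => rfl
      | succ t ih => rw [e2, ← e1, ih]
    exact ⟨c 0, fun t => e3 t ▸ hc t, fun t => (e1 t ▸ e3 t : c' t = c 0) ▸ hc' t⟩
  obtain ⟨c, hcE, hcV⟩ := main 1 one_ne_zero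
  obtain ⟨c', hcE', hcV'⟩ := main (-1) (by norm_num)
  refine ⟨c, c', fun t m hm => ⟨hcE t m hm, hcE' t m hm⟩, ?_⟩
  have near : ∀ q ∈ bd Q, ∀ᶠ y in 𝓝 q, y ∉ bd Q → f y = c ∨ f y = c' := by
    intro q hq
    obtain ⟨i, hi, hqi⟩ := (h.mem_bd 1).1 hq
    rw [add_comm] at hqi
    have hvert : ∀ t, ∀ᶠ y in 𝓝 (Q (t + 1)), y ∉ bd Q → f y = c ∨ f y = c' := by
      intro t
      filter_upwards [(h.corner_vertex t).mem_sector_of_notMem, hcV t, hcV' t] with y h1 h2 h3 h4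
      exact (h1 h4).imp h2 h3
    have hqi' : q ∈ insert (Q (i + 1)) (insert (Q (i + 1 + 1))
        (openSegment ℝ (Q (i + 1)) (Q (i + 1 + 1)))) := by
      rw [insert_endpoints_openSegment]; exact hqi
    rcases hqi' with rfl | rfl | hm
    · exact hvert i
    · exact hvert (i + 1)
    · have hcor := h.corner_edge hm
      have g1 := hcE _ q hm
      have g2 := hcE' _ q hm
      filter_upwards [hcor.mem_sector_of_notMem, g1, g2] with y h1 h2 h3 h4
      obtain ⟨s, t, hs0, ht0, hst, hme⟩ := hm
      obtain rfl : t = 1 - s := by linarith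
      have e1 : q - Q (i + 1) = (1 - s) • (Q (i + 1 + 1) - Q (i + 1)) := by rw [← hme]; module
      have e2 : Q (i + 1 + 1) - q = s • (Q (i + 1 + 1) - Q (i + 1)) := by rw [← hme]; module
      have hpos : ∀ σ : ℝ, y - q ∈ sector σ (q - Q (i + 1)) (Q (i + 1 + 1) - q) →
          0 < σ * det (Q (i + 1 + 1) - Q (i + 1)) (y - q) := by
        intro σ hsec
        rw [e1, e2] at hsec
        simp only [sector, det_smul_left] at hsec
        rcases hsec with ⟨-, hs, -⟩ | ⟨-, hs | hs⟩
        · exact (mul_pos_iff_of_pos_left ht0).1 (by linarith)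
        · exact (mul_pos_iff_of_pos_left ht0).1 (by linarith)
        · exact (mul_pos_iff_of_pos_left hs0).1 (by linarith)
      exact (h1 h4).imp (fun hs => h2 (hpos _ hs)) (fun hs => h3 (hpos _ hs))
  intro x hx
  have hne : (bd Q).Nonempty := ⟨Q 0, mem_iUnion.2 ⟨0, left_mem_edge 0⟩⟩
  obtain ⟨q, hq, hqd⟩ := h.isCompact_bd.exists_infDist_eq_dist hne x
  have hxq : x ≠ q := by rintro rfl; exact hx hq
  -- The segment from x to a nearest boundary point q misses the boundary except at q, so f x is a
  -- value taken near q.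
  let T : Set Plane := (fun t : ℝ => AffineMap.lineMap q x t) '' Ioc (0:ℝ) 1
  have hT : IsPreconnected T := isPreconnected_Ioc.image _ (by fun_prop)
  have hTd : Disjoint T (bd Q) := by
    rw [Set.disjoint_left]
    rintro _ ⟨t, ⟨ht0, ht1⟩, rfl⟩ hmem
    have h1 := Metric.infDist_le_dist_of_mem (x := x) hmem
    rw [hqd, dist_right_lineMap, Real.norm_of_nonneg (by linarith), dist_comm x q] at h1
    have := dist_pos.2 hxq.symm
    nlinarith
  have hlim : Tendsto (fun t : ℝ => AffineMap.lineMap q x t) (𝓝[>] 0) (𝓝 q) := by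
    have : Tendsto (fun t : ℝ => AffineMap.lineMap q x t) (𝓝 0)
      (𝓝 (AffineMap.lineMap q x (0:ℝ))) := Continuous.tendsto (by fun_prop) _
    rw [AffineMap.lineMap_apply_zero] at this
    exact this.mono_left nhdsWithin_le_nhds
  obtain ⟨t, ht, ht'⟩ := ((hlim.eventually (near q hq)).and
    (Ioc_mem_nhdsGT (zero_lt_one (α := ℝ)))).exists
  have htT : AffineMap.lineMap q x t ∈ T := ⟨t, ht', rfl⟩
  have hxT : x ∈ T := ⟨1, ⟨zero_lt_one, le_rfl⟩, by simp⟩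
  rw [hf T hT hTd x hxT _ htT]
  exact ht (fun hmem => hTd.le_bot ⟨htT, hmem⟩)

lemma isWind_boundary (h : SimpleCycle n Q) (s : ℕ) : IsWind (angSum (arc Q s n)) (bd Q) := by
  rw [h.bd_eq s]
  exact isWind_closed (head?_arc _ _ _) (by rw [getLast?_arc, h.periodic])

/-- The Jordan curve theorem for simple polygons, in terms of winding numbers. -/
lemma jordan (h : SimpleCycle n Q) :
    bd Q ⊆ closure (regionOf (bd Q))ᶜ ∧
      ∀ x ∈ insideOf (bd Q), angSum (arc Q 0 n) x ≠ 0 := by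
  have hn := h.three_le
  have hW := h.isWind_boundary 0
  -- Recording both data at once ties them together: one of the at most two values is (0, False),
  -- taken outside, and the jump makes the winding number of the other nonzero.
  let f : Plane → ℝ × Prop := fun x => (angSum (arc Q 0 n) x, x ∈ insideOf (bd Q))
  have hf : ∀ T, IsPreconnected T → Disjoint T (bd Q) → ∀ x ∈ T, ∀ y ∈ T, f x = f y := by
    intro T hT hd x hx y hy
    refine Prod.ext (hW.eq_of_isPreconnected hT hd hx hy) (propext ⟨?_, ?_⟩)
    · exact mem_insideOf_of_isPreconnected hT hd hx hy
    · exact mem_insideOf_of_isPreconnected hT hd hy hx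
  obtain ⟨c, c', hE, hx⟩ := h.exists_sides hf
  have hd : ∀ t, Q (t + 1) - Q t ≠ 0 := fun t => sub_ne_zero.2 (h.ne t).symm
  have hjump : c.1 ≠ c'.1 := by
    have hmid : midpoint ℝ (Q 0) (Q 1) ∈ openSegment ℝ (Q 0) (Q 1) :=
      ⟨1/2, 1/2, by norm_num, by norm_num, by norm_num, by
        rw [midpoint_eq_smul_add, smul_add]; norm_num⟩
    generalize midpoint ℝ (Q 0) (Q 1) = m at hmid
    obtain ⟨g1, g2⟩ := hE 0 m hmid
    have hsum : ∀ x, angSum (arc Q 0 n) x = ang (Q 0) (Q 1) x + angSum (arc Q 1 (n - 1)) x := by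
      intro x
      have := angSum_arc Q 0 1 (n - 1) x
      rw [show 1 + (n - 1) = n by omega] at this
      simpa [arc, angSum] using this
    have hcont : ContinuousAt (angSum (arc Q 1 (n - 1))) m := by
      apply continuousAt_angSum
      intro hm
      have hm0 : m ∈ edge Q 0 := openSegment_subset_segment _ _ _ hmid
      have hl : m ≠ Q 0 := by
        rintro rfl; exact h.ne 0 (left_mem_openSegment_iff.1 hmid)
      have hr : m ≠ Q 1 := by
        rintro rfl; exact h.ne 0 (right_mem_openSegment_iff.1 hmid)
      rcases mem_carrier_arc.1 hm with rfl | ⟨i, hi, hmi⟩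
      · exact hr rfl
      · rw [add_comm, ← zero_add (i + 1)] at hmi
        rcases h.edge_inter (by omega) (by omega) hm0 hmi with ⟨-, h1⟩ | ⟨-, h1⟩
        · exact hr h1
        · exact hl h1
    refine ang_jump hmid (h.ne 0) hsum hcont ?_ ?_
    · have hfr : ∃ᶠ y in 𝓝[{y | 0 < det (Q 1 - Q 0) (y - m)}] m, True := by
        rw [frequently_nhdsWithin_iff]
        exact (frequently_half (hd 0) m one_ne_zero).mono
          fun y hy => ⟨trivial, by rwa [one_mul] at hy⟩
      refine (hfr.and_eventually (eventually_nhdsWithin_iff.2 ?_)).mono fun y hy => hy.2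
      filter_upwards [g1] with y hy hy1
      have := hy (by rw [one_mul]; exact hy1)
      exact congrArg Prod.fst this
    · have hfr : ∃ᶠ y in 𝓝[{y | det (Q 1 - Q 0) (y - m) < 0}] m, True := by
        rw [frequently_nhdsWithin_iff]
        exact (frequently_half (σ := -1) (hd 0) m (by norm_num)).mono
          fun y hy => ⟨trivial, by change det (Q 1 - Q 0) (y - m) < 0; linarith⟩
      refine (hfr.and_eventually (eventually_nhdsWithin_iff.2 ?_)).mono fun y hy => hy.2
      filter_upwards [g2] with y hy hy1
      have hy1 : det (Q 1 - Q 0) (y - m) < 0 := hy1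
      have := hy (by change 0 < -1 * det (Q 1 - Q 0) (y - m); linarith)
      exact congrArg Prod.fst this
  obtain ⟨x₀, hx₀⟩ := exists_notMem_regionOf h.isCompact_bd.isBounded
  have hx₀bd : x₀ ∉ bd Q := fun h => hx₀ (Or.inl h)
  have hx₀in : x₀ ∉ insideOf (bd Q) := fun h => hx₀ (Or.inr h)
  have hf0 : f x₀ = (0, False) :=
    Prod.ext (hW.eq_zero_of_notMem (subset_regionOf _) hx₀) (eq_false hx₀in)
  have hin : ∀ x ∈ insideOf (bd Q), f x = (0, False) → False := by
    intro x hx h0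
    have : (x ∈ insideOf (bd Q)) = False := congrArg Prod.snd h0
    exact this ▸ hx
  -- The sign σ is the exterior side of every edge.
  have hext : ∃ σ : ℝ, σ ≠ 0 ∧ (∀ t, ∀ m ∈ openSegment ℝ (Q t) (Q (t + 1)),
      HalfGerm f (Q (t + 1) - Q t) m σ (0, False)) ∧
      ∀ x ∈ insideOf (bd Q), angSum (arc Q 0 n) x ≠ 0 := by
    rcases hx x₀ hx₀bd with h0 | h0
    · obtain rfl : c = (0, False) := h0.symm.trans hf0
      refine ⟨1, one_ne_zero, fun t m hm => (hE t m hm).1, fun x hxin => ?_⟩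
      rcases hx x hxin.1 with h1 | h1
      · exact (hin x hxin h1).elim
      · have : angSum (arc Q 0 n) x = c'.1 := congrArg Prod.fst h1
        rw [this]; exact hjump.symm
    · obtain rfl : c' = (0, False) := h0.symm.trans hf0
      refine ⟨-1, by norm_num, fun t m hm => (hE t m hm).2, fun x hxin => ?_⟩
      rcases hx x hxin.1 with h1 | h1
      · have : angSum (arc Q 0 n) x = c.1 := congrArg Prod.fst h1
        rw [this]; exact hjump
      · exact (hin x hxin h1).elim
  obtain ⟨σ, hσ, hg, hne⟩ := hext
  refine ⟨?_, hne⟩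
  intro q hq
  obtain ⟨t, ht⟩ := mem_iUnion.1 hq
  have hopen : openSegment ℝ (Q t) (Q (t + 1)) ⊆ closure (regionOf (bd Q))ᶜ := by
    intro m hm
    rw [mem_closure_iff_frequently]
    refine ((frequently_half (hd t) m hσ).and_eventually ((hg t m hm).and
      (h.corner_edge hm).near)).mono ?_
    rintro y ⟨h1, h2, h3⟩
    have h2 : (y ∈ insideOf (bd Q)) = False := congrArg Prod.snd (h2 h1)
    have h2' : y ∉ insideOf (bd Q) := fun hh => h2 ▸ hh
    rintro (hyb | hyi)
    · have hy4 : y ∈ segment ℝ (Q t) (Q (t + 1)) := by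
        rcases h3 hyb with h4 | h4
        · exact (convex_segment _ _).segment_subset (left_mem_segment _ _ _)
            (openSegment_subset_segment _ _ _ hm) h4
        · exact (convex_segment _ _).segment_subset
            (openSegment_subset_segment _ _ _ hm) (right_mem_segment _ _ _) h4
      obtain ⟨a, b, ha, hb, hab, rfl⟩ := hy4
      obtain ⟨a', b', ha', hb', hab', rfl⟩ := hm
      obtain rfl : b = 1 - a := by linarith
      obtain rfl : b' = 1 - a' := by linarith
      have : a • Q t + (1 - a) • Q (t + 1) - (a' • Q t + (1 - a') • Q (t + 1)) =
        (a' - a) • (Q (t + 1) - Q t) := by module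
      rw [this, det_smul_right, det_self] at h1
      simp at h1
    · exact h2' hyi
  have := closure_minimal hopen isClosed_closure
  rw [closure_openSegment] at this
  exact this ht

end SimpleCycle

/-! ### Visibility near the boundary and crossing curves -/

/-- A small ball about q misses the cycle and contains an exterior point, where the winding number
vanishes. -/
lemma IsWind.eventually_eq_zero {W : Plane → ℝ} {C S : Set Plane} (hW : IsWind W C)
    (hC : IsClosed C) (hCS : C ⊆ regionOf S) {q : Plane} (hq : q ∉ C)
    (hqS : q ∈ closure (regionOf S)ᶜ) : ∀ᶠ y in 𝓝 q, W y = 0 := by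
  obtain ⟨r, hr, hball⟩ := Metric.eventually_nhds_iff_ball.1
    (hC.isOpen_compl.eventually_mem hq)
  obtain ⟨e, he, he'⟩ := ((mem_closure_iff_frequently.1 hqS).and_eventually
    (Metric.ball_mem_nhds q hr)).exists
  have hd : Disjoint (Metric.ball q r) C := by
    rw [Set.disjoint_left]; exact hball
  filter_upwards [Metric.ball_mem_nhds q hr] with y hy
  rw [hW.eq_of_isPreconnected (convex_ball q r).isPreconnected hd hy he']
  exact hW.eq_zero_of_notMem hCS he

/-- If the segment from V to y met S again, that point would lie on one of the two edges, and so
would y, which is close to V on the same ray. -/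
lemma Corner.disjoint_of_notMem {S : Set Plane} {V A B : Plane} (h : Corner S V A B) :
    ∀ᶠ y in 𝓝 V, y ∉ S → Disjoint (segment ℝ V y \ {V}) S := by
  obtain ⟨r, hr, hball⟩ := Metric.eventually_nhds_iff_ball.1 h.near
  filter_upwards [Metric.ball_mem_nhds V hr, eventually_lt_one h.sub_left_ne V,
    eventually_lt_one h.sub_right_ne V] with y hy hu hw hyS
  rw [Set.disjoint_left]
  rintro z ⟨hz, hzV⟩ hzS
  have hzb : z ∈ Metric.ball V r :=
    (convex_ball V r).segment_subset (Metric.mem_ball_self hr) hy hz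
  obtain ⟨s, hs, hzs⟩ := sub_eq_of_mem_segment_right hz
  have hs0 : s ≠ 0 := by
    rintro rfl
    rw [zero_smul, sub_eq_zero] at hzs
    exact hzV hzs
  have hyz : y - V = s⁻¹ • (z - V) := by
    rw [hzs, smul_smul, inv_mul_cancel₀ hs0, one_smul]
  rcases hball z hzb hzS with h1 | h1
  · obtain ⟨t, ht, hzt⟩ := sub_eq_of_mem_segment_left h1
    rw [hzt] at hyz
    have h3 := hu (-(s⁻¹ * t)) (by rw [hyz]; module)
    rw [abs_neg, abs_of_nonneg (by positivity)] at h3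
    refine hyS (h.left_subset ?_)
    rw [segment_symm]
    exact mem_segment_of_sub_eq (r := s⁻¹ * t) (by positivity) h3.le (by rw [hyz]; module)
  · obtain ⟨t, ht, hzt⟩ := sub_eq_of_mem_segment_right h1
    rw [hzt] at hyz
    have h3 := hw (s⁻¹ * t) (by rw [hyz]; module)
    rw [abs_of_nonneg (by positivity)] at h3
    exact hyS (h.right_subset
      (mem_segment_of_sub_eq (r := s⁻¹ * t) (by positivity) h3.le (by rw [hyz]; module)))

lemma isPreconnected_segment_diff (V y : Plane) : IsPreconnected (segment ℝ V y \ {V}) := by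
  by_cases hVy : V = y
  · subst hVy; simp [isPreconnected_empty]
  have : segment ℝ V y \ {V} = (fun t : ℝ => AffineMap.lineMap V y t) '' Ioc (0:ℝ) 1 := by
    ext z
    rw [segment_eq_image_lineMap]
    constructor
    · rintro ⟨⟨t, ⟨h0, h1⟩, rfl⟩, hz⟩
      refine ⟨t, ⟨lt_of_le_of_ne h0 ?_, h1⟩, rfl⟩
      rintro rfl
      simp at hz
    · rintro ⟨t, ⟨h0, h1⟩, rfl⟩
      refine ⟨⟨t, ⟨h0.le, h1⟩, rfl⟩, ?_⟩
      intro hz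
      have hz : AffineMap.lineMap V y t = V := hz
      rw [AffineMap.lineMap_eq_left_iff] at hz
      exact hz.elim hVy h0.ne'
  rw [this]
  exact isPreconnected_Ioc.image _ (by fun_prop)

/-- Near a point of `S` with a corner, a point of the region sees the corner. -/
lemma Corner.eventually_segment_subset {S : Set Plane} {V A B : Plane} (h : Corner S V A B) :
    ∀ᶠ y in 𝓝 V, y ∈ regionOf S → segment ℝ V y ⊆ regionOf S ∧
      (y ∈ insideOf S → segment ℝ V y \ {V} ⊆ insideOf S) := by
  filter_upwards [h.near, h.disjoint_of_notMem] with y h1 h2 hy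
  rcases hy with hyS | hyi
  · refine ⟨?_, fun h => absurd hyS h.1⟩
    refine Subset.trans ?_ (subset_regionOf S)
    rcases h1 hyS with h3 | h3
    · exact ((convex_segment _ _).segment_subset (right_mem_segment _ _ _) h3).trans h.left_subset
    · exact ((convex_segment _ _).segment_subset (left_mem_segment _ _ _) h3).trans h.right_subset
  · have key : segment ℝ V y \ {V} ⊆ insideOf S := by
      intro z hz
      refine mem_insideOf_of_isPreconnected (isPreconnected_segment_diff V y) (h2 hyi.1)
        ⟨right_mem_segment _ _ _, ?_⟩ hz hyi
      rintro rfl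
      exact hyi.1 h.mem
    refine ⟨fun z hz => ?_, fun _ => key⟩
    by_cases hzV : z = V
    · subst hzV; exact Or.inl h.mem
    · exact Or.inr (key ⟨hz, hzV⟩)

lemma eventually_segment_subset_of_mem_insideOf {S : Set Plane} (hS : IsClosed S) {x : Plane}
    (hx : x ∈ insideOf S) : ∀ᶠ y in 𝓝 x, segment ℝ x y ⊆ insideOf S := by
  obtain ⟨r, hr, hball⟩ := Metric.mem_nhds_iff.1 ((isOpen_insideOf hS).mem_nhds hx)
  filter_upwards [Metric.ball_mem_nhds x hr] with y hy
  exact ((convex_ball x r).segment_subset (Metric.mem_ball_self hr) hy).trans hball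

namespace SimpleCycle

variable {n : ℕ} {Q : ℕ → Plane}

lemma exists_corner (h : SimpleCycle n Q) {x : Plane} (hx : x ∈ bd Q) :
    ∃ A B, Corner (bd Q) x A B := by
  obtain ⟨i, hi, hxi⟩ := (h.mem_bd 1).1 hx
  rw [add_comm] at hxi
  have hx' : x ∈ insert (Q (i + 1)) (insert (Q (i + 1 + 1))
      (openSegment ℝ (Q (i + 1)) (Q (i + 1 + 1)))) := by
    rw [insert_endpoints_openSegment]; exact hxi
  rcases hx' with rfl | rfl | hm
  · exact ⟨_, _, h.corner_vertex i⟩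
  · exact ⟨_, _, h.corner_vertex (i + 1)⟩
  · exact ⟨_, _, h.corner_edge hm⟩

/-- A point of the region sees all nearby points of the region. -/
lemma eventually_segment_subset (h : SimpleCycle n Q) {x : Plane} (hx : x ∈ regionOf (bd Q)) :
    ∀ᶠ y in 𝓝 x, y ∈ regionOf (bd Q) → segment ℝ x y ⊆ regionOf (bd Q) := by
  rcases hx with hx | hx
  · obtain ⟨A, B, hc⟩ := h.exists_corner hx
    filter_upwards [hc.eventually_segment_subset] with y hy hyR
    exact (hy hyR).1
  · filter_upwards [eventually_segment_subset_of_mem_insideOf h.isClosed_bd hx] with y hy _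
    exact hy.trans (insideOf_subset_regionOf _)

lemma arc_inter (h : SimpleCycle n Q) {t : ℕ} (ht : t < n) {x : Plane}
    (hx : x ∈ carrier (arc Q 0 t)) (hx' : x ∈ carrier (arc Q t (n - t))) : x = Q 0 ∨ x = Q t := by
  rw [mem_carrier_arc] at hx hx'
  rcases hx with hx | ⟨i, hi, hxi⟩
  · exact Or.inl hx
  rcases hx' with hx' | ⟨j, hj, hxj⟩
  · exact Or.inr hx'
  rw [zero_add] at hxi
  rw [show t + j = i + (t + j - i) by omega] at hxj
  rcases h.edge_inter (by omega) (by omega) hxi hxj with ⟨h1, h2⟩ | ⟨h1, h2⟩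
  · right; rw [h2]; congr 1; omega
  · left; rw [h2]; congr 1; omega

/-- The line l cuts the boundary cycle into two cycles, and the winding numbers satisfy W₂ - W₁ = W
with W that of the whole boundary. If τ missed l, then just after its last visit to the second arc
both W₁ and W₂ would vanish at an inside point, where W does not. -/
lemma crossing_aux (h : SimpleCycle n Q) {t : ℕ} (ht : t < n) {l : List Plane}
    (hhead : l.head? = some (Q 0)) (hlast : l.getLast? = some (Q t))
    (hl : carrier l ⊆ regionOf (bd Q)) {u v : Plane} (τ : Path u v)
    (hτ : range τ ⊆ regionOf (bd Q)) (hu : u ∈ carrier (arc Q t (n - t)))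
    (hv : v ∈ carrier (arc Q 0 t)) : (carrier l ∩ range τ).Nonempty := by
  by_contra hemp
  have hdis : ∀ s, τ s ∉ carrier l := fun s hs => hemp ⟨_, hs, s, rfl⟩
  have h0l : Q 0 ∈ carrier l := mem_carrier_of_mem (List.mem_of_mem_head? hhead)
  have htl : Q t ∈ carrier l := mem_carrier_of_mem (List.mem_of_getLast? hlast)
  have hnot : ∀ s, τ s ∈ carrier (arc Q 0 t) → τ s ∉ carrier (arc Q t (n - t)) := by
    intro s h1 h2
    rcases h.arc_inter ht h1 h2 with h3 | h3
    · exact hdis s (h3 ▸ h0l)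
    · exact hdis s (h3 ▸ htl)
  obtain ⟨hJ1, hJ2⟩ := h.jordan
  have hclosed : ∀ l', IsClosed (carrier l') := fun l' => (isCompact_carrier l').isClosed
  have hW1 := isWind_sub hhead hlast (head?_arc Q 0 t) (by rw [getLast?_arc, zero_add])
  have hW2 := isWind_add hhead hlast (head?_arc Q t (n - t))
    (by rw [getLast?_arc, show t + (n - t) = 0 + n by omega, h.periodic])
  have hC1 : carrier l ∪ carrier (arc Q 0 t) ⊆ regionOf (bd Q) :=
    union_subset hl ((carrier_arc_subset _ _ _).trans (subset_regionOf _))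
  have hC2 : carrier l ∪ carrier (arc Q t (n - t)) ⊆ regionOf (bd Q) :=
    union_subset hl ((carrier_arc_subset _ _ _).trans (subset_regionOf _))
  have hK : IsCompact {s : unitInterval | τ s ∈ carrier (arc Q t (n - t))} :=
    ((hclosed _).preimage τ.continuous).isCompact
  -- After the last visit t0 to the second arc, τ stays off the second cycle, so W₂ keeps its value
  -- at the endpoint of τ. That endpoint is a boundary point off this cycle, so the value is zero.
  obtain ⟨t0, ht0mem, ht0max⟩ := hK.exists_isGreatest ⟨0, by
    change τ 0 ∈ carrier (arc Q t (n - t)); rw [τ.source]; exact hu⟩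
  have ht0mem : τ t0 ∈ carrier (arc Q t (n - t)) := ht0mem
  have hafter : ∀ s, t0 < s → τ s ∉ carrier (arc Q t (n - t)) := fun s hs hmem =>
    absurd (ht0max hmem) (not_le.2 hs)
  have hv1 : τ 1 ∈ carrier (arc Q 0 t) := by rw [τ.target]; exact hv
  have hlt1 : t0 < 1 := by
    refine lt_of_le_of_ne unitInterval.le_one' ?_
    rintro rfl
    exact hnot _ hv1 ht0mem
  have hq1 : τ t0 ∉ carrier (arc Q 0 t) := fun hh => hnot _ hh ht0mem
  have near1 := hW1.eventually_eq_zero ((hclosed _).union (hclosed _)) hC1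
    (q := τ t0) (by rintro (hh | hh); exacts [hdis _ hh, hq1 hh])
    (hJ1 (carrier_arc_subset _ _ _ ht0mem))
  have hv2 := (hW2.eventually_eq_zero ((hclosed _).union (hclosed _)) hC2
    (q := τ 1) (by rintro (hh | hh); exacts [hdis _ hh, hnot _ hv1 hh])
    (hJ1 (carrier_arc_subset _ _ _ hv1))).self_of_nhds
  have near2 : ∀ᶠ y in 𝓝 (τ t0), y ∉ carrier (arc Q 0 t) :=
    (hclosed _).isOpen_compl.eventually_mem hq1
  have : (𝓝[>] t0).NeBot := nhdsGT_neBot_of_exists_gt ⟨1, hlt1⟩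
  obtain ⟨s, ⟨hs1, hs2⟩, hs⟩ := (((τ.continuous.tendsto t0).mono_left nhdsWithin_le_nhds).eventually
    (near1.and near2) |>.and self_mem_nhdsWithin).exists (f := 𝓝[>] t0)
  have hs : t0 < s := hs
  let T : Set Plane := τ '' Ioc t0 1
  have hTpre : IsPreconnected T := isPreconnected_Ioc.image _ τ.continuous.continuousOn
  have hTd : Disjoint T (carrier l ∪ carrier (arc Q t (n - t))) := by
    rw [Set.disjoint_left]
    rintro _ ⟨r, hr, rfl⟩ (hh | hh)
    · exact hdis _ hh
    · exact hafter r hr.1 hh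
  have hzero := hW2.eq_of_isPreconnected hTpre hTd (x := τ s) (y := τ 1)
    ⟨s, ⟨hs, unitInterval.le_one'⟩, rfl⟩ ⟨1, ⟨hlt1, le_rfl⟩, rfl⟩
  rw [hv2] at hzero
  have hsum := angSum_arc Q 0 t (n - t) (τ s)
  rw [show t + (n - t) = n by omega, zero_add] at hsum
  refine hJ2 (τ s) ?_ (by rw [hsum]; linarith)
  refine (hτ ⟨s, rfl⟩).resolve_left fun hbd => ?_
  obtain ⟨i, hi, hmem⟩ := (h.mem_bd 0).1 hbd
  rcases lt_or_ge i t with hit | hit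
  · exact hs2 (mem_carrier_arc.2 (Or.inr ⟨i, hit, hmem⟩))
  · exact hafter s hs (mem_carrier_arc.2
      (Or.inr ⟨i - t, by omega, by rwa [show t + (i - t) = 0 + i by omega]⟩))

/-- Two curves in the region whose endpoints interlace on the boundary intersect. -/
lemma crossing (h : SimpleCycle n Q) {s t : ℕ} (hst : s < t) (ht : t < s + n) {l : List Plane}
    (hhead : l.head? = some (Q s)) (hlast : l.getLast? = some (Q t))
    (hl : carrier l ⊆ regionOf (bd Q)) {u v : Plane} (τ : Path u v)
    (hτ : range τ ⊆ regionOf (bd Q)) (hu : ∃ i, t ≤ i ∧ i < s + n ∧ u ∈ edge Q i)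
    (hv : ∃ i, s ≤ i ∧ i < t ∧ v ∈ edge Q i) : (carrier l ∩ range τ).Nonempty := by
  have hs := h.shift s
  have hbd := h.bd_shift s
  refine hs.crossing_aux (t := t - s) (by omega) hhead
    (by rwa [show s + (t - s) = t by omega]) (by rwa [hbd]) τ (by rwa [hbd]) ?_ ?_
  · obtain ⟨i, h1, h2, h3⟩ := hu
    refine mem_carrier_arc.2 (Or.inr ⟨i - t, by omega, ?_⟩)
    change u ∈ edge Q (s + (t - s + (i - t)))
    rwa [show s + (t - s + (i - t)) = i by omega]
  · obtain ⟨i, h1, h2, h3⟩ := hv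
    refine mem_carrier_arc.2 (Or.inr ⟨i - s, by omega, ?_⟩)
    change v ∈ edge Q (s + (0 + (i - s)))
    rwa [show s + (0 + (i - s)) = i by omega]

end SimpleCycle

/-! ### Taut polygonal lines -/

/-- Points chosen on either side of z along a segment still have z between them; this makes straight
passages taut. -/
lemma seg_between {p q x y z : Plane} (hz : z ∈ segment ℝ p q) (hx : x ∈ segment ℝ p z)
    (hy : y ∈ segment ℝ z q) : z ∈ segment ℝ x y := by
  rw [mem_segment_iff_wbtw] at *
  exact (hz.trans_left_right hx).trans_right_left hy

/-- The polygonal line from `p` via `q` to `s` cannot be shortened within `R` at `q`. -/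
def Turn (R : Set Plane) (p q s : Plane) : Prop :=
  ∀ x ∈ segment ℝ p q, ∀ y ∈ segment ℝ q s, x ≠ q → y ≠ q →
    convexHull ℝ {x, q, y} ⊆ R → q ∈ segment ℝ x y

lemma turn_of_mem_segment (R : Set Plane) {p q s : Plane} (h : q ∈ segment ℝ p s) :
    Turn R p q s := fun _ hx _ hy _ _ _ => seg_between h hx hy

namespace Turn

variable {R : Set Plane} {p q s p' s' : Plane}

lemma symm (h : Turn R p q s) : Turn R s q p := by
  intro x hx y hy hxq hyq hR
  rw [segment_symm]
  rw [segment_symm] at hx hy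
  refine h y hy x hx hyq hxq (Subset.trans (convexHull_mono ?_) hR)
  intro z hz
  simp only [mem_insert_iff, mem_singleton_iff] at hz ⊢
  tauto

lemma shrink_left (h : Turn R p q s) (hp : p' ∈ segment ℝ p q) : Turn R p' q s :=
  fun x hx y hy hxq hyq hR =>
    h x ((convex_segment _ _).segment_subset hp (right_mem_segment _ _ _) hx) y hy hxq hyq hR

lemma shrink_right (h : Turn R p q s) (hs : s' ∈ segment ℝ q s) : Turn R p q s' :=
  (h.symm.shrink_left (segment_symm ℝ q s ▸ hs)).symm

/-- Tautness at q depends only on the germs of the two edges: a larger triangle in R contains the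
one with corner p, and straightness at q then extends beyond p. -/
lemma grow_left (h : Turn R p q s) (hp : p ∈ segment ℝ p' q) (hpq : p ≠ q) : Turn R p' q s := by
  intro x hx y hy hxq hyq hR
  rcases mem_segment_split hp hx with hx' | hx'
  · have hpx : p ∈ segment ℝ x q := seg_between hp hx' (right_mem_segment _ _ _)
    have hsub : convexHull ℝ {p, q, y} ⊆ convexHull ℝ {x, q, y} := by
      apply convexHull_min _ (convex_convexHull ℝ _)
      have hss := subset_convexHull ℝ ({x, q, y} : Set Plane)
      rintro z (rfl | rfl | rfl)
      · exact (convex_convexHull ℝ _).segment_subset (hss (by simp)) (hss (by simp)) hpx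
      · exact hss (by simp)
      · exact hss (by simp)
    have h1 := h p (left_mem_segment _ _ _) y hy hpq hyq (hsub.trans hR)
    rw [mem_segment_iff_wbtw] at hpx h1 ⊢
    exact hpx.trans_expand_right h1 hpq
  · exact h x hx' y hy hxq hyq hR

lemma grow_right (h : Turn R p q s) (hs : s ∈ segment ℝ q s') (hsq : s ≠ q) : Turn R p q s' :=
  (h.symm.grow_left (segment_symm ℝ q s' ▸ hs) hsq).symm

end Turn

/-- A polygonal line in `R` that cannot be shortened at any of its interior vertices. -/
structure Taut (R : Set Plane) (l : List Plane) : Prop where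
  subset : carrier l ⊆ R
  ne : ∀ p q, [p, q] <:+: l → p ≠ q
  turn : ∀ p q s, [p, q, s] <:+: l → Turn R p q s

lemma pair_infix {p q : Plane} {A B : List Plane} {z : Plane} (h : [p, q] <:+: A ++ z :: B) :
    [p, q] <:+: A ++ [z] ∨ [p, q] <:+: z :: B := by
  induction A with
  | nil => exact Or.inr h
  | cons a A ih =>
    rw [List.cons_append, List.infix_cons_iff] at h
    rcases h with h | h
    · left
      refine List.IsPrefix.isInfix ?_
      cases A with
      | nil => simpa using h
      | cons b A => simpa using h
    · exact (ih h).imp_left fun h => List.infix_cons h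

lemma triple_infix {p q s : Plane} {A B : List Plane} {z : Plane}
    (h : [p, q, s] <:+: A ++ z :: B) :
    [p, q, s] <:+: A ++ [z] ∨ [p, q, s] <:+: z :: B ∨
      (q = z ∧ ∃ A' B', A = A' ++ [p] ∧ B = s :: B') := by
  induction A with
  | nil => exact Or.inr (Or.inl h)
  | cons a A ih =>
    rw [List.cons_append, List.infix_cons_iff] at h
    rcases h with h | h
    · match A with
      | [] =>
        simp only [List.nil_append, List.cons_prefix_cons] at h
        obtain ⟨rfl, rfl, h⟩ := h
        cases B with
        | nil => simp at h
        | cons b B =>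
          simp only [List.cons_prefix_cons, List.nil_prefix, and_true] at h
          subst h
          exact Or.inr (Or.inr ⟨rfl, [], B, rfl, rfl⟩)
      | [b] => exact Or.inl (List.IsPrefix.isInfix (by simpa using h))
      | b :: c :: A => exact Or.inl (List.IsPrefix.isInfix (by simpa using h))
    · rcases ih h with h | h | ⟨rfl, A', B', rfl, rfl⟩
      · exact Or.inl (List.infix_cons h)
      · exact Or.inr (Or.inl h)
      · exact Or.inr (Or.inr ⟨rfl, a :: A', B', rfl, rfl⟩)

lemma append_singleton_infix (A B : List Plane) (z : Plane) : A ++ [z] <:+: A ++ z :: B :=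
  ⟨[], B, by simp⟩

lemma cons_infix (A B : List Plane) (z : Plane) : z :: B <:+: A ++ z :: B :=
  ⟨A, [], by simp⟩

namespace Taut

variable {R : Set Plane} {l l' A B A' B' : List Plane} {p q s x y z : Plane}

lemma of_infix (h : Taut R l) (h' : l' <:+: l) : Taut R l' where
  subset := (carrier_mono h').trans h.subset
  ne p q hp := h.ne p q (hp.trans h')
  turn p q s hp := h.turn p q s (hp.trans h')

lemma left (h : Taut R (A ++ z :: B)) : Taut R (A ++ [z]) :=
  h.of_infix (append_singleton_infix A B z)

lemma right (h : Taut R (A ++ z :: B)) : Taut R (z :: B) := h.of_infix (cons_infix A B z)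

/-- The only new condition concerns the triple around z. -/
lemma append (h : Taut R (A ++ [z])) (h' : Taut R (z :: B))
    (ht : ∀ A' p s B', A = A' ++ [p] → B = s :: B' → Turn R p z s) : Taut R (A ++ z :: B) where
  subset := by rw [carrier_append]; exact union_subset h.subset h'.subset
  ne p q hp := (pair_infix hp).elim (h.ne p q) (h'.ne p q)
  turn p q s hp := by
    rcases triple_infix hp with h1 | h1 | ⟨rfl, A', B', h1, h2⟩
    · exact h.turn p q s h1
    · exact h'.turn p q s h1
    · exact ht A' p s B' h1 h2

/-- Taut polygonal lines that share an edge can be spliced. -/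
lemma splice (h : Taut R (A ++ x :: y :: B')) (h' : Taut R (A' ++ x :: y :: B)) :
    Taut R (A ++ x :: y :: B) := by
  -- Joining at y, the triple around y comes from the second line and the triple around x from the
  -- first: a shared edge leaves no new turn.
  have e1 : A ++ x :: y :: B = (A ++ [x]) ++ y :: B := by simp
  have e2 : A ++ x :: y :: B' = (A ++ [x]) ++ y :: B' := by simp
  rw [e1]
  rw [e2] at h
  refine h.left.append (h'.of_infix ⟨A' ++ [x], [], by simp⟩) ?_
  intro C p s D hC hD
  have hp : x = p := by
    have := congrArg List.getLast? hC
    simpa using this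
  subst hp hD
  exact h'.turn x y s ⟨A', D, by simp⟩

lemma reverse (h : Taut R l) : Taut R l.reverse where
  subset := by rw [carrier_reverse]; exact h.subset
  ne p q hp := by
    have := List.reverse_infix.2 hp
    rw [List.reverse_reverse] at this
    exact (h.ne q p (by simpa using this)).symm
  turn p q s hp := by
    have := List.reverse_infix.2 hp
    rw [List.reverse_reverse] at this
    exact (h.turn s q p (by simpa using this)).symm

lemma singleton (hx : x ∈ R) : Taut R [x] where
  subset := by simpa using hx
  ne p q hp := by have := hp.length_le; simp at this
  turn p q s hp := by have := hp.length_le; simp at this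

lemma pair (hxy : x ≠ y) (hR : segment ℝ x y ⊆ R) : Taut R [x, y] where
  subset := by
    rw [carrier_cons_cons, carrier_singleton]
    exact union_subset hR (singleton_subset_iff.2 (hR (right_mem_segment _ _ _)))
  ne p q hp := by
    have := hp.eq_of_length (by simp)
    simp only [List.cons.injEq, and_true] at this
    rw [this.1, this.2]; exact hxy
  turn p q s hp := by have := hp.length_le; simp at this

lemma segment_subset_carrier {l : List Plane} (h : [p, q] <:+: l) : segment ℝ p q ⊆ carrier l :=
  fun _ hx => Or.inr ⟨p, q, h, hx⟩

/-- A point of an edge may be inserted as a vertex. -/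
lemma insert (h : Taut R (A ++ p :: q :: B)) (hz : z ∈ segment ℝ p q) (hzp : z ≠ p)
    (hzq : z ≠ q) : Taut R (A ++ p :: z :: q :: B) := by
  have hpq : segment ℝ p q ⊆ R := fun y hy => h.subset (Or.inr ⟨p, q, ⟨A, B, by simp⟩, hy⟩)
  have h1 : segment ℝ p z ⊆ R :=
    ((convex_segment _ _).segment_subset (left_mem_segment _ _ _) hz).trans hpq
  have h2 : segment ℝ z q ⊆ R :=
    ((convex_segment _ _).segment_subset hz (right_mem_segment _ _ _)).trans hpq
  have hqs : z ∈ segment ℝ q p := segment_symm ℝ p q ▸ hz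
  have t1 : Taut R (A ++ p :: [z]) := by
    refine (h.left).append (pair hzp.symm h1) ?_
    rintro A' o s B' rfl hB
    simp only [List.cons.injEq] at hB
    obtain ⟨rfl, -⟩ := hB
    exact (h.turn o p q ⟨A', B, by simp⟩).shrink_right hz
  have t2 : Taut R ([z] ++ q :: B) := by
    refine Taut.append (pair hzq h2) (h.of_infix ⟨A ++ [p], [], by simp⟩) ?_
    rintro A' o s B' hA rfl
    have hz : z = o := by simpa using congrArg List.getLast? hA
    subst hz
    exact (h.turn p q s ⟨A, B', by simp⟩).shrink_left (by assumption)
  have e1 : A ++ p :: z :: q :: B = (A ++ [p]) ++ z :: q :: B := by simp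
  rw [e1]
  refine Taut.append (by simpa using t1) t2 ?_
  intro A' o s B' hA hB
  have ho : p = o := by simpa using congrArg List.getLast? hA
  simp only [List.cons.injEq] at hB
  obtain ⟨rfl, -⟩ := hB
  subst ho
  exact turn_of_mem_segment R hz

end Taut

/-! ### Taut lines between given endpoints -/

/-- A taut polygonal line in `R` from `x` to `y`. -/
structure Link (R : Set Plane) (x y : Plane) (l : List Plane) : Prop extends Taut R l where
  head : l.head? = some x
  last : l.getLast? = some y

namespace Link

variable {R : Set Plane} {l l' A B A' B' : List Plane} {p q s x y z x' y' : Plane}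

lemma left (h : Link R x y (A ++ z :: B)) : Link R x z (A ++ [z]) where
  toTaut := h.toTaut.left
  head := by have := h.head; cases A <;> simpa using this
  last := by simp

lemma right (h : Link R x y (A ++ z :: B)) : Link R z y (z :: B) where
  toTaut := h.toTaut.right
  head := rfl
  last := by have := h.last; simpa using this

lemma reverse (h : Link R x y l) : Link R y x l.reverse where
  toTaut := h.toTaut.reverse
  head := by rw [List.head?_reverse]; exact h.last
  last := by rw [List.getLast?_reverse]; exact h.head

lemma singleton (hx : x ∈ R) : Link R x x [x] := ⟨Taut.singleton hx, rfl, rfl⟩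

lemma pair (hxy : x ≠ y) (hR : segment ℝ x y ⊆ R) : Link R x y [x, y] :=
  ⟨Taut.pair hxy hR, rfl, rfl⟩

lemma head_mem (h : Link R x y l) : x ∈ l := List.mem_of_mem_head? h.head

lemma last_mem (h : Link R x y l) : y ∈ l := List.mem_of_getLast? h.last

lemma splice (h : Link R x y (A ++ p :: q :: B')) (h' : Link R x' y' (A' ++ p :: q :: B)) :
    Link R x y' (A ++ p :: q :: B) where
  toTaut := h.toTaut.splice h'.toTaut
  head := by have := h.head; cases A <;> simpa using this
  last := by have := h'.last; simpa using this

/-- Every point of a taut polygonal line may be made a vertex. -/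
lemma exists_insert (h : Link R x y l) (hz : z ∈ carrier l) :
    ∃ A B, Link R x y (A ++ z :: B) ∧ carrier (A ++ z :: B) = carrier l := by
  by_cases hmem : z ∈ l
  · obtain ⟨A, B, rfl⟩ := List.append_of_mem hmem
    exact ⟨A, B, h, rfl⟩
  · obtain ⟨p, q, ⟨A, B, rfl⟩, hzpq⟩ := hz.resolve_left hmem
    simp only [List.append_assoc, List.cons_append, List.nil_append] at h hmem hz ⊢
    have hzp : z ≠ p := by rintro rfl; simp at hmem
    have hzq : z ≠ q := by rintro rfl; simp at hmem
    refine ⟨A ++ [p], q :: B, ?_, ?_⟩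
    · refine ⟨by simpa using h.toTaut.insert hzpq hzp hzq, ?_, ?_⟩
      · have := h.head; cases A <;> simpa using this
      · have := h.last; simpa using this
    · have e1 : A ++ [p] ++ z :: q :: B = A ++ p :: z :: q :: B := by simp
      rw [e1, carrier_append, carrier_append A (q :: B), carrier_cons_cons, carrier_cons_cons,
        carrier_cons_cons, ← union_assoc (segment ℝ p z)]
      congr 2
      refine Subset.antisymm (union_subset ?_ ?_) fun w hw => mem_segment_split hzpq hw
      · exact (convex_segment _ _).segment_subset (left_mem_segment _ _ _) hzpq
      · exact (convex_segment _ _).segment_subset hzpq (right_mem_segment _ _ _)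

end Link

/-! ### Exposed vertices and uniqueness of taut lines -/

lemma isPreconnected_carrier (l : List Plane) : IsPreconnected (carrier l) := by
  induction l with
  | nil => simp [isPreconnected_empty]
  | cons a l ih =>
    cases l with
    | nil => simp [isPreconnected_singleton]
    | cons b l =>
      rw [carrier_cons_cons]
      exact IsPreconnected.union b (right_mem_segment _ _ _) (mem_carrier_of_mem (by simp))
        (convex_segment _ _).isPreconnected ih

lemma carrier_subset_of_convex {l : List Plane} {s : Set Plane} (hs : Convex ℝ s)
    (h : ∀ p ∈ l, p ∈ s) : carrier l ⊆ s := by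
  rintro x (hx | ⟨p, q, hpq, hx⟩)
  · exact h x hx
  · exact hs.segment_subset (h p (hpq.subset (by simp))) (h q (hpq.subset (by simp))) hx

/-- A connected subset of a segment that contains its endpoints is the whole segment. -/
lemma eq_segment_of_isPreconnected {T : Set Plane} {x y : Plane} (hT : IsPreconnected T)
    (hsub : T ⊆ segment ℝ x y) (hx : x ∈ T) (hy : y ∈ T) : T = segment ℝ x y := by
  refine Subset.antisymm hsub fun z hz => ?_
  let g : Plane → ℝ := fun p => inner ℝ (y - x) p
  have hg : Continuous g := by fun_prop
  have hpar : ∀ p ∈ segment ℝ x y, ∃ t : ℝ, 0 ≤ t ∧ t ≤ 1 ∧ p = x + t • (y - x) := by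
    rintro p ⟨a, t, ha, ht, hat, rfl⟩
    obtain rfl : a = 1 - t := by linarith
    exact ⟨t, ht, by linarith, by module⟩
  have hgp : ∀ t : ℝ, g (x + t • (y - x)) = g x + t * inner ℝ (y - x) (y - x) := by
    intro t; simp only [g, inner_add_right, inner_smul_right]
  obtain ⟨t, ht0, ht1, rfl⟩ := hpar z hz
  have hnn : 0 ≤ inner ℝ (y - x) (y - x) := real_inner_self_nonneg
  have hgy : g y = g x + 1 * inner ℝ (y - x) (y - x) := by rw [← hgp]; simp
  have hmem : g (x + t • (y - x)) ∈ Icc (g x) (g y) := by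
    rw [hgp, hgy]; constructor <;> nlinarith
  obtain ⟨w, hw, hwe⟩ := hT.intermediate_value hx hy hg.continuousOn hmem
  obtain ⟨t', -, -, rfl⟩ := hpar w (hsub hw)
  rw [hgp, hgp] at hwe
  by_cases h0 : y - x = 0
  · rw [h0] at hw ⊢; simpa using hw
  · have : t' = t := mul_right_cancel₀ (inner_self_ne_zero.2 h0) (by linarith)
    rwa [← this]

/-- A polygonal line within the segment between its endpoints fills that segment. -/
lemma carrier_eq_segment {l : List Plane} {x y : Plane} (hx : x ∈ l) (hy : y ∈ l)
    (h : ∀ p ∈ l, p ∈ segment ℝ x y) : carrier l = segment ℝ x y :=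
  eq_segment_of_isPreconnected (isPreconnected_carrier l)
    (carrier_subset_of_convex (convex_segment x y) h) (mem_carrier_of_mem hx)
    (mem_carrier_of_mem hy)

/-- A finite set that is not contained in the segment between `x` and `y` has an exposed point
other than `x` and `y`. -/
lemma exists_exposed {F : List Plane} {x y q : Plane} (hx : x ∈ F) (hy : y ∈ F) (hq : q ∈ F)
    (hqs : q ∉ segment ℝ x y) :
    ∃ e ∈ F, e ≠ x ∧ e ≠ y ∧ ∃ g : Plane, ∀ z ∈ F, z ≠ e → inner ℝ g z < inner ℝ g e := by
  have hcl : IsClosed (segment ℝ x y) := by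
    rw [segment_eq_image_lineMap]
    exact (isCompact_Icc.image (by fun_prop)).isClosed
  obtain ⟨f, u, hfu, huf⟩ := geometric_hahn_banach_closed_point (convex_segment x y) hcl hqs
  obtain ⟨g, rfl⟩ := (InnerProductSpace.toDual ℝ Plane).surjective f
  simp only [InnerProductSpace.toDual_apply_apply] at hfu huf
  have hgx : 0 < inner ℝ g (q - x) := by
    rw [inner_sub_right]; linarith [hfu x (left_mem_segment _ _ _)]
  have hgy : 0 < inner ℝ g (q - y) := by
    rw [inner_sub_right]; linarith [hfu y (right_mem_segment _ _ _)]
  -- a centre far away in direction `-g` is further from `q` than from `x` and `y`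
  have far : ∀ z, 0 < inner ℝ g (q - z) → ∀ᶠ M : ℝ in atTop,
      ‖z + M • g‖ ^ 2 < ‖q + M • g‖ ^ 2 := by
    intro z hz
    filter_upwards [eventually_gt_atTop ((‖z‖ ^ 2 - ‖q‖ ^ 2) / (2 * inner ℝ g (q - z)))] with M hM
    rw [div_lt_iff₀ (by positivity)] at hM
    have e : ∀ w : Plane, ‖w + M • g‖ ^ 2 = ‖w‖ ^ 2 + 2 * M * inner ℝ g w + ‖M • g‖ ^ 2 := by
      intro w
      rw [norm_add_sq_real, inner_smul_right, real_inner_comm]; ring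
    rw [e, e]
    rw [inner_sub_right] at hM
    nlinarith
  obtain ⟨M, hMx, hMy⟩ := ((far x hgx).and (far y hgy)).exists
  -- A point of F farthest from the centre -Mg is neither x nor y. Since a circle is strictly
  -- convex, the radius vector e + Mg exposes it.
  obtain ⟨e, he, hmax⟩ := F.toFinset.exists_max_image (fun z => ‖z + M • g‖ ^ 2)
    ⟨q, by simpa using hq⟩
  have he : e ∈ F := by simpa using he
  have hmax : ∀ z ∈ F, ‖z + M • g‖ ^ 2 ≤ ‖e + M • g‖ ^ 2 := fun z hz =>
    hmax z (by simpa using hz)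
  refine ⟨e, he, ?_, ?_, e + M • g, fun z hz hze => ?_⟩
  · rintro rfl; linarith [hmax q hq]
  · rintro rfl; linarith [hmax q hq]
  · have h1 : 0 < ‖(e + M • g) - (z + M • g)‖ ^ 2 := by
      have : (e + M • g) - (z + M • g) ≠ 0 := by
        rw [add_sub_add_right_eq_sub]; exact sub_ne_zero.2 hze.symm
      positivity
    rw [norm_sub_sq_real] at h1
    have h2 := hmax z hz
    have h3 : inner ℝ (e + M • g) (z + M • g) < ‖e + M • g‖ ^ 2 := by linarith
    rw [← real_inner_self_eq_norm_sq] at h3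
    rw [inner_add_right, inner_add_right] at h3
    linarith

lemma carrier_lt {l : List Plane} {g : Plane} {r : ℝ} (h : ∀ p ∈ l, inner ℝ g p < r) :
    ∀ z ∈ carrier l, inner ℝ g z < r :=
  carrier_subset_of_convex
    (convex_halfSpace_lt (𝕜 := ℝ) (f := fun z : Plane => inner ℝ g z)
      ⟨fun _ _ => inner_add_right _ _ _, fun _ _ => inner_smul_right _ _ _⟩ r) h

lemma carrier_le {l : List Plane} {g : Plane} {r : ℝ} (h : ∀ p ∈ l, inner ℝ g p ≤ r) :
    ∀ z ∈ carrier l, inner ℝ g z ≤ r :=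
  carrier_subset_of_convex
    (convex_halfSpace_le (𝕜 := ℝ) (f := fun z : Plane => inner ℝ g z)
      ⟨fun _ _ => inner_add_right _ _ _, fun _ _ => inner_smul_right _ _ _⟩ r) h

lemma not_isBounded_halfPlane {g : Plane} (hg : g ≠ 0) (r : ℝ) :
    ¬ Bornology.IsBounded {z : Plane | r < inner ℝ g z} := by
  intro hb
  obtain ⟨M, hM⟩ := hb.exists_norm_le
  have hpos : 0 < inner ℝ g g := real_inner_self_pos.2 hg
  set t : ℝ := (max r (‖g‖ * M) + 1) / inner ℝ g g with ht
  have h1 : inner ℝ g (t • g) = max r (‖g‖ * M) + 1 := by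
    rw [inner_smul_right, ht]; field_simp
  have h2 := hM (t • g) (by change r < inner ℝ g (t • g); rw [h1]; linarith [le_max_left r (‖g‖ * M)])
  have h3 := real_inner_le_norm g (t • g)
  rw [h1] at h3
  have h4 := mul_le_mul_of_nonneg_left h2 (norm_nonneg g)
  linarith [le_max_right r (‖g‖ * M)]

/-- Let a cycle that consists of two polygonal lines pass through an exposed point `e` of its
vertices exactly once. Then the corner at `e` is filled by a triangle in the region. -/
lemma exists_triangle {S : Set Plane} {A B l' : List Plane} {p e s x y g : Plane}
    (hhead : (A ++ p :: e :: s :: B).head? = some x)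
    (hlast : (A ++ p :: e :: s :: B).getLast? = some y)
    (hhead' : l'.head? = some x) (hlast' : l'.getLast? = some y)
    (hS : carrier (A ++ p :: e :: s :: B) ⊆ regionOf S) (hS' : carrier l' ⊆ regionOf S)
    (hA : ∀ q ∈ A ++ [p], inner ℝ g q < inner ℝ g e) (hB : ∀ q ∈ s :: B, inner ℝ g q < inner ℝ g e)
    (hl' : ∀ q ∈ l', inner ℝ g q < inner ℝ g e) (hdet : det (e - p) (s - e) ≠ 0) :
    ∃ a ∈ segment ℝ p e, ∃ b ∈ segment ℝ e s, a ≠ e ∧ b ≠ e ∧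
      convexHull ℝ {a, e, b} ⊆ regionOf S := by
  set l := A ++ p :: e :: s :: B with hl
  have hgp : inner ℝ g p < inner ℝ g e := hA p (by simp)
  have hgs : inner ℝ g s < inner ℝ g e := hB s (by simp)
  have hpe : p ≠ e := by rintro rfl; exact lt_irrefl _ hgp
  have hse : s ≠ e := by rintro rfl; exact lt_irrefl _ hgs
  have hcl : carrier l = carrier (A ++ [p]) ∪ (segment ℝ p e ∪ (segment ℝ e s ∪ carrier (s :: B))) := by
    rw [hl, carrier_append, carrier_cons_cons, carrier_cons_cons]
  set C := carrier l ∪ carrier l' with hC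
  have hW := isWind_sub hhead hlast hhead' hlast'
  have hfar : ∀ {l'' : List Plane}, (∀ q ∈ l'', inner ℝ g q < inner ℝ g e) →
      ∀ᶠ z in 𝓝 e, z ∉ carrier l'' := fun h =>
    (isCompact_carrier _).isClosed.isOpen_compl.eventually_mem
      (fun h' => lt_irrefl _ (carrier_lt h e h'))
  have hps : segment ℝ p e ⊆ carrier l := fun z hz => by rw [hcl]; exact Or.inr (Or.inl hz)
  have hss : segment ℝ e s ⊆ carrier l := fun z hz => by
    rw [hcl]; exact Or.inr (Or.inr (Or.inl hz))
  have hcorner : Corner C e p s := by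
    refine ⟨hpe, hse, fun z hz => Or.inl (hps hz), fun z hz => Or.inl (hss hz), ?_,
      fun h0 => absurd h0 hdet⟩
    filter_upwards [hfar hA, hfar hB, hfar hl'] with z h1 h2 h3 hz
    rcases hz with hz | hz
    · rw [hcl] at hz
      rcases hz with hz | hz | hz | hz
      · exact absurd hz h1
      · exact Or.inl hz
      · exact Or.inr hz
      · exact absurd hz h2
    · exact absurd hz h3
  have hconst : ∀ T, IsPreconnected T → Disjoint T C → ∀ z ∈ T, ∀ w ∈ T,
      angSum l z - angSum l' z = angSum l w - angSum l' w := fun T hT hd z hz w hw =>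
    hW.eq_of_isPreconnected hT hd hz hw
  obtain ⟨c1, hc1⟩ := hcorner.exists_germ hconst (σ := 1) one_ne_zero
  obtain ⟨c2, hc2⟩ := hcorner.exists_germ hconst (σ := -1) (by norm_num)
  -- Near e the edge from p is traversed by the cycle only once, so the winding function jumps
  -- across it.
  have hjump : c1 ≠ c2 := by
    obtain ⟨m, hm, hg1, hg2, hmA, hmB, hml⟩ := exists_near_openSegment_left (A := p)
      ((halfGerm_left_of_sector hc1).and ((halfGerm_left_of_sector hc2).and
        ((hfar hA).and ((hfar hB).and (hfar hl')))))
    have hmes : m ∉ segment ℝ e s := by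
      intro hmes
      obtain ⟨r, hr, hmr⟩ := sub_eq_of_mem_segment_right hmes
      obtain ⟨a, b, ha, hb, hab, rfl⟩ := hm
      obtain rfl : b = 1 - a := by linarith
      have h1 : (-a) • (e - p) = r • (s - e) := by rw [← hmr]; module
      have h2 := congrArg (fun v => det v (s - e)) h1
      simp only [det_smul_left, det_self, mul_zero] at h2
      rcases mul_eq_zero.1 h2 with h3 | h3
      · linarith
      · exact hdet h3
    have hme : m ∉ carrier (e :: s :: B) := by
      rw [carrier_cons_cons]
      rintro (h | h)
      · exact hmes h
      · exact hmB h
    refine ang_jump (W := fun z => angSum l z - angSum l' z)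
      (G := fun z => angSum (A ++ [p]) z + angSum (e :: s :: B) z - angSum l' z) hm hpe ?_
      (((continuousAt_angSum hmA).add (continuousAt_angSum hme)).sub (continuousAt_angSum hml))
      ?_ ?_
    · intro z
      have : angSum l z = angSum (A ++ [p]) z + (ang p e z + angSum (e :: s :: B) z) := by
        rw [hl, angSum_append]; rfl
      rw [this]; ring
    · rw [frequently_nhdsWithin_iff]
      refine ((frequently_half (sub_ne_zero.2 hpe.symm) m one_ne_zero).and_eventually
        (hg1 hm)).mono ?_
      rintro z ⟨h1, h2⟩
      exact ⟨h2 h1, by rwa [one_mul] at h1⟩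
    · rw [frequently_nhdsWithin_iff]
      refine ((frequently_half (σ := -1) (sub_ne_zero.2 hpe.symm) m (by norm_num)).and_eventually
        (hg2 hm)).mono ?_
      rintro z ⟨h1, h2⟩
      exact ⟨h2 h1, by change det (e - p) (z - m) < 0; linarith⟩
  -- beyond `e` the winding number vanishes
  have hout : ∀ z, inner ℝ g e < inner ℝ g z → angSum l z - angSum l' z = 0 := by
    intro z hz
    have hg0 : g ≠ 0 := by rintro rfl; simp at hgp
    refine hW.eq_zero (S := {z | inner ℝ g e < inner ℝ g z}) ?_ ?_
      (not_isBounded_halfPlane hg0 _) hz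
    · exact (convex_halfSpace_gt (𝕜 := ℝ) (f := fun z : Plane => inner ℝ g z)
        ⟨fun _ _ => inner_add_right _ _ _, fun _ _ => inner_smul_right _ _ _⟩ _).isPreconnected
    · rw [Set.disjoint_left]
      intro w (hw : inner ℝ g e < inner ℝ g w) hwC
      have : inner ℝ g w ≤ inner ℝ g e := by
        rcases hwC with h | h
        · refine carrier_le (l := l) ?_ w h
          intro q hq
          have : q ∈ A ++ [p] ∨ q = e ∨ q ∈ s :: B := by
            rw [hl] at hq
            simp only [List.mem_append, List.mem_cons, List.not_mem_nil, or_false] at hq ⊢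
            tauto
          rcases this with h | rfl | h
          · exact (hA q h).le
          · exact le_rfl
          · exact (hB q h).le
        · exact (carrier_lt hl' w h).le
      linarith
  -- The nonconvex sector contains the direction (e - p) - (s - e), which points beyond e because
  -- both neighbours lie below e with respect to g. The value on this sector is therefore zero.
  have hzero : ∀ (σ c : ℝ), σ * det (e - p) (s - e) < 0 →
      (∀ᶠ z in 𝓝 e, z - e ∈ sector σ (e - p) (s - e) → angSum l z - angSum l' z = c) → c = 0 := by
    intro σ c hσ hc
    have hlim : Tendsto (fun ε : ℝ => e + ε • ((e - p) - (s - e))) (𝓝[>] 0) (𝓝 e) := by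
      have : Tendsto (fun ε : ℝ => e + ε • ((e - p) - (s - e))) (𝓝 0)
        (𝓝 (e + (0:ℝ) • ((e - p) - (s - e)))) := Continuous.tendsto (by fun_prop) _
      rw [zero_smul, add_zero] at this
      exact this.mono_left nhdsWithin_le_nhds
    obtain ⟨ε, h1, h2⟩ := ((hlim.eventually hc).and self_mem_nhdsWithin).exists
    have h2 : 0 < ε := h2
    rw [← h1 ?_]
    · apply hout
      rw [inner_add_right, inner_smul_right, inner_sub_right, inner_sub_right, inner_sub_right]
      have := mul_pos h2 (show 0 < inner ℝ g e - inner ℝ g p - (inner ℝ g s - inner ℝ g e) by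
        linarith)
      linarith
    · refine Or.inr ⟨hσ.le, Or.inl ?_⟩
      have : det (e - p) (e + ε • ((e - p) - (s - e)) - e) = -(ε * det (e - p) (s - e)) := by
        simp [det]; ring
      rw [this]
      have := mul_neg_of_pos_of_neg h2 hσ
      linarith
  -- The convex sector thus has a nonzero value, and a point with nonzero winding number lies in the
  -- region.
  obtain ⟨σ, c, hσ, hc, hc0⟩ : ∃ σ c : ℝ, 0 < σ * det (e - p) (s - e) ∧
      (∀ᶠ z in 𝓝 e, z - e ∈ sector σ (e - p) (s - e) → angSum l z - angSum l' z = c) ∧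
      c ≠ 0 := by
    rcases lt_or_gt_of_ne hdet with h | h
    · refine ⟨-1, c2, by linarith, hc2, ?_⟩
      rw [← hzero 1 c1 (by linarith) hc1]; exact hjump.symm
    · refine ⟨1, c1, by linarith, hc1, ?_⟩
      rw [← hzero (-1) c2 (by linarith) hc2]; exact hjump
  obtain ⟨r, hr, hball⟩ := Metric.eventually_nhds_iff_ball.1 (hcorner.notMem_of_sector σ |>.and hc)
  have hnear : ∀ v : Plane, ∃ δ : ℝ, 0 < δ ∧ δ ≤ 1 ∧ e + δ • v ∈ Metric.ball e r := by
    intro v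
    refine ⟨min 1 (r / (2 * (‖v‖ + 1))), by positivity, min_le_left _ _, ?_⟩
    rw [mem_ball_iff_norm, add_sub_cancel_left, norm_smul, Real.norm_of_nonneg (by positivity)]
    have h1 := min_le_right 1 (r / (2 * (‖v‖ + 1)))
    have h2 : r / (2 * (‖v‖ + 1)) * ‖v‖ < r := by
      rw [div_mul_eq_mul_div, div_lt_iff₀ (by positivity)]
      nlinarith [norm_nonneg v]
    nlinarith [norm_nonneg v]
  obtain ⟨δ, hδ, hδ1, hbp⟩ := hnear (p - e)
  obtain ⟨δ', hδ', hδ1', hbs⟩ := hnear (s - e)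
  have ha : e + δ • (p - e) ∈ segment ℝ p e := by
    rw [segment_symm]; exact mem_segment_of_sub_eq hδ.le hδ1 (by module)
  have hb : e + δ' • (s - e) ∈ segment ℝ e s := mem_segment_of_sub_eq hδ'.le hδ1' (by module)
  refine ⟨_, ha, _, hb, ?_, ?_, ?_⟩
  · rw [Ne, add_eq_left, smul_eq_zero, sub_eq_zero]
    rintro (h | h)
    exacts [hδ.ne' h, hpe h]
  · rw [Ne, add_eq_left, smul_eq_zero, sub_eq_zero]
    rintro (h | h)
    exacts [hδ'.ne' h, hse h]
  · intro z hz
    have hzball : z ∈ Metric.ball e r := by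
      refine convexHull_min ?_ (convex_ball e r) hz
      rintro w (rfl | rfl | rfl)
      exacts [hbp, Metric.mem_ball_self hr, hbs]
    rw [convexHull_insert (by simp), convexHull_pair, mem_convexJoin] at hz
    obtain ⟨a, ha', b, hb', hz⟩ := hz
    rw [mem_singleton_iff] at ha'
    subst ha'
    obtain ⟨t, ht, hbt⟩ := sub_eq_of_mem_segment_right hb'
    obtain ⟨α, β, hα, hβ, hαβ, rfl⟩ := hz
    obtain rfl : β = 1 - α := by linarith
    have hb2 : b = e + t • (δ' • (s - e)) := by
      rw [add_sub_cancel_left] at hbt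
      exact sub_eq_iff_eq_add'.1 hbt
    have ht1 : b ∈ segment ℝ e s :=
      (convex_segment _ _).segment_subset (left_mem_segment _ _ _) hb hb'
    rcases hα.eq_or_lt with rfl | hα0
    · have : (0:ℝ) • (e + δ • (p - e)) + (1 - (0:ℝ)) • b = b := by module
      rw [this]
      exact hS (hss ht1)
    by_cases hz0 : (1 - α) * t = 0
    · have : α • (e + δ • (p - e)) + (1 - α) • b = e + (α * δ) • (p - e) := by
        have h3 : (1 - α) • b = (1 - α) • e + ((1 - α) * t) • (δ' • (s - e)) := by
          rw [hb2]; module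
        rw [h3, hz0]; module
      rw [this]
      refine hS (hps ?_)
      rw [segment_symm]
      exact mem_segment_of_sub_eq (r := α * δ) (by positivity) (by nlinarith) (by module)
    · have hz1 : 0 < (1 - α) * t := lt_of_le_of_ne (by positivity) (Ne.symm hz0)
      have hzsub : α • (e + δ • (p - e)) + (1 - α) • b - e =
          (-(α * δ)) • (e - p) + ((1 - α) * t * δ') • (s - e) := by
        rw [hb2]; module
      have hsec : α • (e + δ • (p - e)) + (1 - α) • b - e ∈ sector σ (e - p) (s - e) := by
        rw [hzsub]
        refine Or.inl ⟨hσ, ?_, ?_⟩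
        · rw [det_add_smul, det_smul_right, det_self]
          have := mul_pos (mul_pos hz1 hδ') hσ
          linarith
        · rw [det_add_smul, det_smul_right, det_self, det_swap]
          have := mul_pos (mul_pos hα0 hδ) hσ
          linarith
      obtain ⟨h1, h2⟩ := hball _ hzball
      by_contra hnot
      have h3 := hW.eq_zero_of_notMem (union_subset hS hS') hnot
      exact hc0 ((h2 hsec).symm.trans h3)

namespace Link

variable {S : Set Plane} {l l' : List Plane} {x y : Plane}

lemma length_pos {R : Set Plane} (h : Link R x y l) : 0 < l.length :=
  List.length_pos_of_mem h.head_mem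

/-- An exposed vertex of a taut line is visited by the other line as well. -/
lemma exposed_mem (h : Link (regionOf S) x y l) (h' : Link (regionOf S) x y l')
    (hmono : ∀ m e, m.length < l.length → Link (regionOf S) e e m → carrier m = {e})
    {e g : Plane} (he : e ∈ l) (hex : e ≠ x) (hey : e ≠ y)
    (hg : ∀ z ∈ l ++ l', z ≠ e → inner ℝ g z < inner ℝ g e) : e ∈ l' := by
  by_contra hel'
  obtain ⟨A, B, rfl, heA⟩ := List.eq_append_cons_of_mem he
  have hAne : A ≠ [] := by
    rintro rfl; exact hex (by simpa using h.head)
  have hBne : B ≠ [] := by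
    rintro rfl; exact hey (by simpa using h.last)
  obtain ⟨A, p, rfl⟩ := List.eq_nil_or_concat A |>.resolve_left hAne
  obtain ⟨s, B, rfl⟩ := List.exists_cons_of_ne_nil hBne
  simp only [List.concat_eq_append, List.append_assoc, List.cons_append, List.nil_append] at *
  have hps : [p, e, s] <:+: A ++ p :: e :: s :: B := ⟨A, B, by simp⟩
  have hpe : p ≠ e := h.ne p e ⟨A, s :: B, by simp⟩
  have hes : e ≠ s := h.ne e s ⟨A ++ [p], B, by simp⟩
  -- A second visit to e would close up a shorter taut loop at e, which `hmono` reduces to the point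
  -- e; consecutive vertices are distinct.
  have heB : e ∉ s :: B := by
    intro hmem
    obtain ⟨C, D, hCD⟩ := List.append_of_mem hmem
    have hC : C ≠ [] := by
      rintro rfl
      simp only [List.nil_append, List.cons.injEq] at hCD
      exact hes hCD.1.symm
    obtain ⟨c, C, rfl⟩ := List.exists_cons_of_ne_nil hC
    have h1 : Link (regionOf S) x y ((A ++ [p]) ++ e :: ((c :: C) ++ e :: D)) := by
      rw [← hCD]; simpa using h
    have h2 := h1.right
    have h3 : Link (regionOf S) e y ((e :: c :: C) ++ e :: D) := by simpa using h2
    have h4 := hmono _ e (by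
      have := congrArg List.length hCD
      simp only [List.length_append, List.length_cons, List.length_nil] at this ⊢
      omega) h3.left
    have hc : c ∈ carrier (e :: c :: C ++ [e]) := mem_carrier_of_mem (by simp)
    rw [h4, mem_singleton_iff] at hc
    simp only [List.cons_append, List.cons.injEq] at hCD
    exact hes (by rw [hCD.1, hc])
  have hA : ∀ q ∈ A ++ [p], inner ℝ g q < inner ℝ g e := fun q hq => by
    refine hg q ?_ ?_
    · simp only [List.mem_append, List.mem_cons, List.not_mem_nil, or_false] at hq ⊢
      tauto
    · rintro rfl; exact heA (by simpa using hq)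
  have hB : ∀ q ∈ s :: B, inner ℝ g q < inner ℝ g e := fun q hq => by
    refine hg q ?_ ?_
    · simp only [List.mem_cons] at hq ⊢
      simp only [List.mem_append, List.mem_cons]
      tauto
    · rintro rfl; exact heB hq
  have hl' : ∀ q ∈ l', inner ℝ g q < inner ℝ g e := fun q hq => by
    refine hg q ?_ ?_
    · simp only [List.mem_append, List.mem_cons]; tauto
    · rintro rfl; exact hel' hq
  have hgp := hA p (by simp)
  have hgs := hB s (by simp)
  have hturn := h.turn p e s hps
  have hsegp : segment ℝ p e ⊆ regionOf S := fun z hz =>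
    h.subset (Or.inr ⟨p, e, ⟨A, s :: B, by simp⟩, hz⟩)
  have hsegs : segment ℝ e s ⊆ regionOf S := fun z hz =>
    h.subset (Or.inr ⟨e, s, ⟨A ++ [p], B, by simp⟩, hz⟩)
  -- In the collinear case both neighbours lie below e with respect to g, so the line turns straight
  -- back; a degenerate triangle contained in an edge shows that this is not taut.
  by_cases hdet : det (e - p) (s - e) = 0
  · obtain ⟨μ, hμ⟩ := exists_smul_of_det_eq_zero (sub_ne_zero.2 hpe.symm) hdet
    have hμ0 : μ < 0 := by
      have := congrArg (fun z => inner ℝ g z) hμ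
      simp only [inner_sub_right, inner_smul_right] at this
      by_contra! hcon
      have := mul_nonneg hcon (show 0 ≤ inner ℝ g e - inner ℝ g p by linarith)
      linarith
    rcases le_total (-1) μ with h1 | h1
    · have hs : s ∈ segment ℝ p e := by
        rw [segment_symm]
        exact mem_segment_of_sub_eq (r := -μ) (by linarith) (by linarith) (by rw [hμ]; module)
      have := hturn s hs s (right_mem_segment _ _ _) hes.symm hes.symm (by
        have : ({s, e, s} : Set Plane) = {e, s} := by ext z; simp
        rw [this, convexHull_pair]; exact hsegs)
      rw [segment_same, mem_singleton_iff] at this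
      exact hes this
    · have hp : p ∈ segment ℝ e s := by
        refine mem_segment_of_sub_eq (r := -μ⁻¹) ?_ ?_ ?_
        · rw [neg_nonneg, inv_nonpos]; exact hμ0.le
        · rw [← inv_neg]; exact inv_le_one_of_one_le₀ (by linarith)
        · rw [hμ, smul_smul, neg_mul, inv_mul_cancel₀ hμ0.ne]; module
      have := hturn p (left_mem_segment _ _ _) p hp hpe hpe (by
        have : ({p, e, p} : Set Plane) = {p, e} := by ext z; simp; tauto
        rw [this, convexHull_pair]; exact hsegp)
      rw [segment_same, mem_singleton_iff] at this
      exact hpe this.symm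
  · obtain ⟨a, ha, b, hb, hae, hbe, hR⟩ := exists_triangle h.head h.last h'.head h'.last
      h.subset h'.subset hA hB hl' hdet
    -- Tautness puts e between a and b, although both lie strictly below e with respect to g.
    have hmem := hturn a ha b hb hae hbe hR
    have lt_of : ∀ {u v : Plane}, inner ℝ g u < inner ℝ g e → v ∈ segment ℝ e u → v ≠ e →
        inner ℝ g v < inner ℝ g e := by
      intro u v hu hv hve
      obtain ⟨r, hr, hvr⟩ := sub_eq_of_mem_segment_right hv
      have hr0 : r ≠ 0 := by
        rintro rfl
        rw [zero_smul, sub_eq_zero] at hvr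
        exact hve hvr
      have h1 := congrArg (fun z => inner ℝ g z) hvr
      simp only [inner_sub_right, inner_smul_right] at h1
      have := mul_pos (lt_of_le_of_ne hr (Ne.symm hr0))
        (show 0 < inner ℝ g e - inner ℝ g u by linarith)
      linarith
    have hga := lt_of hgp (segment_symm ℝ p e ▸ ha) hae
    have hgb := lt_of hgs hb hbe
    have := (convex_halfSpace_lt (𝕜 := ℝ) (f := fun z : Plane => inner ℝ g z)
      ⟨fun _ _ => inner_add_right _ _ _, fun _ _ => inner_smul_right _ _ _⟩
      (inner ℝ g e)).segment_subset hga hgb hmem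
    exact lt_irrefl (inner ℝ g e) this

/-- Taut polygonal lines in the region enclosed by a closed set are determined by their
endpoints. -/
theorem carrier_unique (h : Link (regionOf S) x y l) (h' : Link (regionOf S) x y l') :
    carrier l = carrier l' := by
  induction hN : l.length + l'.length using Nat.strong_induction_on generalizing l l' x y with
  | _ N ih =>
    subst hN
    by_cases hall : ∀ q ∈ l ++ l', q ∈ segment ℝ x y
    · rw [carrier_eq_segment h.head_mem h.last_mem fun p hp => hall p (by simp [hp]),
        carrier_eq_segment h'.head_mem h'.last_mem fun p hp => hall p (by simp [hp])]
    · push Not at hall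
      obtain ⟨q, hq, hqs⟩ := hall
      obtain ⟨e, he, hex, hey, g, hg⟩ := exists_exposed (F := l ++ l')
        (List.mem_append_left _ h.head_mem) (List.mem_append_left _ h.last_mem) hq hqs
      -- The induction hypothesis is applied to m and the constant line `[e]`, whose length 1 still
      -- leaves a smaller total.
      have hmono : ∀ m e, (m.length < l.length ∨ m.length < l'.length) →
          Link (regionOf S) e e m → carrier m = {e} := by
        intro m e hm hlink
        rw [← carrier_singleton e]
        refine ih _ ?_ hlink (Link.singleton (hlink.subset (mem_carrier_of_mem hlink.head_mem))) rfl
        have := h.length_pos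
        have := h'.length_pos
        simp only [List.length_singleton]
        omega
      have hboth : e ∈ l ∧ e ∈ l' := by
        rcases List.mem_append.1 he with hel | hel
        · exact ⟨hel, h.exposed_mem h' (fun m e hm => hmono m e (Or.inl hm)) hel hex hey hg⟩
        · refine ⟨h'.exposed_mem (g := g) h (fun m e hm => hmono m e (Or.inr hm)) hel hex hey ?_,
            hel⟩
          intro z hz
          exact hg z (by simp only [List.mem_append] at hz ⊢; tauto)
      obtain ⟨A, B, rfl⟩ := List.append_of_mem hboth.1
      obtain ⟨A', B', rfl⟩ := List.append_of_mem hboth.2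
      have hA : A ≠ [] := by rintro rfl; exact hex (by simpa using h.head)
      have hB : B ≠ [] := by rintro rfl; exact hey (by simpa using h.last)
      have hA1 := List.length_pos_iff.2 hA
      have hB1 := List.length_pos_iff.2 hB
      have e1 := ih _ (by simp; omega) h.left h'.left rfl
      have e2 := ih _ (by simp; omega) h.right h'.right rfl
      rw [carrier_append, carrier_append A', e1, e2]

end Link

/-! ### Shortest paths are taut polygonal lines -/

/-- A boundary arc is a competitor of finite length; without it the minimal length might be infinite
and lengths could not be cancelled. -/
lemma exists_lipschitz_arc (Q : ℕ → Plane) (s k : ℕ) :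
    ∃ (f : ℝ → Plane) (K : NNReal), LipschitzWith K f ∧ f 0 = Q s ∧ f k = Q (s + k) ∧
      ∀ u ∈ Icc (0 : ℝ) k, f u ∈ bd Q := by
  induction k with
  | zero =>
    refine ⟨fun _ => Q s, 0, LipschitzWith.const _, rfl, rfl, fun u _ => ?_⟩
    exact mem_iUnion.2 ⟨s, left_mem_segment _ _ _⟩
  | succ k ih =>
    obtain ⟨f, K, hK, h0, hk, hf⟩ := ih
    let d : Plane := Q (s + k + 1) - Q (s + k)
    have hl : LipschitzWith _ fun u : ℝ =>
        -- Clamping makes the earlier arc stop at time k and the new edge run exactly during [k, k +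
        -- 1], so no case distinction spoils the Lipschitz bound.
        f (min u k) + (ContinuousLinearMap.toSpanSingleton ℝ d) (max (min (u - k) 1) 0) :=
      (hK.comp (LipschitzWith.id.min_const (k : ℝ))).add
        ((ContinuousLinearMap.toSpanSingleton ℝ d).lipschitz.comp
          (((LipschitzWith.id.sub (LipschitzWith.const (k : ℝ))).min_const 1).max_const 0))
    have hval : ∀ u : ℝ, k ≤ u → u ≤ k + 1 →
        f (min u k) + (ContinuousLinearMap.toSpanSingleton ℝ d) (max (min (u - k) 1) 0) =
          Q (s + k) + (u - k) • d := by
      intro u hu hu'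
      rw [min_eq_right hu, hk, min_eq_left (by linarith), max_eq_left (by linarith)]
      rfl
    refine ⟨_, _, hl, ?_, ?_, ?_⟩
    · have hk0 : (0 : ℝ) ≤ k := Nat.cast_nonneg k
      rw [min_eq_left hk0, h0, zero_sub, max_eq_right ((min_le_left _ _).trans (by linarith))]
      simp
    · rw [hval _ (by simp) (by simp)]
      simp [d, add_assoc]
    · rintro u ⟨hu0, hu1⟩
      push_cast at hu1
      rcases le_total u k with hu | hu
      · rw [min_eq_left hu, max_eq_right ((min_le_left _ _).trans (by linarith)), map_zero, add_zero]
        exact hf u ⟨hu0, hu⟩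
      · rw [hval u hu hu1]
        exact mem_iUnion.2 ⟨s + k, mem_segment_of_sub_eq (r := u - k) (by linarith) (by linarith)
          (by rw [add_sub_cancel_left])⟩

lemma eVariationOn_comp_monotone_ne_top {f : ℝ → Plane} {K : NNReal} (hf : LipschitzWith K f)
    {φ : unitInterval → ℝ} (hφ : Monotone φ) (s t : unitInterval) :
    eVariationOn (f ∘ φ) (Icc s t) ≤ K * ENNReal.ofReal (φ t - φ s) := by
  rcases lt_or_ge t s with hst | hst
  · rw [Icc_eq_empty (not_le.2 hst)]; simp
  have h1 := (hf.lipschitzOnWith (s := univ)).comp_eVariationOn_le (g := φ) (s := Icc s t)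
    (mapsTo_univ _ _)
  refine h1.trans ?_
  gcongr
  have h2 := (hφ.monotoneOn (Icc s t)).eVariationOn_eq (left_mem_Icc.2 hst) (right_mem_Icc.2 hst)
  exact (inter_self (Icc s t) ▸ h2).le

lemma exists_path_finite (Q : ℕ → Plane) (s k : ℕ) :
    ∃ γ : Path (Q s) (Q (s + k)), range γ ⊆ bd Q ∧ eVariationOn γ univ ≠ ⊤ := by
  obtain ⟨f, K, hK, h0, hk, hf⟩ := exists_lipschitz_arc Q s k
  let φ : unitInterval → ℝ := fun u => k * u
  have hφ : Monotone φ := fun u v huv => mul_le_mul_of_nonneg_left huv (Nat.cast_nonneg k)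
  refine ⟨⟨⟨f ∘ φ, hK.continuous.comp (by fun_prop)⟩, ?_, ?_⟩, ?_, ?_⟩
  · simp [φ, h0]
  · simp [φ, hk]
  · rintro _ ⟨u, rfl⟩
    have hk0 : (0 : ℝ) ≤ k := Nat.cast_nonneg k
    refine hf (k * u) ⟨mul_nonneg hk0 u.2.1, ?_⟩
    have := mul_le_mul_of_nonneg_left u.2.2 hk0
    linarith
  · have h1 : (univ : Set unitInterval) = Icc 0 1 := by
      ext u; simp [unitInterval.le_one']
    rw [h1]
    refine ne_top_of_le_ne_top ?_ (eVariationOn_comp_monotone_ne_top hK hφ 0 1)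
    exact ENNReal.mul_ne_top ENNReal.coe_ne_top ENNReal.ofReal_ne_top

lemma eVariationOn_split {γ : unitInterval → Plane} {s t : unitInterval} (hst : s ≤ t) :
    eVariationOn γ univ =
      eVariationOn γ (Icc 0 s) + eVariationOn γ (Icc s t) + eVariationOn γ (Icc t 1) := by
  have h1 := eVariationOn.Icc_add_Icc γ (s := univ) (unitInterval.nonneg' (t := s)) hst (mem_univ _)
  have h2 := eVariationOn.Icc_add_Icc γ (s := univ) (unitInterval.nonneg' (t := t)) (unitInterval.le_one' (t := t))
    (mem_univ _)
  simp only [univ_inter] at h1 h2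
  rw [h1, h2]
  congr 1
  ext u; simp [unitInterval.le_one']

variable {R : Set Plane} {x y : Plane}

/-- A shortest path runs straight between two of its points that see each other. -/
lemma image_eq_segment_of_shortest {γ : Path x y} (hγ : IsShortestPathIn R γ)
    (hfin : eVariationOn γ univ ≠ ⊤) {s t : unitInterval} (hst : s ≤ t)
    (hR : segment ℝ (γ s) (γ t) ⊆ R) : γ '' Icc s t = segment ℝ (γ s) (γ t) := by
  rcases hst.eq_or_lt with rfl | hlt
  · simp
  have hts : (0 : ℝ) < t - s := sub_pos.2 hlt
  let L : ℝ → Plane := AffineMap.lineMap (γ s) (γ t)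
  -- The competitor replaces the piece over [s, t] by the straight segment, run through at the
  -- clamped affine speed φ.
  let φ : unitInterval → ℝ := fun u => max 0 (min 1 ((u - s) / (t - s)))
  have hφ : Monotone φ := fun u v huv => by
    have : (u : ℝ) ≤ v := huv
    dsimp only [φ]
    gcongr
  have hφs : ∀ u ≤ s, φ u = 0 := fun u hu => by
    have h1 : ((u : ℝ) - s) / (t - s) ≤ 0 :=
      div_nonpos_of_nonpos_of_nonneg (sub_nonpos.2 hu) hts.le
    exact max_eq_left ((min_le_right _ _).trans h1)
  have hφt : ∀ u, t ≤ u → φ u = 1 := fun u hu => by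
    have h2 : (t : ℝ) ≤ u := hu
    have h1 : 1 ≤ ((u : ℝ) - s) / (t - s) := by
      rw [le_div_iff₀ hts]; linarith
    simp only [φ]
    rw [min_eq_left h1]; norm_num
  have hφcont : Continuous φ := by fun_prop
  have hφmem : ∀ u, φ u ∈ Icc (0 : ℝ) 1 := fun u =>
    ⟨le_max_left _ _, max_le zero_le_one (min_le_left _ _)⟩
  let g : unitInterval → Plane := fun u =>
    if u ≤ s then γ u else if u ≤ t then L (φ u) else γ u
  have hgs : ∀ u ≤ s, g u = γ u := fun u hu => if_pos hu
  have hgm : ∀ u ∈ Icc s t, g u = L (φ u) := by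
    rintro u ⟨h1, h2⟩
    rcases h1.eq_or_lt with rfl | h1
    · rw [hgs _ le_rfl, hφs _ le_rfl]; simp [L]
    · simp [g, not_le.2 h1, h2]
  have hgt : ∀ u, t ≤ u → g u = γ u := by
    intro u h1
    rcases h1.eq_or_lt with rfl | h1
    · rw [hgm _ ⟨hst, le_rfl⟩, hφt _ le_rfl]; simp [L]
    · simp [g, not_le.2 h1]
  have hLcont : Continuous L := by fun_prop
  have hgcont : Continuous g := by
    refine Continuous.if_le γ.continuous ?_ continuous_id continuous_const ?_
    · refine Continuous.if_le (hLcont.comp hφcont) γ.continuous continuous_id continuous_const ?_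
      rintro u rfl
      have h1 := hgm u ⟨hst, le_rfl⟩
      have h2 := hgt u le_rfl
      rw [← h2, h1]
    · rintro u rfl
      have h1 := hgm u ⟨le_rfl, hst⟩
      have h2 := hgs u le_rfl
      simp only [hst, if_true]
      rw [← h2, h1]
  let γ' : Path x y := ⟨⟨g, hgcont⟩, by
    change g 0 = x; rw [hgs 0 (unitInterval.nonneg' (t := s))]; exact γ.source, by
    change g 1 = y; rw [hgt 1 unitInterval.le_one']; exact γ.target⟩
  have hγ'R : range γ' ⊆ R := by
    rintro _ ⟨u, rfl⟩
    change g u ∈ R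
    rcases le_total u s with hu | hu
    · rw [hgs u hu]; exact hγ.1 ⟨u, rfl⟩
    rcases le_total u t with hu' | hu'
    · rw [hgm u ⟨hu, hu'⟩]
      apply hR
      rw [segment_eq_image_lineMap]
      exact ⟨_, hφmem u, rfl⟩
    · rw [hgt u hu']; exact hγ.1 ⟨u, rfl⟩
  have hle := hγ.2 γ' hγ'R
  have e0 : eVariationOn γ' (Icc 0 s) = eVariationOn γ (Icc 0 s) :=
    eVariationOn.congr fun u hu => hgs u hu.2
  have e1 : eVariationOn γ' (Icc t 1) = eVariationOn γ (Icc t 1) :=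
    eVariationOn.congr fun u hu => hgt u hu.1
  have e2 : eVariationOn γ' (Icc s t) ≤ edist (γ s) (γ t) := by
    have h1 : eVariationOn γ' (Icc s t) = eVariationOn (L ∘ φ) (Icc s t) :=
      eVariationOn.congr fun u hu => hgm u hu
    rw [h1]
    have h2 := eVariationOn_comp_monotone_ne_top
      (lipschitzWith_lineMap (𝕜 := ℝ) (γ s) (γ t)) hφ s t
    rw [hφs s le_rfl, hφt t le_rfl, sub_zero, ENNReal.ofReal_one, mul_one] at h2
    rwa [edist_nndist]
  rw [eVariationOn_split hst, eVariationOn_split (γ := γ') hst, e0, e1] at hle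
  rw [eVariationOn_split hst] at hfin
  have hf1 : eVariationOn γ (Icc t 1) ≠ ⊤ := ne_top_of_le_ne_top hfin le_add_self
  have hf0 : eVariationOn γ (Icc 0 s) ≠ ⊤ :=
    ne_top_of_le_ne_top hfin (le_self_add.trans le_self_add)
  have hvar : eVariationOn γ (Icc s t) ≤ edist (γ s) (γ t) :=
    ((ENNReal.add_le_add_iff_left hf0).1 ((ENNReal.add_le_add_iff_right hf1).1 hle)).trans e2
  refine eq_segment_of_isPreconnected
    (isPreconnected_Icc.image _ γ.continuous.continuousOn) ?_
    ⟨s, ⟨le_rfl, hst⟩, rfl⟩ ⟨t, ⟨hst, le_rfl⟩, rfl⟩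
  rintro _ ⟨u, ⟨hu1, hu2⟩, rfl⟩
  have h3 := eVariationOn.Icc_add_Icc γ (s := univ) hu1 hu2 (mem_univ _)
  simp only [univ_inter] at h3
  rw [← h3] at hvar
  -- The piece is no longer than the distance of its ends, so equality in the triangle inequality
  -- places each of its points on the segment.
  have h4 : edist (γ s) (γ u) + edist (γ u) (γ t) ≤ edist (γ s) (γ t) :=
    (add_le_add (eVariationOn.edist_le _ (left_mem_Icc.2 hu1) (right_mem_Icc.2 hu1))
      (eVariationOn.edist_le _ (left_mem_Icc.2 hu2) (right_mem_Icc.2 hu2))).trans hvar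
  rw [edist_dist, edist_dist, edist_dist, ← ENNReal.ofReal_add dist_nonneg dist_nonneg,
    ENNReal.ofReal_le_ofReal_iff dist_nonneg] at h4
  rw [mem_segment_iff_wbtw, ← dist_add_dist_eq_iff]
  exact le_antisymm h4 (dist_triangle _ _ _)

/-- A shortest path in a set in which every point sees all nearby points is a taut polygonal
line. -/
theorem exists_link_of_shortest {γ : Path x y} (hγ : IsShortestPathIn R γ)
    (hfin : eVariationOn γ univ ≠ ⊤)
    (hR : ∀ z ∈ R, ∀ᶠ w in 𝓝 z, w ∈ R → segment ℝ z w ⊆ R) :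
    ∃ l, Link R x y l ∧ carrier l = range γ := by
  have hsc := @image_eq_segment_of_shortest R x y γ hγ hfin
  have hmem : ∀ t, γ t ∈ R := fun t => hγ.1 ⟨t, rfl⟩
  let K : unitInterval → Prop := fun t => ∃ l, Link R (γ 0) (γ t) l ∧ carrier l = γ '' Icc 0 t
  have hstep : ∀ t t', t ≤ t' → segment ℝ (γ t) (γ t') ⊆ R → K t → K t' := by
    rintro t t' htt hseg ⟨l, hl, hc⟩
    have himg := hsc htt hseg
    have hunion : γ '' Icc 0 t' = γ '' Icc 0 t ∪ segment ℝ (γ t) (γ t') := by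
      rw [← himg, ← image_union, Icc_union_Icc_eq_Icc (unitInterval.nonneg' (t := t)) htt]
    by_cases heq : γ t = γ t'
    · refine ⟨l, heq ▸ hl, ?_⟩
      rw [hunion, ← heq, segment_same, hc, eq_comm, union_eq_left, singleton_subset_iff]
      exact ⟨t, ⟨unitInterval.nonneg', le_rfl⟩, rfl⟩
    · obtain ⟨A, hA⟩ : ∃ A, l = A ++ [γ t] :=
        ⟨_, (List.dropLast_append_getLast? _ hl.last).symm⟩
      subst hA
      refine ⟨A ++ γ t :: [γ t'], ⟨?_, ?_, ?_⟩, ?_⟩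
      · refine hl.toTaut.append (Taut.pair heq hseg) ?_
        -- If a triangle of R cuts the corner, its two outer vertices are visited by γ before and
        -- after time t and see each other; γ is straight between them and passes through γ t.
        rintro A' p s B' rfl hB u hu v hv hut hvt hhull
        simp only [List.cons.injEq] at hB
        obtain ⟨rfl, -⟩ := hB
        have hu' : u ∈ γ '' Icc 0 t := by
          rw [← hc]; exact Or.inr ⟨p, γ t, ⟨A', [], by simp⟩, hu⟩
        obtain ⟨r1, hr1, rfl⟩ := hu'
        rw [← himg] at hv
        obtain ⟨r2, hr2, rfl⟩ := hv
        have hss := subset_convexHull ℝ ({γ r1, γ t, γ r2} : Set Plane)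
        have h1 : segment ℝ (γ r1) (γ r2) ⊆ R :=
          ((convex_convexHull ℝ _).segment_subset (hss (by simp)) (hss (by simp))).trans hhull
        rw [← hsc (hr1.2.trans hr2.1) h1]
        exact ⟨t, ⟨hr1.2, hr2.1⟩, rfl⟩
      · have := hl.head; cases A <;> simpa using this
      · simp
      · rw [carrier_append, hc, hunion, carrier_cons_cons, carrier_singleton]
        congr 1
        rw [union_eq_left, singleton_subset_iff]
        exact right_mem_segment _ _ _
  have hnbhd : ∀ τ : unitInterval, ∃ U : Set unitInterval, IsOpen U ∧ τ ∈ U ∧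
      ∀ t ∈ U, segment ℝ (γ τ) (γ t) ⊆ R := by
    intro τ
    obtain ⟨U, hU, hUo, hτU⟩ := eventually_nhds_iff.1
      ((γ.continuous.tendsto τ).eventually (hR _ (hmem τ)))
    exact ⟨U, hUo, hτU, fun t ht => hU t ht (hmem t)⟩
  choose U hUo hτU hU using hnbhd
  -- Each subinterval lies in the neighbourhood of some time τ whose point sees the points at both
  -- ends. If τ lies between the ends, γ goes via γ τ; otherwise straightness from τ on, or up to τ,
  -- contains the wanted segment.
  obtain ⟨t, ht0, htm, ⟨m, hm⟩, hcov⟩ := exists_monotone_Icc_subset_open_cover_unitInterval hUo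
    (fun τ _ => mem_iUnion.2 ⟨τ, hτU τ⟩)
  have hK : ∀ k, K (t k) := by
    intro k
    induction k with
    | zero =>
      rw [ht0]
      exact ⟨[γ 0], Link.singleton (hmem 0), by simp⟩
    | succ k ih =>
      obtain ⟨τ, hτ⟩ := hcov k
      have hk := htm (Nat.le_succ k)
      have h1 := hU τ _ (hτ (left_mem_Icc.2 hk))
      have h2 := hU τ _ (hτ (right_mem_Icc.2 hk))
      rcases le_total τ (t k) with h3 | h3
      · refine hstep _ _ hk ?_ ih
        have himg := hsc (h3.trans hk) h2
        refine Subset.trans ((convex_segment _ _).segment_subset ?_ (right_mem_segment _ _ _)) h2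
        rw [← himg]; exact ⟨t k, ⟨h3, hk⟩, rfl⟩
      rcases le_total τ (t (k + 1)) with h4 | h4
      · exact hstep _ _ h4 h2 (hstep _ _ h3 (segment_symm ℝ (γ τ) _ ▸ h1) ih)
      · refine hstep _ _ hk ?_ ih
        rw [segment_symm] at h1
        have himg := hsc h3 h1
        refine Subset.trans ((convex_segment _ _).segment_subset (left_mem_segment _ _ _) ?_) h1
        rw [← himg]; exact ⟨t (k + 1), ⟨hk, h4⟩, rfl⟩
  obtain ⟨l, hl, hc⟩ := hK m
  rw [hm m le_rfl] at hl hc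
  rw [γ.source, γ.target] at hl
  refine ⟨l, hl, ?_⟩
  rw [hc, ← image_univ]
  congr 1
  ext u; simp [unitInterval.le_one']

/-! ### Taut lines at corners of the boundary -/

lemma cramer {u g : Plane} (h : det u g ≠ 0) (w : Plane) :
    w = (det w g / det u g) • u + (det u w / det u g) • g := by
  apply plane_ext <;> simp <;> field_simp <;> simp only [det] <;> ring

lemma exists_small_smul {r : ℝ} (hr : 0 < r) (V v : Plane) :
    ∃ δ : ℝ, 0 < δ ∧ δ ≤ 1 ∧ V + δ • v ∈ Metric.ball V r := by
  refine ⟨min 1 (r / (2 * (‖v‖ + 1))), by positivity, min_le_left _ _, ?_⟩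
  rw [mem_ball_iff_norm, add_sub_cancel_left, norm_smul, Real.norm_of_nonneg (by positivity)]
  have h1 := min_le_right 1 (r / (2 * (‖v‖ + 1)))
  have h2 : r / (2 * (‖v‖ + 1)) * ‖v‖ < r := by
    rw [div_mul_eq_mul_div, div_lt_iff₀ (by positivity)]
    nlinarith [norm_nonneg v]
  nlinarith [norm_nonneg v]

lemma add_smul_mem_segment {V v : Plane} {δ : ℝ} (h0 : 0 ≤ δ) (h1 : δ ≤ 1) :
    V + δ • (v - V) ∈ segment ℝ V v :=
  mem_segment_of_sub_eq h0 h1 (by rw [add_sub_cancel_left])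

lemma add_smul_ne {V v : Plane} {δ : ℝ} (h0 : 0 < δ) (hv : v ≠ V) : V + δ • (v - V) ≠ V := by
  rw [Ne, add_eq_left, smul_eq_zero, sub_eq_zero]
  rintro (h | h)
  exacts [h0.ne' h, hv h]

/-- Points of a triangle in the affine coordinates given by one of its vertices. -/
lemma mem_triangle {V a b z : Plane} (hz : z ∈ convexHull ℝ {a, V, b}) :
    ∃ α β : ℝ, 0 ≤ α ∧ 0 ≤ β ∧ α + β ≤ 1 ∧ z = V + (α • (a - V) + β • (b - V)) := by
  rw [convexHull_insert (by simp), convexHull_pair, mem_convexJoin] at hz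
  obtain ⟨a', ha', c, hc, hz⟩ := hz
  rw [mem_singleton_iff] at ha'
  subst ha'
  obtain ⟨s, t, hs, ht, hst, rfl⟩ := hc
  obtain ⟨α, β, hα, hβ, hαβ, rfl⟩ := hz
  obtain rfl : β = 1 - α := by linarith
  obtain rfl : s = 1 - t := by linarith
  exact ⟨α, (1 - α) * t, hα, by positivity, by nlinarith, by module⟩

lemma triangle_mem {V a b : Plane} {α β : ℝ} (hα : 0 ≤ α) (hβ : 0 ≤ β) (h : α + β ≤ 1) :
    V + (α • (a - V) + β • (b - V)) ∈ convexHull ℝ {a, V, b} := by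
  have hss := subset_convexHull ℝ ({a, V, b} : Set Plane)
  have hc := convex_convexHull ℝ ({a, V, b} : Set Plane)
  rcases (add_nonneg hα hβ).eq_or_lt with h0 | h0
  · obtain rfl : α = 0 := by linarith
    obtain rfl : β = 0 := by linarith
    simpa using hss (show V ∈ ({a, V, b} : Set Plane) by simp)
  · have h1 : (α / (α + β)) • a + (β / (α + β)) • b ∈ convexHull ℝ {a, V, b} :=
      hc (hss (by simp)) (hss (by simp)) (by positivity) (by positivity) (by field_simp)
    have h2 := hc (hss (show V ∈ ({a, V, b} : Set Plane) by simp)) h1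
      (show 0 ≤ 1 - (α + β) by linarith) h0.le (by ring)
    rw [smul_add, smul_smul, smul_smul, mul_div_cancel₀ _ h0.ne', mul_div_cancel₀ _ h0.ne'] at h2
    convert h2 using 1
    module

/-- At a point with a neighbourhood in `R`, a taut line is straight. -/
lemma Turn.mem_segment_of_nhds {R : Set Plane} {p q s : Plane} (h : Turn R p q s) (hp : p ≠ q)
    (hs : s ≠ q) (hR : R ∈ 𝓝 q) : q ∈ segment ℝ p s := by
  obtain ⟨r, hr, hball⟩ := Metric.mem_nhds_iff.1 hR
  obtain ⟨δ, hδ, hδ1, hb⟩ := exists_small_smul hr q (p - q)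
  obtain ⟨δ', hδ', hδ1', hb'⟩ := exists_small_smul hr q (s - q)
  have h1 := h (q + δ • (p - q)) (by rw [segment_symm]; exact add_smul_mem_segment hδ.le hδ1)
    (q + δ' • (s - q)) (add_smul_mem_segment hδ'.le hδ1') (add_smul_ne hδ hp) (add_smul_ne hδ' hs)
    (Subset.trans (convexHull_min (by
      rintro w (rfl | rfl | rfl)
      exacts [hb, Metric.mem_ball_self hr, hb']) (convex_ball q r)) hball)
  obtain ⟨a, b, ha, hb0, hab, he⟩ := h1
  obtain rfl : a = 1 - b := by linarith
  have h2 : ((1 - b) * δ) • (p - q) + (b * δ') • (s - q) = 0 := by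
    rw [← sub_eq_zero] at he
    rw [← he]; module
  have hpos : 0 < (1 - b) * δ + b * δ' := by
    rcases hb0.eq_or_lt with rfl | hb0
    · simpa using hδ
    · have := mul_pos hb0 hδ'
      have := mul_nonneg ha hδ.le
      linarith
  refine ⟨(1 - b) * δ / ((1 - b) * δ + b * δ'), b * δ' / ((1 - b) * δ + b * δ'), by positivity,
    by positivity, by field_simp, ?_⟩
  have h3 : ((1 - b) * δ) • p + (b * δ') • s = ((1 - b) * δ + b * δ') • q := by
    rw [← sub_eq_zero, ← h2]; module
  rw [div_eq_inv_mul, div_eq_inv_mul, mul_smul _ ((1 - b) * δ), mul_smul _ (b * δ'), ← smul_add,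
    h3, smul_smul, inv_mul_cancel₀ hpos.ne', one_smul]

namespace Corner

variable {S : Set Plane} {V A B : Plane}

/-- If a triangle at a corner lies in the region, the line is straight there or points on the
bisecting median are inside. -/
lemma straight_or_inside (h : Corner S V A B) {x y : Plane} (hx : x ∈ segment ℝ A V)
    (hy : y ∈ segment ℝ V B) (hxV : x ≠ V) (hyV : y ≠ V)
    (hR : convexHull ℝ {x, V, y} ⊆ regionOf S) :
    V ∈ segment ℝ x y ∨ (det (V - A) (B - V) ≠ 0 ∧
      ∀ᶠ t in 𝓝[>] (0 : ℝ), AffineMap.lineMap V (midpoint ℝ A B) t ∈ insideOf S) := by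
  by_cases h0 : det (V - A) (B - V) = 0
  · left
    obtain ⟨μ, hμ, he⟩ := h.ray h0
    refine seg_between (p := A) (q := B) ?_ hx hy
    refine ⟨μ / (1 + μ), 1 / (1 + μ), by positivity, by positivity, by field_simp; ring, ?_⟩
    have hB : B = V + μ • (V - A) := by rw [← he]; abel
    rw [hB]
    apply plane_ext <;> simp <;> field_simp <;> ring
  · right
    refine ⟨h0, ?_⟩
    obtain ⟨a, ha, hxa⟩ := sub_eq_of_mem_segment_left hx
    obtain ⟨b, hb, hyb⟩ := sub_eq_of_mem_segment_right hy
    have ha0 : 0 < a := lt_of_le_of_ne ha (by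
      rintro rfl; rw [zero_smul, neg_zero, sub_eq_zero] at hxa; exact hxV hxa)
    have hb0 : 0 < b := lt_of_le_of_ne hb (by
      rintro rfl; rw [zero_smul, sub_eq_zero] at hyb; exact hyV hyb)
    have hlim : Tendsto (fun t : ℝ => AffineMap.lineMap V (midpoint ℝ A B) t) (𝓝[>] 0) (𝓝 V) := by
      have : Tendsto (fun t : ℝ => AffineMap.lineMap V (midpoint ℝ A B) t) (𝓝 0)
        (𝓝 (AffineMap.lineMap V (midpoint ℝ A B) (0:ℝ))) := Continuous.tendsto (by fun_prop) _
      rw [AffineMap.lineMap_apply_zero] at this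
      exact this.mono_left nhdsWithin_le_nhds
    -- The determinant itself serves as the sign σ, which selects the convex sector; for small t the
    -- median lies in it and in the given triangle.
    filter_upwards [hlim.eventually (h.notMem_of_sector (det (V - A) (B - V))),
      Ioo_mem_nhdsGT (show (0:ℝ) < min a b by positivity)] with t ht1 ht2
    have hta : t < a := ht2.2.trans_le (min_le_left _ _)
    have htb : t < b := ht2.2.trans_le (min_le_right _ _)
    have ht0 := ht2.1
    have hval : AffineMap.lineMap V (midpoint ℝ A B) t - V =
        (t / 2) • ((B - V) - (V - A)) := by
      rw [AffineMap.lineMap_apply, midpoint_eq_smul_add, vsub_eq_sub, vadd_eq_add, invOf_eq_inv]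
      module
    have hz : AffineMap.lineMap V (midpoint ℝ A B) t ∈ regionOf S := by
      have : AffineMap.lineMap V (midpoint ℝ A B) t =
          V + ((t / 2 / a) • (x - V) + (t / 2 / b) • (y - V)) := by
        rw [← sub_eq_iff_eq_add', hval, hxa, hyb, smul_neg, smul_smul, smul_smul,
          div_mul_cancel₀ _ ha0.ne', div_mul_cancel₀ _ hb0.ne']
        module
      rw [this]
      refine hR (triangle_mem (by positivity) (by positivity) ?_)
      have h1 : t / 2 / a ≤ 1 / 2 := by rw [div_le_iff₀ ha0]; linarith
      have h2 : t / 2 / b ≤ 1 / 2 := by rw [div_le_iff₀ hb0]; linarith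
      linarith
    refine hz.resolve_left (ht1 ?_)
    rw [hval]
    have hpos : 0 < det (V - A) (B - V) * det (V - A) (B - V) := mul_self_pos.2 h0
    have e1 : det (V - A) ((t / 2) • ((B - V) - (V - A))) = t / 2 * det (V - A) (B - V) := by
      simp [det]; ring
    have e2 : det (B - V) ((t / 2) • ((B - V) - (V - A))) = t / 2 * det (V - A) (B - V) := by
      simp [det]; ring
    have := mul_pos (half_pos ht0) hpos
    refine Or.inl ⟨hpos, ?_, ?_⟩
    · rw [e1]; linarith
    · rw [e2]; linarith

/-- If a line that arrives along an edge and leaves into the inside is taut, it is straight or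
it leaves on the other side of the other edge. -/
lemma turn_cases (h : Corner S V A B) {G : Plane} (hG : G ≠ V)
    (hGin : openSegment ℝ V G ⊆ insideOf S)
    (ht : Turn (regionOf S) A V G) :
    (∃ r : ℝ, 0 < r ∧ A - V = -(r • (G - V))) ∨
      (det (A - V) (G - V) ≠ 0 ∧ ∃ α β : ℝ, 0 ≤ α ∧ 0 < β ∧
        B - V = α • (A - V) + β • (G - V)) := by
  have hg0 : G - V ≠ 0 := sub_ne_zero.2 hG
  have hin : ∀ δ : ℝ, 0 < δ → δ < 1 → V + δ • (G - V) ∈ insideOf S := fun δ h0 h1 =>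
    hGin ⟨1 - δ, δ, by linarith, h0, by ring, by module⟩
  by_cases hdet : det (A - V) (G - V) = 0
  · left
    rw [det_swap, neg_eq_zero] at hdet
    obtain ⟨r, hr⟩ := exists_smul_of_det_eq_zero hg0 hdet
    refine ⟨-r, ?_, by rw [hr]; module⟩
    by_contra! hcon
    have hr0 : r ≠ 0 := by
      rintro rfl; rw [zero_smul, sub_eq_zero] at hr; exact h.left_ne hr
    have hrpos : 0 < r := lt_of_le_of_ne (by linarith) hr0.symm
    set δ := min 1 r / 2 with hδ
    have hδ0 : 0 < δ := by positivity
    have hδ1 : δ < 1 := by have := min_le_left 1 r; linarith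
    have hδr : δ ≤ r := by have := min_le_right 1 r; linarith
    refine (hin δ hδ0 hδ1).1 (h.left_subset ?_)
    rw [segment_symm]
    refine mem_segment_of_sub_eq (r := δ / r) (by positivity) ((div_le_one hrpos).2 hδr) ?_
    rw [hr, smul_smul, div_mul_cancel₀ _ hr0, add_sub_cancel_left]
  · right
    refine ⟨hdet, ?_⟩
    -- If B is not in the cone spanned by A and G, the part of the cone near V misses S. It contains
    -- points of VG, so it is inside, and a small triangle there would contradict tautness.
    by_contra! hcone
    obtain ⟨r, hr, hball⟩ := Metric.eventually_nhds_iff_ball.1 h.near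
    set σ := det (A - V) (G - V) with hσ
    -- In coordinates α(A - V) + β(G - V) this is α ≥ 0 and β > 0, intersected with a ball: the ray
    -- towards A is left out because it lies in S.
    let T₀ : Set Plane :=
      ({p | 0 ≤ (-σ) * det (G - V) p} ∩ {p | 0 < σ * det (A - V) p}) ∩ Metric.ball 0 r
    let T : Set Plane := (fun p => V + p) '' T₀
    have hT : IsPreconnected T :=
      ((((convex_halfSpace_ge (isLinearMap_det (-σ) (G - V)) 0).inter
        (convex_halfSpace_gt (isLinearMap_det σ (A - V)) 0)).inter
        (convex_ball 0 r)).isPreconnected).image _ (by fun_prop)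
    have hTd : Disjoint T S := by
      rw [Set.disjoint_left]
      rintro _ ⟨p, ⟨⟨hp1, hp2⟩, hp3⟩, rfl⟩ hS
      have hp1 : 0 ≤ (-σ) * det (G - V) p := hp1
      have hp2 : 0 < σ * det (A - V) p := hp2
      rcases hball (V + p) (by
        rw [mem_ball_iff_norm, add_sub_cancel_left]; simpa using hp3) hS with h1 | h1
      · obtain ⟨t, ht, he⟩ := sub_eq_of_mem_segment_left h1
        rw [add_sub_cancel_left] at he
        rw [he, ← smul_neg, neg_sub, det_smul_right, det_self] at hp2
        simp at hp2
      · obtain ⟨t, ht, he⟩ := sub_eq_of_mem_segment_right h1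
        rw [add_sub_cancel_left] at he
        rw [he, det_smul_right] at hp1 hp2
        have ht0 : t ≠ 0 := by rintro rfl; simp at hp2
        have htpos : 0 < t := lt_of_le_of_ne ht ht0.symm
        have k1 : 0 ≤ det (B - V) (G - V) / σ := by
          have : 0 ≤ σ * det (B - V) (G - V) := by
            rw [det_swap (B - V)]
            by_contra! hneg
            have := mul_neg_of_pos_of_neg htpos hneg
            linarith
          rw [← mul_div_mul_left _ _ hdet]
          exact div_nonneg this (mul_self_nonneg σ)
        have k2 : 0 < det (A - V) (B - V) / σ := by
          have : 0 < σ * det (A - V) (B - V) := by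
            by_contra! hneg
            have := mul_nonpos_of_nonneg_of_nonpos htpos.le hneg
            linarith
          rw [← mul_div_mul_left _ _ hdet]
          exact div_pos this (mul_self_pos.2 hdet)
        exact hcone _ _ k1 k2 (cramer hdet (B - V))
    have hσσ : 0 < σ * σ := mul_self_pos.2 hdet
    have hTmem : ∀ α β : ℝ, 0 ≤ α → 0 < β →
        V + (α • (A - V) + β • (G - V)) ∈ Metric.ball V r →
        V + (α • (A - V) + β • (G - V)) ∈ T := by
      intro α β hα hβ hb
      refine ⟨_, ⟨⟨?_, ?_⟩, ?_⟩, rfl⟩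
      · change 0 ≤ (-σ) * det (G - V) (α • (A - V) + β • (G - V))
        have : det (G - V) (α • (A - V) + β • (G - V)) = -(α * σ) := by
          rw [hσ]; simp [det]; ring
        rw [this]
        have := mul_nonneg hα hσσ.le
        linarith
      · change 0 < σ * det (A - V) (α • (A - V) + β • (G - V))
        have : det (A - V) (α • (A - V) + β • (G - V)) = β * σ := by
          rw [hσ]; simp [det]; ring
        rw [this]
        have := mul_pos hβ hσσ
        linarith
      · rw [mem_ball_iff_norm, add_sub_cancel_left] at hb
        simpa using hb
    have hTin : T ⊆ insideOf S := by
      obtain ⟨δ, hδ, hδ1, hb⟩ := exists_small_smul hr V (G - V)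
      have hmem : V + ((0:ℝ) • (A - V) + (δ / 2) • (G - V)) ∈ T := by
        refine hTmem 0 (δ / 2) le_rfl (by positivity) ?_
        rw [mem_ball_iff_norm, add_sub_cancel_left] at hb ⊢
        rw [zero_smul, zero_add]
        rw [norm_smul, Real.norm_of_nonneg (by positivity)] at hb ⊢
        nlinarith [norm_nonneg (G - V)]
      intro z hz
      refine mem_insideOf_of_isPreconnected hT hTd hmem hz ?_
      rw [zero_smul, zero_add]
      exact hin _ (by positivity) (by linarith)
    obtain ⟨δ, hδ, hδ1, hb⟩ := exists_small_smul hr V (A - V)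
    obtain ⟨δ', hδ', hδ1', hb'⟩ := exists_small_smul hr V (G - V)
    have hseg := ht (V + δ • (A - V)) (by
        rw [segment_symm]; exact add_smul_mem_segment hδ.le hδ1)
      (V + δ' • (G - V)) (add_smul_mem_segment hδ'.le hδ1') (add_smul_ne hδ h.left_ne)
      (add_smul_ne hδ' hG) (by
        intro z hz
        have hzb : z ∈ Metric.ball V r := by
          refine convexHull_min ?_ (convex_ball V r) hz
          rintro w (rfl | rfl | rfl)
          exacts [hb, Metric.mem_ball_self hr, hb']
        obtain ⟨α, β, hα, hβ, hαβ, rfl⟩ := mem_triangle hz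
        rw [add_sub_cancel_left, add_sub_cancel_left, smul_smul, smul_smul] at hzb ⊢
        rcases hβ.eq_or_lt with rfl | hβ0
        · rw [zero_mul, zero_smul, add_zero]
          refine Or.inl (h.left_subset ?_)
          rw [segment_symm]
          exact add_smul_mem_segment (by positivity) (by nlinarith)
        · exact Or.inr (hTin (hTmem _ _ (by positivity) (by positivity) hzb)))
    obtain ⟨a, b, ha, hb0, hab, he⟩ := hseg
    obtain rfl : a = 1 - b := by linarith
    have h2 : ((1 - b) * δ) • (A - V) + (b * δ') • (G - V) = 0 := by
      rw [← sub_eq_zero] at he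
      rw [← he]; module
    have h3 := congrArg (fun v => det v (G - V)) h2
    have h4 := congrArg (fun v => det (A - V) v) h2
    have e3 : det (((1 - b) * δ) • (A - V) + (b * δ') • (G - V)) (G - V) = (1 - b) * δ * σ := by
      rw [hσ]; simp [det]; ring
    have e4 : det (A - V) (((1 - b) * δ) • (A - V) + (b * δ') • (G - V)) = b * δ' * σ := by
      rw [hσ]; simp [det]; ring
    have z1 : det 0 (G - V) = 0 := by simp [det]
    have z2 : det (A - V) 0 = 0 := by simp [det]
    simp only [e3, e4, z1, z2] at h3 h4
    have k3 : (1 - b) = 0 := by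
      rcases mul_eq_zero.1 h3 with h | h
      · exact (mul_eq_zero.1 h).resolve_right hδ.ne'
      · exact absurd h hdet
    have k4 : b = 0 := by
      rcases mul_eq_zero.1 h4 with h | h
      · exact (mul_eq_zero.1 h).resolve_right hδ'.ne'
      · exact absurd h hdet
    linarith

/-- Two taut lines cannot arrive along the two edges of a corner and leave in the same
direction into the inside. -/
lemma not_turn_both (h : Corner S V A B) {G : Plane} (hG : G ≠ V)
    (hGin : openSegment ℝ V G ⊆ insideOf S)
    (hA : Turn (regionOf S) A V G) (hB : Turn (regionOf S) B V G) : False := by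
  have hg0 : G - V ≠ 0 := sub_ne_zero.2 hG
  rcases h.turn_cases hG hGin hA with ⟨r, hr, h1⟩ | ⟨hd, α, β, hα, hβ, h1⟩
  · rcases h.symm.turn_cases hG hGin hB with ⟨r', hr', h2⟩ | ⟨hd', α', β', hα', hβ', h2⟩
    -- If both edges are opposite to G, they overlap, which `ray` excludes.
    · have e1 : V - A = r • (G - V) := by rw [← neg_sub, h1, neg_neg]
      obtain ⟨μ, hμ, h3⟩ := h.ray (by rw [e1, h2]; simp [det]; ring)
      rw [h2, e1, smul_smul, ← neg_smul] at h3
      have := smul_left_injective ℝ hg0 h3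
      nlinarith
    · have h3 := congrArg (fun v => det v (G - V)) h2
      have e1 : det (A - V) (G - V) = 0 := by rw [h1]; simp [det]; ring
      have e2 : det (α' • (B - V) + β' • (G - V)) (G - V) = α' * det (B - V) (G - V) := by
        simp [det]; ring
      simp only [e1, e2] at h3
      rcases mul_eq_zero.1 h3.symm with h4 | h4
      · rw [h4, zero_smul, zero_add, h1, ← neg_smul] at h2
        have := smul_left_injective ℝ hg0 h2
        linarith
      · exact hd' h4
  · rcases h.symm.turn_cases hG hGin hB with ⟨r', hr', h2⟩ | ⟨hd', α', β', hα', hβ', h2⟩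
    · have h3 := congrArg (fun v => det v (G - V)) h1
      have e1 : det (B - V) (G - V) = 0 := by rw [h2]; simp [det]; ring
      have e2 : det (α • (A - V) + β • (G - V)) (G - V) = α * det (A - V) (G - V) := by
        simp [det]; ring
      simp only [e1, e2] at h3
      rcases mul_eq_zero.1 h3.symm with h4 | h4
      · rw [h4, zero_smul, zero_add, h2, ← neg_smul] at h1
        have := smul_left_injective ℝ hg0 h1
        linarith
      · exact hd h4
    -- B would lie between A and G, and A between B and G; comparing determinants makes a positive
    -- multiple of det (A - V) (G - V) vanish.
    · have h3 := congrArg (fun v => det (A - V) v) h1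
      have h4 := congrArg (fun v => det v (B - V)) h2
      have e3 : det (A - V) (α • (A - V) + β • (G - V)) = β * det (A - V) (G - V) := by
        simp [det]; ring
      have e4 : det (α' • (B - V) + β' • (G - V)) (B - V) = -(β' * det (B - V) (G - V)) := by
        simp [det]; ring
      have h5 := congrArg (fun v => det v (G - V)) h1
      have e5 : det (α • (A - V) + β • (G - V)) (G - V) = α * det (A - V) (G - V) := by
        simp [det]; ring
      simp only [e3, e4, e5] at h3 h4 h5
      rw [h5] at h4
      rw [h3] at h4
      have h6 : (β + β' * α) * det (A - V) (G - V) = 0 := by linarith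
      rcases mul_eq_zero.1 h6 with h7 | h7
      · have := mul_nonneg hβ'.le hα
        linarith
      · exact hd h7

end Corner

/-! ### Local behaviour of taut lines -/

/-- A segment in the region that leaves a boundary edge shows which side of it is inside. -/
lemma SimpleCycle.halfGerm_of_segment {n : ℕ} {Q : ℕ → Plane} (h : SimpleCycle n Q) {t : ℕ}
    {m G : Plane} (hm : m ∈ openSegment ℝ (Q t) (Q (t + 1)))
    (hG : segment ℝ m G ⊆ regionOf (bd Q)) (hdet : det (Q (t + 1) - Q t) (G - m) ≠ 0) :
    ∀ᶠ y in 𝓝 m, 0 < det (Q (t + 1) - Q t) (G - m) * det (Q (t + 1) - Q t) (y - m) →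
      y ∈ insideOf (bd Q) := by
  set d := Q (t + 1) - Q t with hd
  set σ := det d (G - m) with hσ
  obtain ⟨c, hc⟩ := exists_halfGerm_edge (f := fun x => x ∈ insideOf (bd Q)) (h.ne t)
    (fun m hm => h.corner_edge hm) (fun T hT hd x hx y hy => propext
      ⟨mem_insideOf_of_isPreconnected hT hd hx hy, mem_insideOf_of_isPreconnected hT hd hy hx⟩)
    hdet
  have hg := hc m hm
  have hlim : Tendsto (fun ε : ℝ => m + ε • (G - m)) (𝓝[>] 0) (𝓝 m) := by
    have : Tendsto (fun ε : ℝ => m + ε • (G - m)) (𝓝 0) (𝓝 (m + (0:ℝ) • (G - m))) :=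
      Continuous.tendsto (by fun_prop) _
    rw [zero_smul, add_zero] at this
    exact this.mono_left nhdsWithin_le_nhds
  obtain ⟨ε, ⟨h1, h2⟩, h3⟩ := ((hlim.eventually (hg.and (h.corner_edge hm).near)).and
    (Ioo_mem_nhdsGT (zero_lt_one (α := ℝ)))).exists
  have hval : det d (m + ε • (G - m) - m) = ε * σ := by
    rw [add_sub_cancel_left, det_smul_right]
  have hpos : 0 < σ * det d (m + ε • (G - m) - m) := by
    rw [hval]
    have := mul_pos h3.1 (mul_self_pos.2 hdet)
    linarith
  have hdet0 : ∀ y ∈ segment ℝ (Q t) (Q (t + 1)), det d (y - m) = 0 := by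
    rintro y ⟨a, b, ha, hb, hab, rfl⟩
    obtain ⟨a', b', ha', hb', hab', rfl⟩ := hm
    obtain rfl : b = 1 - a := by linarith
    obtain rfl : b' = 1 - a' := by linarith
    have : a • Q t + (1 - a) • Q (t + 1) - (a' • Q t + (1 - a') • Q (t + 1)) =
      (a' - a) • d := by rw [hd]; module
    rw [this, det_smul_right, det_self, mul_zero]
  have hms := openSegment_subset_segment _ _ _ hm
  have hin : m + ε • (G - m) ∈ insideOf (bd Q) := by
    refine (hG (add_smul_mem_segment h3.1.le h3.2.le)).resolve_left fun hb => ?_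
    have : det d (m + ε • (G - m) - m) = 0 := by
      rcases h2 hb with h4 | h4
      · exact hdet0 _ ((convex_segment _ _).segment_subset (left_mem_segment _ _ _) hms h4)
      · exact hdet0 _ ((convex_segment _ _).segment_subset hms (right_mem_segment _ _ _) h4)
    rw [this] at hpos
    simp at hpos
  have hctrue : c = True := by rw [← h1 hpos]; exact eq_true hin
  filter_upwards [hg] with y hy hy'
  have := hy hy'
  rw [hctrue] at this
  exact of_eq_true this

/-- A taut line cannot leave a boundary edge at an interior point of that edge. -/
lemma SimpleCycle.det_eq_zero_of_turn {n : ℕ} {Q : ℕ → Plane} (h : SimpleCycle n Q) {t : ℕ}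
    {m p s : Plane} (hm : m ∈ openSegment ℝ (Q t) (Q (t + 1)))
    (hp : segment ℝ m p ⊆ regionOf (bd Q)) (hs : segment ℝ m s ⊆ regionOf (bd Q))
    (hpm : p ≠ m) (hsm : s ≠ m) (ht : Turn (regionOf (bd Q)) p m s) :
    det (Q (t + 1) - Q t) (p - m) = 0 := by
  by_contra hdet
  have hd0 : Q (t + 1) - Q t ≠ 0 := sub_ne_zero.2 (h.ne t).symm
  have g1 := h.halfGerm_of_segment hm hp hdet
  set d := Q (t + 1) - Q t with hd
  set σ := det d (p - m) with hσ
  have hσσ : 0 < σ * σ := mul_self_pos.2 hdet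
  rcases lt_or_ge (σ * det d (s - m)) 0 with hneg | hpos
  -- If the line crosses the edge, both sides near m are inside. An exterior point near m, moved off
  -- the line of the edge if necessary, contradicts this.
  · have hdet' : det d (s - m) ≠ 0 := by intro h0; rw [h0] at hneg; simp at hneg
    have g2 := h.halfGerm_of_segment hm hs hdet'
    have hmc := h.jordan.1 (h.corner_edge hm).mem
    rw [mem_closure_iff_frequently] at hmc
    obtain ⟨y, hy, hy'⟩ := (hmc.and_eventually (g1.and g2).eventually_nhds).exists
    have hopen := (isClosed_regionOf h.isClosed_bd).isOpen_compl.eventually_mem hy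
    have key : ∃ z, z ∈ (regionOf (bd Q))ᶜ ∧ det d (z - m) ≠ 0 ∧
        (0 < σ * det d (z - m) → z ∈ insideOf (bd Q)) ∧
        (0 < det d (s - m) * det d (z - m) → z ∈ insideOf (bd Q)) := by
      by_cases hy0 : det d (y - m) = 0
      · obtain ⟨z, hz, hz1, hz2⟩ := ((frequently_half hd0 y one_ne_zero).and_eventually
          (hopen.and hy')).exists
        refine ⟨z, hz1, ?_, hz2⟩
        have : z - m = (y - m) + (1:ℝ) • (z - y) := by module
        rw [this, det_add_smul, hy0]
        exact (by linarith : (0:ℝ) < 0 + 1 * det d (z - y)).ne'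
      · exact ⟨y, hy, hy0, hy'.self_of_nhds⟩
    obtain ⟨z, hz, hz0, hz1, hz2⟩ := key
    refine hz (Or.inr ?_)
    rcases (mul_ne_zero hdet hz0).lt_or_gt with h1 | h1
    · refine hz2 ?_
      by_contra! h2
      have h3 := mul_nonneg_of_nonpos_of_nonpos hneg.le h1.le
      have h4 : σ * det d (s - m) * (σ * det d (z - m)) =
        σ * σ * (det d (s - m) * det d (z - m)) := by ring
      have h5 := mul_pos_of_neg_of_neg hneg h1
      rw [h4] at h5
      have := mul_nonpos_of_nonneg_of_nonpos hσσ.le h2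
      linarith
    · exact hz1 h1
  -- Otherwise s is on the side of p or on the line of the edge; a small triangle is then in the
  -- region and cuts the corner.
  · obtain ⟨r, hr, hball⟩ := Metric.eventually_nhds_iff_ball.1 g1
    obtain ⟨δ, hδ, hδ1, hb⟩ := exists_small_smul hr m (p - m)
    obtain ⟨δ', hδ', hδ1', hb'⟩ := exists_small_smul hr m (s - m)
    have hseg := ht (m + δ • (p - m)) (by
        rw [segment_symm]; exact add_smul_mem_segment hδ.le hδ1)
      (m + δ' • (s - m)) (add_smul_mem_segment hδ'.le hδ1') (add_smul_ne hδ hpm)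
      (add_smul_ne hδ' hsm) (by
        intro z hz
        have hzb : z ∈ Metric.ball m r := by
          refine convexHull_min ?_ (convex_ball m r) hz
          rintro w (rfl | rfl | rfl)
          exacts [hb, Metric.mem_ball_self hr, hb']
        obtain ⟨α, β, hα, hβ, hαβ, rfl⟩ := mem_triangle hz
        rw [add_sub_cancel_left, add_sub_cancel_left, smul_smul, smul_smul] at hzb ⊢
        rcases hα.eq_or_lt with rfl | hα0
        · rw [zero_mul, zero_smul, zero_add]
          exact hs (add_smul_mem_segment (by positivity) (by nlinarith))
        · refine Or.inr (hball _ hzb ?_)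
          rw [add_sub_cancel_left, det_add_smul, det_smul_right]
          have h1 := mul_pos (mul_pos hα0 hδ) hσσ
          have h2 := mul_nonneg (mul_nonneg hβ hδ'.le) hpos
          rw [← hσ]
          linarith)
    obtain ⟨a, b, ha, hb0, hab, he⟩ := hseg
    obtain rfl : a = 1 - b := by linarith
    have h2 : ((1 - b) * δ) • (p - m) + (b * δ') • (s - m) = 0 := by
      rw [← sub_eq_zero] at he
      rw [← he]; module
    have h3 := congrArg (fun v => σ * det d v) h2
    have z0 : det d 0 = 0 := by simp [det]
    simp only [det_add_smul, det_smul_right, z0, mul_zero] at h3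
    rw [← hσ] at h3
    have h4 := mul_nonneg (mul_nonneg ha hδ.le) hσσ.le
    have h5 := mul_nonneg (mul_nonneg hb0 hδ'.le) hpos
    have h6 : (1 - b) * δ * (σ * σ) = 0 := by linarith
    have h7 : 1 - b = 0 := by
      rcases mul_eq_zero.1 h6 with h8 | h8
      · exact (mul_eq_zero.1 h8).resolve_right hδ.ne'
      · exact absurd h8 hσσ.ne'
    obtain rfl : b = 1 := by linarith
    rw [sub_self, zero_mul, zero_smul, zero_add, one_mul, smul_eq_zero, sub_eq_zero] at h2
    rcases h2 with h2 | h2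
    exacts [hδ'.ne' h2, hsm h2]

/-- A taut line through an interior point of an edge runs along that edge. -/
lemma SimpleCycle.eventually_mem_carrier {n : ℕ} {Q : ℕ → Plane} (h : SimpleCycle n Q) {t : ℕ}
    {m x y : Plane} {l : List Plane} (hm : m ∈ openSegment ℝ (Q t) (Q (t + 1)))
    (hl : Link (regionOf (bd Q)) x y l) (hml : m ∈ carrier l) (hmx : m ≠ x) (hmy : m ≠ y) :
    ∀ᶠ r in 𝓝 (0 : ℝ), m + r • (Q (t + 1) - Q t) ∈ carrier l := by
  obtain ⟨A, B, hL, hcar⟩ := hl.exists_insert hml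
  rw [← hcar]
  rcases List.eq_nil_or_concat' A with rfl | ⟨A, p, rfl⟩
  · exact absurd (by simpa using hL.head) hmx
  rcases B with _ | ⟨s, B⟩
  · exact absurd (by simpa using hL.last) hmy
  have hi1 : [p, m] <:+: A ++ [p] ++ m :: s :: B := ⟨A, s :: B, by simp⟩
  have hi2 : [m, s] <:+: A ++ [p] ++ m :: s :: B := ⟨A ++ [p], B, by simp⟩
  have hpm := hL.ne p m hi1
  have hsm := (hL.ne m s hi2).symm
  have c1 : segment ℝ m p ⊆ carrier (A ++ [p] ++ m :: s :: B) := by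
    rw [segment_symm]; exact Taut.segment_subset_carrier hi1
  have c2 : segment ℝ m s ⊆ carrier (A ++ [p] ++ m :: s :: B) :=
    Taut.segment_subset_carrier hi2
  have s1 := c1.trans hL.subset
  have s2 := c2.trans hL.subset
  have ht := hL.turn p m s ⟨A, B, by simp⟩
  have hd0 : Q (t + 1) - Q t ≠ 0 := sub_ne_zero.2 (h.ne t).symm
  obtain ⟨α, hα⟩ := exists_smul_of_det_eq_zero hd0
    (h.det_eq_zero_of_turn hm s1 s2 hpm hsm ht)
  obtain ⟨β, hβ⟩ := exists_smul_of_det_eq_zero hd0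
    (h.det_eq_zero_of_turn hm s2 s1 hsm hpm ht.symm)
  have hα0 : α ≠ 0 := by
    rintro rfl; rw [zero_smul, sub_eq_zero] at hα; exact hpm hα
  have hβ0 : β ≠ 0 := by
    rintro rfl; rw [zero_smul, sub_eq_zero] at hβ; exact hsm hβ
  have hspike : ∀ z, z ∈ segment ℝ m p → z ∈ segment ℝ m s → z = m := by
    intro z h1 h2
    by_contra hz
    have := ht z (by rwa [segment_symm]) z h2 hz hz (by
      refine Subset.trans (convexHull_min ?_ (convex_segment m p)) s1
      rintro w (rfl | rfl | rfl)
      exacts [h1, left_mem_segment _ _ _, h1])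
    rw [segment_same, mem_singleton_iff] at this
    exact hz this.symm
  -- Both neighbours lie on the line of the edge; a taut line cannot turn back at m, so they lie on
  -- opposite sides and cover a neighbourhood of m in that line.
  have hαβ : α * β < 0 := by
    by_contra! hcon
    have hpos : 0 < α * β := lt_of_le_of_ne hcon (mul_ne_zero hα0 hβ0).symm
    rcases le_total (α / β) 1 with h1 | h1
    · have : 0 < α / β := by rw [← mul_div_mul_right _ _ hβ0]; exact div_pos hpos (mul_self_pos.2 hβ0)
      refine hpm (hspike p (right_mem_segment _ _ _) (mem_segment_of_sub_eq this.le h1 ?_))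
      rw [hβ, smul_smul, div_mul_cancel₀ _ hβ0, hα]
    · have h0 : 0 < β / α := by
        rw [← mul_div_mul_right _ _ hα0]
        exact div_pos (by linarith) (mul_self_pos.2 hα0)
      have h2 : β / α ≤ 1 := by
        have := inv_le_one_of_one_le₀ h1
        rwa [inv_div] at this
      refine hsm (hspike s (mem_segment_of_sub_eq h0.le h2 ?_) (right_mem_segment _ _ _))
      rw [hα, smul_smul, div_mul_cancel₀ _ hα0, hβ]
  have e1 : ∀ᶠ r in 𝓝 (0:ℝ), r / α < 1 :=
    (continuous_id.div_const α).continuousAt.eventually_lt continuousAt_const (by simp)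
  have e2 : ∀ᶠ r in 𝓝 (0:ℝ), r / β < 1 :=
    (continuous_id.div_const β).continuousAt.eventually_lt continuousAt_const (by simp)
  filter_upwards [e1, e2] with r h1 h2
  rcases le_or_gt 0 (r / α) with h3 | h3
  · refine c1 (mem_segment_of_sub_eq h3 h1.le ?_)
    rw [hα, smul_smul, div_mul_cancel₀ _ hα0, add_sub_cancel_left]
  · refine c2 (mem_segment_of_sub_eq ?_ h2.le ?_)
    · have h4 : r / β = (r / α) * (α * β) / (β * β) := by field_simp
      rw [h4]
      exact div_nonneg (mul_nonneg_of_nonpos_of_nonpos h3.le hαβ.le) (mul_self_nonneg β)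
    · rw [hβ, smul_smul, div_mul_cancel₀ _ hβ0, add_sub_cancel_left]

/-! ### Common points and common edges of taut lines -/

namespace Link

variable {R S : Set Plane} {l l' A B A' B' : List Plane} {a p q s x y z x' y' X Y Z : Plane}

/-- A taut line that ends along a chord inside the region, pointing away from an endpoint of the
chord, comes from that endpoint. -/
lemma exists_turn_of_chord (hS : IsClosed S) {p' p'' : Plane}
    (hin : openSegment ℝ p' p'' ⊆ insideOf S) (ha : a ∉ insideOf S) (hap : a ≠ p')
    (h : Link (regionOf S) a Y (A ++ [X, Y])) (hX : X ∈ segment ℝ p' Y)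
    (hY : Y ∈ segment ℝ p' p'') :
    ∃ A' r, Link (regionOf S) a p' (A' ++ [r, p']) ∧ Turn (regionOf S) r p' p'' := by
  induction A using List.reverseRecOn generalizing X Y with
  | nil =>
    have hXY : X ≠ Y := h.ne X Y ⟨[], [], by simp⟩
    obtain rfl : X = a := by simpa using h.head
    refine absurd (hin (mem_openSegment_of_ne_left_right hap.symm ?_ ?_)) ha
    · rintro rfl
      rw [mem_segment_iff_wbtw] at hX hY
      exact hXY (hX.swap_right_iff.1 hY)
    · exact (convex_segment _ _).segment_subset (left_mem_segment _ _ _) hY hX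
  | append_singleton A W ih =>
    have hXY : X ≠ Y := h.ne X Y ⟨A ++ [W], [], by simp⟩
    have hWX : W ≠ X := h.ne W X ⟨A, [Y], by simp⟩
    have ht : Turn (regionOf S) W X Y := h.turn W X Y ⟨A, [], by simp⟩
    have hXs : X ∈ segment ℝ p' p'' :=
      (convex_segment _ _).segment_subset (left_mem_segment _ _ _) hY hX
    have hXl : Link (regionOf S) a X (A ++ [W, X]) := by
      have : A ++ [W] ++ [X, Y] = (A ++ [W]) ++ X :: [Y] := by simp
      rw [this] at h
      simpa using h.left
    by_cases hXp : X = p'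
    · subst hXp
      exact ⟨A, W, hXl, ht.grow_right hY hXY.symm⟩
    have hXp'' : X ≠ p'' := by
      rintro rfl
      rw [mem_segment_iff_wbtw] at hX hY
      exact hXY (hX.swap_right_iff.1 hY)
    have hXin := hin (mem_openSegment_of_ne_left_right (Ne.symm hXp) hXp''.symm hXs)
    -- At an inside vertex the line is straight, so the previous vertex W lies on the ray from X
    -- towards p': either before p', and the argument repeats, or beyond it, and p' is inserted as a
    -- vertex.
    have hWXY := ht.mem_segment_of_nhds hWX hXY.symm
      (mem_of_superset ((isOpen_insideOf hS).mem_nhds hXin) (insideOf_subset_regionOf S))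
    have hray : SameRay ℝ (p' - X) (W - X) := by
      rw [mem_segment_iff_wbtw] at hX hWXY
      have h1 := hX.sameRay_vsub
      have h2 := hWXY.sameRay_vsub
      have := h1.trans h2.symm fun h0 => absurd (sub_eq_zero.1 h0) hXY.symm
      simpa using this.neg
    rcases wbtw_total_of_sameRay_vsub_left (x := X) hray with h1 | h1
    · rw [← mem_segment_iff_wbtw] at h1
      by_cases hWp : W = p'
      · subst hWp
        exact ih hXl (left_mem_segment _ _ _) hXs
      · have hT : Taut (regionOf S) (A ++ W :: X :: []) := by simpa using hXl.toTaut
        rw [segment_symm] at h1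
        have hT' := hT.insert h1 (Ne.symm hWp) (Ne.symm hXp)
        refine ⟨A, W, ⟨hT'.of_infix ⟨[], [X], by simp⟩, ?_, by simp⟩,
          (turn_of_mem_segment _ h1).grow_right hXs hXp⟩
        have := hXl.head; cases A <;> simpa using this
    · rw [← mem_segment_iff_wbtw, segment_symm] at h1
      exact ih hXl h1 hXs

/-- A later point of a taut line may be made a vertex. -/
lemma exists_insert_tail (h : Link R x y (A ++ X :: B)) (hZ : Z ∈ carrier (X :: B))
    (hne : Z ≠ X) : ∃ N D, Link R x y (A ++ X :: (N ++ Z :: D)) := by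
  by_cases hmem : Z ∈ X :: B
  · obtain ⟨N, D, rfl⟩ := List.append_of_mem ((List.mem_cons.1 hmem).resolve_left hne)
    exact ⟨N, D, h⟩
  · obtain ⟨p, q, ⟨C, D, hCD⟩, hzpq⟩ := hZ.resolve_left hmem
    have hCD : C ++ p :: q :: D = X :: B := by simpa using hCD
    rw [← hCD] at h hmem
    have hzp : Z ≠ p := by rintro rfl; simp at hmem
    have hzq : Z ≠ q := by rintro rfl; simp at hmem
    have hT : Taut R ((A ++ C) ++ p :: q :: D) := by simpa using h.toTaut
    have hT' := hT.insert hzpq hzp hzq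
    have hhead := h.head
    have hlast := h.last
    cases C with
    | nil =>
      simp only [List.nil_append, List.cons.injEq] at hCD
      obtain ⟨rfl, rfl⟩ := hCD
      refine ⟨[], q :: D, by simpa using hT', ?_, by simpa using hlast⟩
      cases A <;> simpa using hhead
    | cons c C =>
      simp only [List.cons_append, List.cons.injEq] at hCD
      obtain ⟨rfl, rfl⟩ := hCD
      refine ⟨C ++ [p], q :: D, by simpa using hT', ?_, by simpa [List.getLast?_cons] using hlast⟩
      cases A <;> simpa using hhead

/-- A vertex of a taut line lies between any two mutually visible points of the line that it
separates. -/
lemma mem_segment (h : Link (regionOf S) x y (A ++ Z :: B)) (hq : p ∈ carrier (A ++ [Z]))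
    (hq' : q ∈ carrier (Z :: B)) (hR : segment ℝ p q ⊆ regionOf S) : Z ∈ segment ℝ p q := by
  by_cases hpZ : p = Z
  · subst hpZ; exact left_mem_segment _ _ _
  by_cases hqZ : q = Z
  · subst hqZ; exact right_mem_segment _ _ _
  -- The piece of the line between p and q is taut and passes through Z; by uniqueness it is the
  -- segment pq.
  obtain ⟨N, D, h1⟩ := h.exists_insert_tail hq' hqZ
  have h2 := h1.reverse
  have e : (A ++ Z :: (N ++ q :: D)).reverse =
      (D.reverse ++ q :: N.reverse) ++ Z :: A.reverse := by simp
  rw [e] at h2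
  obtain ⟨N', D', h3⟩ := h2.exists_insert_tail (Z := p) (by
    rw [← carrier_reverse]; simpa using hq) hpZ
  have e' : (D.reverse ++ q :: N.reverse) ++ Z :: (N' ++ p :: D') =
      (D.reverse ++ q :: (N.reverse ++ Z :: N')) ++ p :: D' := by simp
  rw [e'] at h3
  have h4 := h3.left
  have e'' : (D.reverse ++ q :: (N.reverse ++ Z :: N')) ++ [p] =
      D.reverse ++ q :: (N.reverse ++ Z :: N' ++ [p]) := by simp
  rw [e''] at h4
  have h5 := h4.right
  have hZm : Z ∈ carrier (q :: (N.reverse ++ Z :: N' ++ [p])) := mem_carrier_of_mem (by simp)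
  by_cases hpq : p = q
  · subst hpq
    rw [h5.carrier_unique (singleton (hR (left_mem_segment _ _ _))), carrier_singleton] at hZm
    rwa [segment_same]
  · rw [h5.carrier_unique (pair (Ne.symm hpq) (by rwa [segment_symm])), carrier_cons_cons,
      carrier_singleton] at hZm
    rw [segment_symm]
    rcases hZm with hZm | rfl
    exacts [hZm, right_mem_segment _ _ _]

/-- A taut line does not return to its initial point. -/
lemma head_notMem (h : Link (regionOf S) x y (x :: z :: l)) : x ∉ carrier (z :: l) := by
  intro hx
  have hxz : x ≠ z := h.ne x z ⟨[], l, by simp⟩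
  obtain ⟨N, D, h1⟩ := Link.exists_insert_tail (A := [x]) (X := z) h hx hxz
  have h2 : Link (regionOf S) x x (([x] ++ z :: N) ++ [x]) :=
    Link.left (z := x) (B := D) (by simpa using h1)
  have hz : z ∈ carrier (([x] ++ z :: N) ++ [x]) := mem_carrier_of_mem (by simp)
  rw [h2.carrier_unique (singleton (h.subset (mem_carrier_of_mem (by simp)))),
    carrier_singleton] at hz
  exact hxz hz.symm

/-- Taut lines with the same endpoints start along the same ray. -/
lemma exists_common_germ (h : Link (regionOf S) x y (x :: z :: l))
    (h' : Link (regionOf S) x y (x :: z' :: l')) :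
    ∃ w, w ≠ x ∧ w ≠ z ∧ w ≠ z' ∧ w ∈ segment ℝ x z ∧ w ∈ segment ℝ x z' := by
  have hxz : z ≠ x := (h.ne x z ⟨[], l, by simp⟩).symm
  have hxz' : z' ≠ x := (h'.ne x z' ⟨[], l', by simp⟩).symm
  have hc := h.carrier_unique h'
  rw [carrier_cons_cons, carrier_cons_cons] at hc
  have hlim : Tendsto (fun ε : ℝ => x + ε • (z - x)) (𝓝[>] 0) (𝓝 x) := by
    have : Tendsto (fun ε : ℝ => x + ε • (z - x)) (𝓝 0) (𝓝 (x + (0:ℝ) • (z - x))) :=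
      Continuous.tendsto (by fun_prop) _
    rw [zero_smul, add_zero] at this
    exact this.mono_left nhdsWithin_le_nhds
  -- The rest of the second line stays away from x, so points of the first edge near x can lie only
  -- on the first edge of the other line.
  obtain ⟨ε, ⟨h1, h2, h3⟩, h4⟩ := ((hlim.eventually
    (((isCompact_carrier (z' :: l')).isClosed.isOpen_compl.eventually_mem h'.head_notMem).and
    ((isOpen_ne.eventually_mem hxz.symm).and (isOpen_ne.eventually_mem hxz'.symm)))).and
    (Ioo_mem_nhdsGT (zero_lt_one (α := ℝ)))).exists
  have hmem : x + ε • (z - x) ∈ segment ℝ x z := add_smul_mem_segment h4.1.le h4.2.le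
  refine ⟨_, add_smul_ne h4.1 hxz, h2, h3, hmem, ?_⟩
  have : x + ε • (z - x) ∈ segment ℝ x z ∪ carrier (z :: l) := Or.inl hmem
  rw [hc] at this
  exact this.resolve_right h1

/-- Taut lines that share two points in the same order share an edge. -/
lemma exists_common_edge_aux {N N' D D' : List Plane}
    (h : Link (regionOf S) x y (A ++ X :: (N ++ Y :: D)))
    (h' : Link (regionOf S) x' y' (A' ++ X :: (N' ++ Y :: D'))) :
    ∃ Z C C', Z ≠ X ∧ Link (regionOf S) x y (A ++ X :: Z :: C) ∧
      Link (regionOf S) x' y' (A' ++ X :: Z :: C') := by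
  have key : ∀ {x y : Plane} {A N D : List Plane}, Link (regionOf S) x y (A ++ X :: (N ++ Y :: D)) →
      ∃ s l D', A ++ X :: (N ++ Y :: D) = A ++ X :: s :: D' ∧
        Link (regionOf S) X Y (X :: s :: l) := by
    intro x y A N D h
    have h1 : Link (regionOf S) X Y (X :: (N ++ [Y])) := by
      have := h.right
      have e : X :: (N ++ Y :: D) = (X :: N) ++ Y :: D := by simp
      rw [e] at this
      simpa using this.left
    cases N with
    | nil => exact ⟨Y, [], D, rfl, h1⟩
    | cons s N => exact ⟨s, N ++ [Y], N ++ Y :: D, rfl, h1⟩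
  have ins : ∀ {x y s w : Plane} {A D : List Plane}, Link (regionOf S) x y (A ++ X :: s :: D) →
      w ∈ segment ℝ X s → w ≠ X → w ≠ s → Link (regionOf S) x y (A ++ X :: w :: s :: D) := by
    intro x y s w A D h hw h1 h2
    refine ⟨h.toTaut.insert hw h1 h2, ?_, by simpa using h.last⟩
    have := h.head; cases A <;> simpa using this
  obtain ⟨s, l, C, e, h1⟩ := key h
  obtain ⟨s', l', C', e', h1'⟩ := key h'
  rw [e] at h
  rw [e'] at h'
  obtain ⟨w, hw, hws, hws', hm, hm'⟩ := h1.exists_common_germ h1'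
  exact ⟨w, s :: C, s' :: C', hw, ins h hm hw hws, ins h' hm' hw hws'⟩

/-- Taut lines that share two points share an edge, up to orientation. -/
lemma exists_common_edge (h : Link (regionOf S) x y l) (h' : Link (regionOf S) x' y' l')
    (hX : X ∈ carrier l) (hY : Y ∈ carrier l) (hX' : X ∈ carrier l') (hY' : Y ∈ carrier l')
    (hne : X ≠ Y) :
    ∃ V W A B A' B', V ≠ W ∧ Link (regionOf S) x y (A ++ V :: W :: B) ∧
      (Link (regionOf S) x' y' (A' ++ V :: W :: B') ∨
        Link (regionOf S) x' y' (A' ++ W :: V :: B')) := by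
  have order : ∀ {x y : Plane} {l : List Plane} {X Y : Plane}, Link (regionOf S) x y l →
      X ∈ carrier l → Y ∈ carrier l → X ≠ Y →
      (∃ A N D, Link (regionOf S) x y (A ++ X :: (N ++ Y :: D))) ∨
      (∃ A N D, Link (regionOf S) x y (A ++ Y :: (N ++ X :: D))) := by
    intro x y l X Y h hX hY hne
    obtain ⟨A, B, h1, hc⟩ := h.exists_insert hX
    rw [← hc, carrier_append] at hY
    rcases hY with hY | hY
    · right
      have h2 := h1.reverse
      have e : (A ++ X :: B).reverse = B.reverse ++ X :: A.reverse := by simp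
      rw [e] at h2
      obtain ⟨N, D, h3⟩ := h2.exists_insert_tail (Z := Y) (by
        rw [← carrier_reverse]; simpa using hY) hne.symm
      refine ⟨D.reverse, N.reverse, B, ?_⟩
      have := h3.reverse
      simpa using this
    · left
      exact ⟨A, h1.exists_insert_tail hY hne.symm⟩
  have main : ∀ {X Y : Plane}, X ∈ carrier l' → Y ∈ carrier l' → X ≠ Y →
      (∃ A N D, Link (regionOf S) x y (A ++ X :: (N ++ Y :: D))) →
      ∃ V W A B A' B', V ≠ W ∧ Link (regionOf S) x y (A ++ V :: W :: B) ∧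
      (Link (regionOf S) x' y' (A' ++ V :: W :: B') ∨
        Link (regionOf S) x' y' (A' ++ W :: V :: B')) := by
    rintro X Y hX' hY' hne ⟨A, N, D, h1⟩
    rcases order h' hX' hY' hne with ⟨A', N', D', h2⟩ | ⟨A', N', D', h2⟩
    · obtain ⟨Z, C, C', hZ, h3, h4⟩ := exists_common_edge_aux h1 h2
      exact ⟨X, Z, A, C, A', C', hZ.symm, h3, Or.inl h4⟩
    · have h2' : Link (regionOf S) y' x' (D'.reverse ++ X :: (N'.reverse ++ Y :: A'.reverse)) := by
        simpa using h2.reverse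
      obtain ⟨Z, C, C', hZ, h3, h4⟩ := exists_common_edge_aux h1 h2'
      refine ⟨X, Z, A, C, C'.reverse, D', hZ.symm, h3, Or.inr ?_⟩
      simpa using h4.reverse
  rcases order h hX hY hne with h1 | h1
  · exact main hX' hY' hne h1
  · exact main hY' hX' hne.symm h1

end Link

/-! ### The vertices of a polygon as a periodic sequence -/

lemma region_eq {n : ℕ} (P : Polygon Plane n) : P.region = regionOf (P.boundary ℝ) := rfl

lemma inside_eq {n : ℕ} (P : Polygon Plane n) : P.inside = insideOf (P.boundary ℝ) := rfl

section Polygon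

variable {n : ℕ} [NeZero n] (P : Polygon Plane n) (s : Fin n)

/-- The vertices of a polygon, listed cyclically from the vertex with index `s`. -/
def walk (t : ℕ) : Plane := P (s + Fin.ofNat n t)

lemma ofNat_eq_iff {a b : ℕ} : Fin.ofNat n a = Fin.ofNat n b ↔ a ≡ b [MOD n] := by
  rw [Fin.ext_iff]; rfl

lemma ofNat_add (a b : ℕ) : Fin.ofNat n (a + b) = Fin.ofNat n a + Fin.ofNat n b := by
  rw [Fin.ext_iff, Fin.val_add]
  exact Nat.add_mod a b n

lemma ofNat_val (i : Fin n) : Fin.ofNat n i.val = i :=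
  Fin.ext (Nat.mod_eq_of_lt i.isLt)

lemma ofNat_succ (t : ℕ) : Fin.ofNat n (t + 1) = Fin.ofNat n t + 1 := by
  rw [ofNat_add]; rfl

lemma edge_walk (t : ℕ) : edge (walk P s) t = P.edgeSet ℝ (s + Fin.ofNat n t) := by
  rw [edge, walk, walk, ofNat_succ, Polygon.edgeSet, affineSegment_eq_segment,
    finRotate_apply, add_assoc]

lemma bd_walk : bd (walk P s) = P.boundary ℝ := by
  unfold bd Polygon.boundary
  refine Subset.antisymm (iUnion_subset fun t => ?_) (iUnion_subset fun i => ?_)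
  · rw [edge_walk]; exact subset_iUnion (fun i => P.edgeSet ℝ i) _
  · have : P.edgeSet ℝ i = edge (walk P s) (i - s).val := by
      rw [edge_walk, ofNat_val, add_sub_cancel]
    rw [this]; exact subset_iUnion (edge (walk P s)) _

lemma simpleCycle_walk {P : Polygon Plane n} (hP : P.IsSimple) : SimpleCycle n (walk P s) where
  three_le := hP.three_le
  periodic t := by
    unfold walk
    rw [ofNat_eq_iff.2 (show t + n ≡ t [MOD n] by simp [Nat.ModEq])]
  ne t := by
    have := hP.nondegenerate (s + Fin.ofNat n t)
    rwa [finRotate_apply, add_assoc, ← ofNat_succ] at this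
  consecutive t := by
    have := hP.consecutive (s + Fin.ofNat n t)
    rwa [add_assoc, ← ofNat_succ, ← edge_walk, ← edge_walk] at this
  nonconsecutive a b h1 h2 := by
    have key : ∀ c d : ℕ, c < d → d < c + n → Fin.ofNat n d ≠ Fin.ofNat n c := by
      intro c d hcd hdn he
      have := (Nat.modEq_iff_dvd' hcd.le).1 (ofNat_eq_iff.1 he.symm)
      have := Nat.le_of_dvd (by omega) this
      omega
    rw [edge_walk, edge_walk]
    refine hP.nonconsecutive _ _ ?_ ?_ ?_
    · intro he; exact key a b (by omega) (by omega) (add_left_cancel he)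
    · rw [add_assoc, ← ofNat_succ]
      intro he; exact key (a + 1) b (by omega) (by omega) (add_left_cancel he)
    · rw [add_assoc, ← ofNat_succ, ← ofNat_eq_iff.2 (show a + n ≡ a [MOD n] by simp [Nat.ModEq])]
      intro he; exact key (b + 1) (a + n) (by omega) (by omega) (add_left_cancel he)

/-- The boundary cannot be shortened within the polygon at a reflex vertex. -/
lemma turn_of_isReflex {P : Polygon Plane n} (hP : P.IsSimple) (t : ℕ)
    (h : P.IsReflex (s + Fin.ofNat n (t + 1))) :
    Turn (regionOf (bd (walk P s))) (walk P s t) (walk P s (t + 1)) (walk P s (t + 2)) := by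
  intro x hx y hy hxV hyV hR
  rcases ((simpleCycle_walk s hP).corner_vertex t).straight_or_inside hx hy hxV hyV hR with
    h1 | ⟨hdet, hin⟩
  · exact h1
  · have e1 : s + Fin.ofNat n (t + 1) - 1 = s + Fin.ofNat n t := by
      rw [ofNat_succ, ← add_assoc, add_sub_cancel_right]
    have e2 : s + Fin.ofNat n (t + 1) + 1 = s + Fin.ofNat n (t + 2) := by
      rw [ofNat_succ (t + 1), add_assoc]
    unfold Polygon.IsReflex Polygon.interiorAngle at h
    rw [e1, e2] at h
    rw [bd_walk, ← inside_eq] at hin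
    simp only [walk] at hin hdet
    rw [if_pos hin] at h
    -- A corner that can be cut has interior angle ∠ ≤ π; being reflex forces ∠ = π, which
    -- contradicts the nonzero determinant.
    have hpi := le_antisymm (EuclideanGeometry.angle_le_pi _ _ _) h
    have hs := (EuclideanGeometry.angle_eq_pi_iff_sbtw.1 hpi).wbtw
    rw [← mem_segment_iff_wbtw] at hs
    obtain ⟨a, b, ha, hb, hab, he⟩ := hs
    obtain rfl : b = 1 - a := by linarith
    rw [← he] at hdet
    refine absurd ?_ hdet
    simp [det]; ring

end Polygon

/-! ### Taut boundary arcs -/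

section Arc

variable {n : ℕ} {Q : ℕ → Plane} {R : Set Plane} {p : Plane}

lemma vertex_mem_carrier_arc {s i k : ℕ} (h : i ≤ k) : Q (s + i) ∈ carrier (arc Q s k) := by
  rw [mem_carrier_arc]
  rcases Nat.eq_zero_or_pos i with rfl | h0
  · exact Or.inl rfl
  · refine Or.inr ⟨i - 1, by omega, ?_⟩
    have := SimpleCycle.right_mem_edge (Q := Q) (s + (i - 1))
    rwa [show s + (i - 1) + 1 = s + i by omega] at this

/-- Only the turns at interior vertices matter; the edges of a simple cycle are already
nondegenerate and lie in R. -/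
lemma SimpleCycle.link_arc (h : SimpleCycle n Q) (hR : bd Q ⊆ R) {s k : ℕ}
    (ht : ∀ i, i + 1 < k → Turn R (Q (s + i)) (Q (s + i + 1)) (Q (s + i + 2))) :
    Link R (Q s) (Q (s + k)) (arc Q s k) := by
  refine ⟨⟨(carrier_arc_subset _ _ _).trans hR, ?_, ?_⟩, head?_arc _ _ _, getLast?_arc _ _ _⟩
  · clear ht
    induction k generalizing s with
    | zero => intro p q hp; have := hp.length_le; simp [arc] at this
    | succ k ih =>
      intro p q hp
      rw [arc, List.infix_cons_iff] at hp
      rcases hp with hp | hp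
      · obtain ⟨l, hl⟩ := arc_cons Q (s + 1) k
        rw [hl] at hp
        simp only [List.cons_prefix_cons] at hp
        rw [hp.1, hp.2.1]
        exact h.ne s
      · exact ih p q hp
  · induction k generalizing s with
    | zero => intro p q r hp; have := hp.length_le; simp [arc] at this
    | succ k ih =>
      intro p q r hp
      rw [arc, List.infix_cons_iff] at hp
      rcases hp with hp | hp
      · cases k with
        | zero => have := hp.length_le; simp [arc] at this
        | succ k =>
          obtain ⟨l, hl⟩ := arc_cons Q (s + 1 + 1) k
          rw [arc, hl] at hp
          simp only [List.cons_prefix_cons] at hp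
          rw [hp.1, hp.2.1, hp.2.2.1]
          exact ht 0 (by omega)
      · refine ih (fun i hi => ?_) p q r hp
        have := ht (i + 1) (by omega)
        rwa [show s + (i + 1) = s + 1 + i by omega] at this

/-- A point of a taut boundary arc may be made a vertex whose neighbours span a corner. -/
lemma SimpleCycle.exists_corner_split (h : SimpleCycle n Q) {s k : ℕ}
    (hl : Link R (Q s) (Q (s + k)) (arc Q s k)) (hp : p ∈ carrier (arc Q s k)) (hps : p ≠ Q s)
    (hpk : p ≠ Q (s + k)) :
    ∃ A N N' B, Link R (Q s) (Q (s + k)) (A ++ N :: p :: N' :: B) ∧ Corner (bd Q) p N N' := by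
  have vertex : ∀ j, j + 1 < k → p = Q (s + j + 1) →
      ∃ A N N' B, Link R (Q s) (Q (s + k)) (A ++ N :: p :: N' :: B) ∧ Corner (bd Q) p N N' := by
    rintro j hj rfl
    obtain ⟨m, rfl⟩ : ∃ m, k = j + (m + 2) := ⟨k - j - 2, by omega⟩
    obtain ⟨l, hl'⟩ := arc_cons Q (s + j + 1 + 1) m
    rw [arc_append, arc, arc, hl'] at hl
    exact ⟨_, _, _, _, hl, h.corner_vertex (s + j)⟩
  obtain ⟨i, hi, hpi⟩ := (mem_carrier_arc.1 hp).resolve_left hps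
  have hpi' : p ∈ insert (Q (s + i)) (insert (Q (s + i + 1))
      (openSegment ℝ (Q (s + i)) (Q (s + i + 1)))) := by
    rw [insert_endpoints_openSegment]; exact hpi
  rcases hpi' with rfl | rfl | hm
  · have hi0 : i ≠ 0 := by rintro rfl; exact hps rfl
    exact vertex (i - 1) (by omega) (by congr 1; omega)
  · refine vertex i ?_ rfl
    by_contra hcon
    exact hpk (by congr 1; omega)
  · have hcor := h.corner_edge hm
    obtain ⟨m, rfl⟩ : ∃ m, k = i + (m + 1) := ⟨k - i - 1, by omega⟩
    obtain ⟨l, hl'⟩ := arc_cons Q (s + i + 1) m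
    rw [arc_append, arc, hl'] at hl
    refine ⟨(arc Q s i).dropLast, _, _, l, ⟨hl.toTaut.insert
      (openSegment_subset_segment _ _ _ hm) hcor.left_ne.symm hcor.right_ne.symm, ?_, ?_⟩, hcor⟩
    · have := hl.head
      generalize (arc Q s i).dropLast = A at this ⊢
      cases A <;> simpa using this
    · simpa [List.getLast?_cons] using hl.last

/-- A polygonal line whose endpoints separate the endpoints of a chord meets that chord. -/
lemma SimpleCycle.inter_segment_nonempty (h : SimpleCycle n Q) {s t : ℕ} (hst : s < t)
    (ht : t < s + n) {l : List Plane} (hhead : l.head? = some (Q s))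
    (hlast : l.getLast? = some (Q t)) (hl : carrier l ⊆ regionOf (bd Q)) {u v : Plane}
    (huv : segment ℝ u v ⊆ regionOf (bd Q)) (hu : ∃ i, t ≤ i ∧ i < s + n ∧ u ∈ edge Q i)
    (hv : ∃ i, s ≤ i ∧ i < t ∧ v ∈ edge Q i) : (carrier l ∩ segment ℝ u v).Nonempty := by
  let τ : Path u v :=
    { toFun := fun r => AffineMap.lineMap u v (r : ℝ)
      continuous_toFun := by fun_prop
      source' := by simp
      target' := by simp }
  have hτ : range τ ⊆ segment ℝ u v := by
    rintro _ ⟨r, rfl⟩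
    rw [segment_eq_image_lineMap]
    exact ⟨r, r.2, rfl⟩
  exact (h.crossing hst ht hhead hlast hl τ (hτ.trans huv) hu hv).mono
    (inter_subset_inter_right _ hτ)

end Arc

/-! ### Two disjoint taut boundary arcs joined by a chord -/

/-- Two disjoint taut boundary arcs, from `Q 0` to `Q l` and from `Q k` to `Q (k + j)`, and a chord
of the region that joins interior points of the arcs. -/
structure ChordedArcs (n : ℕ) (Q : ℕ → Plane) (l k j : ℕ) (p' p'' : Plane) : Prop where
  cycle : SimpleCycle n Q
  lt : l < k
  add_lt : k + j < n
  link : Link (regionOf (bd Q)) (Q 0) (Q l) (arc Q 0 l)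
  link' : Link (regionOf (bd Q)) (Q k) (Q (k + j)) (arc Q k j)
  disjoint : Disjoint (carrier (arc Q 0 l)) (carrier (arc Q k j))
  mem : p' ∈ carrier (arc Q 0 l)
  mem' : p'' ∈ carrier (arc Q k j)
  ne_left : p' ≠ Q 0
  ne_right : p' ≠ Q l
  ne_left' : p'' ≠ Q k
  segment_subset : segment ℝ p' p'' ⊆ regionOf (bd Q)
  openSegment_subset : openSegment ℝ p' p'' ⊆ insideOf (bd Q)

namespace ChordedArcs

variable {n l k j : ℕ} {Q : ℕ → Plane} {p' p'' X Y Z : Plane} {A A' C C' : List Plane}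

lemma exists_edge (h : ChordedArcs n Q l k j p' p'') : ∃ i < l, p' ∈ edge Q i := by
  obtain ⟨i, hi, he⟩ := (mem_carrier_arc.1 h.mem).resolve_left h.ne_left
  exact ⟨i, hi, by rwa [zero_add] at he⟩

lemma exists_edge' (h : ChordedArcs n Q l k j p' p'') : ∃ i, k ≤ i ∧ i < k + j ∧ p'' ∈ edge Q i := by
  obtain ⟨i, hi, he⟩ := (mem_carrier_arc.1 h.mem').resolve_left h.ne_left'
  exact ⟨k + i, by omega, by omega, he⟩

lemma head?_append_cons (A B C : List Plane) (z : Plane) :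
    (A ++ z :: B).head? = (A ++ z :: C).head? := by
  cases A <;> simp

lemma getLast?_append_cons (A B C : List Plane) (z : Plane) :
    (A ++ z :: C).getLast? = (B ++ z :: C).getLast? := by
  simp [List.getLast?_cons]

/-- A common vertex of two lines joining the arcs crosswise lies on the chord. -/
lemma mem_chord (h : ChordedArcs n Q l k j p' p'')
    (hac : Link (regionOf (bd Q)) (Q 0) (Q k) (A ++ Z :: C))
    (hbd : Link (regionOf (bd Q)) (Q l) (Q (k + j)) (A' ++ Z :: C'))
    (had : Link (regionOf (bd Q)) (Q 0) (Q (k + j)) (A ++ Z :: C'))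
    (hbc : Link (regionOf (bd Q)) (Q l) (Q k) (A' ++ Z :: C)) : Z ∈ segment ℝ p' p'' := by
  obtain ⟨i, hi, hp'⟩ := h.exists_edge
  obtain ⟨i', hi', hi'', hp''⟩ := h.exists_edge'
  have hlk := h.lt
  have hkn := h.add_lt
  have hp's : p' ∈ edge Q (i + n) := by rwa [h.cycle.edge_periodic]
  have hseg := h.segment_subset
  have hseg' : segment ℝ p'' p' ⊆ regionOf (bd Q) := by rwa [segment_symm]
  have sub : ∀ {x y x' y' : Plane} {D D' E E' : List Plane},
      Link (regionOf (bd Q)) x y (D ++ Z :: D') → Link (regionOf (bd Q)) x' y' (E ++ Z :: E') →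
      carrier (D ++ [Z]) ∪ carrier (Z :: E') ⊆ regionOf (bd Q) := fun h1 h2 =>
    union_subset h1.left.subset h2.right.subset
  -- Of the four half lines at Z towards a, b, c, d, the chord meets one of {a, c}, of {b, d}, of
  -- {c, d} and of {a, b}, since it separates each of these pairs. For the last two pairs the line
  -- through Z need not be taut.
  have m1 : ((carrier (A ++ [Z]) ∪ carrier (Z :: C)) ∩ segment ℝ p'' p').Nonempty := by
    rw [← carrier_append]
    exact h.cycle.inter_segment_nonempty (by omega) (by omega) hac.head hac.last hac.subset hseg'
      ⟨i', hi', by omega, hp''⟩ ⟨i, by omega, by omega, hp'⟩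
  have m2 : ((carrier (A' ++ [Z]) ∪ carrier (Z :: C')) ∩ segment ℝ p' p'').Nonempty := by
    rw [← carrier_append]
    exact h.cycle.inter_segment_nonempty (by omega) (by omega) hbd.head hbd.last hbd.subset hseg
      ⟨i + n, by omega, by omega, hp's⟩ ⟨i', by omega, by omega, hp''⟩
  have m3 : ((carrier (C.reverse ++ [Z]) ∪ carrier (Z :: C')) ∩ segment ℝ p' p'').Nonempty := by
    have hc : Link (regionOf (bd Q)) (Q k) Z (C.reverse ++ [Z]) := by simpa using hac.right.reverse
    rw [← carrier_append]
    refine h.cycle.inter_segment_nonempty (s := k) (t := k + j) (by omega) (by omega) ?_ ?_ ?_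
      hseg ⟨i + n, by omega, by omega, hp's⟩ ⟨i', by omega, by omega, hp''⟩
    · rw [head?_append_cons _ C' []]; exact hc.head
    · rw [getLast?_append_cons _ A']; exact hbd.last
    · rw [carrier_append]; exact sub (D' := []) hc hbd
  have m4 : ((carrier (A ++ [Z]) ∪ carrier (Z :: A'.reverse)) ∩ segment ℝ p'' p').Nonempty := by
    have hb : Link (regionOf (bd Q)) Z (Q l) (Z :: A'.reverse) := by simpa using hbd.left.reverse
    rw [← carrier_append]
    refine h.cycle.inter_segment_nonempty (s := 0) (t := l) (by omega) (by omega) ?_ ?_ ?_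
      hseg' ⟨i', by omega, by omega, hp''⟩ ⟨i, by omega, by omega, hp'⟩
    · rw [head?_append_cons _ _ C]; exact hac.head
    · rw [getLast?_append_cons A []]; exact hb.last
    · rw [carrier_append]; exact sub (E := []) hac hb
  have e1 : carrier (C.reverse ++ [Z]) = carrier (Z :: C) := by rw [← carrier_reverse]; simp
  have e2 : carrier (Z :: A'.reverse) = carrier (A' ++ [Z]) := by rw [← carrier_reverse]; simp
  rw [segment_symm] at m1 m4
  rw [e1] at m3
  rw [e2] at m4
  rw [union_inter_distrib_right, union_nonempty] at m1 m2 m3 m4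
  have fin : ∀ {x y : Plane} {D E : List Plane}, Link (regionOf (bd Q)) x y (D ++ Z :: E) →
      (carrier (D ++ [Z]) ∩ segment ℝ p' p'').Nonempty →
      (carrier (Z :: E) ∩ segment ℝ p' p'').Nonempty → Z ∈ segment ℝ p' p'' := by
    rintro x y D E hL ⟨u, hu, hu'⟩ ⟨v, hv, hv'⟩
    have huv := (convex_segment p' p'').segment_subset hu' hv'
    exact huv (hL.mem_segment hu hv (huv.trans hseg))
  -- In every case the chord meets the half lines to a and d, or those to b and c. Together these
  -- form a taut line, on which Z lies between two points of the chord.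
  rcases m1 with h1 | h1
  · rcases m2 with h2 | h2
    · rcases m3 with h3 | h3
      · exact fin hbc h2 h3
      · exact fin had h1 h3
    · exact fin had h1 h2
  · rcases m2 with h2 | h2
    · exact fin hbc h2 h1
    · rcases m4 with h4 | h4
      · exact fin had h4 h2
      · exact fin hbc h4 h1

/-- If two taut lines from the endpoints of the first arc arrive at its point `p'`, they do not
both continue to `p''` tautly. -/
lemma not_turn_both (h : ChordedArcs n Q l k j p' p'') {r r' : Plane}
    (ha : Link (regionOf (bd Q)) (Q 0) p' (A ++ [r, p'])) (hr : Turn (regionOf (bd Q)) r p' p'')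
    (hb : Link (regionOf (bd Q)) (Q l) p' (A' ++ [r', p']))
    (hr' : Turn (regionOf (bd Q)) r' p' p'') : False := by
  obtain ⟨D, N, N', E, hL, hcor⟩ := h.cycle.exists_corner_split (s := 0) (k := l)
    (by rw [zero_add]; exact h.link) h.mem h.ne_left (by rw [zero_add]; exact h.ne_right)
  rw [zero_add] at hL
  have e : D ++ N :: p' :: N' :: E = (D ++ [N]) ++ p' :: (N' :: E) := by simp
  rw [e] at hL
  have hpp : p'' ≠ p' := by
    rintro rfl
    exact h.disjoint.le_bot ⟨h.mem, h.mem'⟩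
  have key : ∀ {y N r : Plane} {D F : List Plane}, Link (regionOf (bd Q)) p' y (p' :: N :: D) →
      Link (regionOf (bd Q)) p' y (p' :: r :: F) → Turn (regionOf (bd Q)) r p' p'' →
      Turn (regionOf (bd Q)) N p' p'' := by
    intro y N r D F h1 h2 ht
    -- By uniqueness the given taut line arrives at p' along the boundary arc, so the turn into the
    -- chord is also taut for the boundary neighbour.
    obtain ⟨w, hw, -, -, hw1, hw2⟩ := h1.exists_common_germ h2
    rw [segment_symm] at hw1 hw2
    exact (ht.shrink_left hw2).grow_left hw1 hw
  refine hcor.not_turn_both hpp h.openSegment_subset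
    (key (y := Q 0) (D := D.reverse) (F := A.reverse) ?_ ?_ hr) (key (F := A'.reverse) hL.right ?_ hr')
  · simpa using hL.left.reverse
  · simpa using ha.reverse
  · simpa using hb.reverse

/-- Taut lines that join the arcs crosswise do not share an edge in the same direction. -/
lemma not_common_edge (h : ChordedArcs n Q l k j p' p'')
    (hac : Link (regionOf (bd Q)) (Q 0) (Q k) (A ++ X :: Y :: C))
    (hbd : Link (regionOf (bd Q)) (Q l) (Q (k + j)) (A' ++ X :: Y :: C')) : False := by
  have had := hac.splice hbd
  have hbc := hbd.splice hac
  have hX := h.mem_chord hac hbd had hbc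
  have e : ∀ D E : List Plane, D ++ X :: Y :: E = (D ++ [X]) ++ Y :: E := by simp
  have hS := h.cycle.isClosed_bd
  have hY : Y ∈ segment ℝ p' p'' := by
    rw [e] at hac hbd had hbc
    exact h.mem_chord hac hbd had hbc
  have haY : Link (regionOf (bd Q)) (Q 0) Y (A ++ [X, Y]) := by
    rw [e] at hac; simpa using hac.left
  have hbY : Link (regionOf (bd Q)) (Q l) Y (A' ++ [X, Y]) := by
    rw [e] at hbd; simpa using hbd.left
  have ha0 : Q 0 ∈ carrier (arc Q 0 l) := vertex_mem_carrier_arc (i := 0) (by omega)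
  have hb0 : Q l ∈ carrier (arc Q 0 l) := by
    have := vertex_mem_carrier_arc (Q := Q) (s := 0) (i := l) (k := l) le_rfl
    rwa [zero_add] at this
  have hnot : ∀ x ∈ carrier (arc Q 0 l), x ∉ insideOf (bd Q) := fun x hx hin =>
    hin.1 (carrier_arc_subset _ _ _ hx)
  rcases mem_segment_split hY hX with hXY | hXY
  -- The shared edge points away from p': both lines come from p'.
  · obtain ⟨D, r, h1, h2⟩ := haY.exists_turn_of_chord hS h.openSegment_subset (hnot _ ha0)
      h.ne_left.symm hXY hY
    obtain ⟨D', r', h1', h2'⟩ := hbY.exists_turn_of_chord hS h.openSegment_subset (hnot _ hb0)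
      h.ne_right.symm hXY hY
    exact h.not_turn_both h1 h2 h1' h2'
  · have hpp : p'' ≠ p' := by
      rintro rfl
      exact h.disjoint.le_bot ⟨h.mem, h.mem'⟩
    have hap : Q 0 ≠ p'' := by
      intro he
      exact h.disjoint.le_bot ⟨he ▸ ha0, h.mem'⟩
    obtain ⟨D, r, h1, h2⟩ := haY.exists_turn_of_chord hS (p' := p'') (p'' := p')
      (by rw [openSegment_symm]; exact h.openSegment_subset) (hnot _ ha0) hap
      (by rwa [segment_symm]) (by rwa [segment_symm])
    -- The shared edge points away from p'': the taut line from `Q 0` to p'' continues tautly along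
    -- the chord to p', so by uniqueness p'' lies on the first arc.
    have h3 : Link (regionOf (bd Q)) (Q 0) p' ((D ++ [r]) ++ p'' :: [p']) := by
      refine ⟨Taut.append (by simpa using h1.toTaut)
        (Taut.pair hpp (by rw [segment_symm]; exact h.segment_subset)) ?_, ?_, by simp⟩
      · intro E p s F hE hF
        have hp : r = p := by simpa using congrArg List.getLast? hE
        simp only [List.cons.injEq] at hF
        obtain ⟨rfl, -⟩ := hF
        exact hp ▸ h2
      · have := h1.head; cases D <;> simpa using this
    obtain ⟨E, F, h4, hc⟩ := h.link.exists_insert h.mem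
    have hmem : p'' ∈ carrier ((D ++ [r]) ++ p'' :: [p']) := mem_carrier_of_mem (by simp)
    rw [h3.carrier_unique h4.left] at hmem
    refine h.disjoint.le_bot ⟨?_, h.mem'⟩
    rw [← hc]
    exact carrier_mono (append_singleton_infix E F p') hmem

/-- Taut lines that join the arcs crosswise do not share an edge in opposite directions. -/
lemma not_common_edge_reverse (h : ChordedArcs n Q l k j p' p'')
    (hac : Link (regionOf (bd Q)) (Q 0) (Q k) (A ++ X :: Y :: C))
    (hbd : Link (regionOf (bd Q)) (Q l) (Q (k + j)) (A' ++ Y :: X :: C')) : False := by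
  have hdb : Link (regionOf (bd Q)) (Q (k + j)) (Q l) (C'.reverse ++ X :: Y :: A'.reverse) := by
    simpa using hbd.reverse
  have h1 := (hac.splice hdb).carrier_unique h.link
  have h2 := (hdb.splice hac).carrier_unique h.link'.reverse
  rw [carrier_reverse] at h2
  refine h.disjoint.notMem_of_mem_left (a := X) ?_ ?_
  · rw [← h1]; exact mem_carrier_of_mem (by simp)
  · rw [← h2]; exact mem_carrier_of_mem (by simp)

/-- Taut lines that join the arcs crosswise have at most one common point. -/
lemma eq_of_mem_carrier (h : ChordedArcs n Q l k j p' p'') {L L' : List Plane}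
    (hac : Link (regionOf (bd Q)) (Q 0) (Q k) L)
    (hbd : Link (regionOf (bd Q)) (Q l) (Q (k + j)) L') (hX : X ∈ carrier L)
    (hX' : X ∈ carrier L') (hY : Y ∈ carrier L) (hY' : Y ∈ carrier L') : X = Y := by
  by_contra hne
  obtain ⟨V, W, A, B, A', B', -, h1, h2 | h2⟩ :=
    hac.exists_common_edge hbd hX hY hX' hY' hne
  · exact h.not_common_edge h1 h2
  · exact h.not_common_edge_reverse h1 h2

/-- A common point of two taut lines that join the arcs crosswise is an inside point or a
vertex. -/
lemma mem_insideOf_or_vertex (h : ChordedArcs n Q l k j p' p'') {L L' : List Plane}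
    (hac : Link (regionOf (bd Q)) (Q 0) (Q k) L)
    (hbd : Link (regionOf (bd Q)) (Q l) (Q (k + j)) L') (hX : X ∈ carrier L)
    (hX' : X ∈ carrier L') : X ∈ insideOf (bd Q) ∨ ∃ t, X = Q t := by
  rcases hac.subset hX with hb | hin
  · right
    by_contra! hv
    obtain ⟨t, ht⟩ := mem_iUnion.1 hb
    have ht' : X ∈ insert (Q t) (insert (Q (t + 1)) (openSegment ℝ (Q t) (Q (t + 1)))) := by
      rw [insert_endpoints_openSegment]; exact ht
    have hm := (ht'.resolve_left (hv _)).resolve_left (hv _)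
    have e1 := h.cycle.eventually_mem_carrier hm hac hX (hv _) (hv _)
    have e2 := h.cycle.eventually_mem_carrier hm hbd hX' (hv _) (hv _)
    -- Both lines run along the edge near X, so a small nonzero displacement gives a second common
    -- point.
    obtain ⟨r, ⟨h1, h2⟩, h3⟩ := (((e1.and e2).filter_mono nhdsWithin_le_nhds).and
      (self_mem_nhdsWithin (a := (0:ℝ)) (s := {0}ᶜ))).exists
    have := h.eq_of_mem_carrier hac hbd hX hX' h1 h2
    rw [left_eq_add, smul_eq_zero, sub_eq_zero] at this
    rcases this with h4 | h4
    · exact h3 h4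
    · exact h.cycle.ne t h4.symm
  · exact Or.inl hin

end ChordedArcs

/-! ### Boundary paths -/

section BoundaryPath

variable {n : ℕ} [NeZero n] {P : Polygon Plane n} {s : Fin n} {k : ℕ}

lemma carrier_boundaryPath {B : BoundaryPath n} (hs : B.start = s + Fin.ofNat n k) :
    B.carrier P = carrier (arc (walk P s) k B.len) := by
  ext x
  have hv : ∀ t, P.edgeSet ℝ (B.vertexIndex t) = edge (walk P s) (k + t) := by
    intro t
    rw [edge_walk, BoundaryPath.vertexIndex, hs, ofNat_add, add_assoc]
  rw [mem_carrier_arc, BoundaryPath.carrier, mem_iUnion]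
  constructor
  · rintro ⟨t, ht⟩
    exact Or.inr ⟨t, t.2, by rwa [← hv]⟩
  · rintro (rfl | ⟨i, hi, hx⟩)
    · exact ⟨⟨0, B.len_pos⟩, by rw [hv]; exact SimpleCycle.left_mem_edge _⟩
    · exact ⟨⟨i, hi⟩, by rwa [hv]⟩

lemma initial_boundaryPath {B : BoundaryPath n} (hs : B.start = s + Fin.ofNat n k) :
    B.initial P = walk P s k := by
  rw [BoundaryPath.initial, BoundaryPath.vertexIndex, hs, walk, add_assoc, ← ofNat_add, add_zero]

lemma terminal_boundaryPath {B : BoundaryPath n} (hs : B.start = s + Fin.ofNat n k) :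
    B.terminal P = walk P s (k + B.len) := by
  rw [BoundaryPath.terminal, BoundaryPath.vertexIndex, hs, walk, add_assoc, ← ofNat_add]

/-- Outward convexity enters the argument only here: reflex vertices make the boundary path a
geodesic of the region. -/
lemma link_boundaryPath (hP : P.IsSimple) {B : BoundaryPath n} (hB : B.IsOutwardConvex P)
    (hs : B.start = s + Fin.ofNat n k) :
    Link (regionOf (bd (walk P s))) (walk P s k) (walk P s (k + B.len))
      (arc (walk P s) k B.len) := by
  refine (simpleCycle_walk s hP).link_arc (subset_regionOf _) fun i hi => ?_
  refine turn_of_isReflex s hP (k + i) ?_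
  have := hB (i + 1) (by omega) hi
  rwa [BoundaryPath.vertexIndex, hs, add_assoc, ← ofNat_add, ← add_assoc k] at this

end BoundaryPath

/-- The positions of two disjoint boundary paths with a chord between them. -/
lemma exists_chordedArcs {n : ℕ} [NeZero n] {P : Polygon Plane n} (hP : P.IsSimple)
    {B B' : BoundaryPath n} (hB : B.IsOutwardConvex P) (hB' : B'.IsOutwardConvex P)
    (hdisj : B.carrier P ∩ B'.carrier P = ∅) (hvis : StronglyMutuallyVisible P B B') :
    ∃ k p' p'', ChordedArcs n (walk P B.start) B.len k B'.len p' p'' ∧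
      B'.start = B.start + Fin.ofNat n k := by
  have h0 : B.start = B.start + Fin.ofNat n 0 := by
    simp
  have hk : B'.start = B.start + Fin.ofNat n (B'.start - B.start).val := by
    rw [ofNat_val, add_sub_cancel]
  have hkn := (B'.start - B.start).isLt
  set k := (B'.start - B.start).val
  obtain ⟨p', ⟨hp', hpe'⟩, p'', ⟨hp'', hpe''⟩, hseg, hint⟩ := hvis
  have hQ := simpleCycle_walk B.start hP
  have hl := link_boundaryPath hP hB h0
  rw [carrier_boundaryPath h0] at hdisj hp'
  rw [carrier_boundaryPath hk] at hdisj hp''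
  rw [initial_boundaryPath h0, terminal_boundaryPath h0] at hpe'
  rw [initial_boundaryPath hk, terminal_boundaryPath hk] at hpe''
  rw [region_eq, ← bd_walk P B.start] at hseg
  rw [← bd_walk P B.start] at hint
  rw [zero_add] at hl hpe'
  simp only [mem_insert_iff, mem_singleton_iff, not_or] at hpe' hpe''
  rw [← disjoint_iff_inter_eq_empty] at hdisj
  have hpp : p' ≠ p'' := by
    rintro rfl
    exact hdisj.le_bot ⟨hp', hp''⟩
  refine ⟨k, p', p'', ⟨hQ, ?_, ?_, hl, link_boundaryPath hP hB' hk, hdisj, hp', hp'', hpe'.1,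
    hpe'.2, hpe''.1, hseg, ?_⟩, hk⟩
  · by_contra! hle
    refine hdisj.notMem_of_mem_left (a := walk P B.start k) ?_
      (vertex_mem_carrier_arc (i := 0) (by omega))
    have := vertex_mem_carrier_arc (Q := walk P B.start) (s := 0) hle
    rwa [zero_add] at this
  -- If the second arc reached index n, it would contain `Q n = Q 0`, a point of the first arc.
  · by_contra! hle
    refine hdisj.notMem_of_mem_left (a := walk P B.start 0)
      (vertex_mem_carrier_arc (i := 0) (by omega)) ?_
    have := vertex_mem_carrier_arc (Q := walk P B.start) (s := k) (i := n - k) (k := B'.len)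
      (by omega)
    rwa [show k + (n - k) = 0 + n by omega, hQ.periodic] at this
  · intro x hx
    have hxs := openSegment_subset_segment _ _ _ hx
    refine (hseg hxs).resolve_left fun hb => ?_
    have : x ∈ ({p', p''} : Set Plane) := hint ▸ ⟨hxs, hb⟩
    rcases this with rfl | rfl
    · exact hpp (left_mem_openSegment_iff.1 hx)
    · exact hpp (right_mem_openSegment_iff.1 hx)

/-- Shortest paths between vertices of a simple polygon are taut polygonal lines. -/
lemma exists_link_of_shortest_walk {n : ℕ} {Q : ℕ → Plane} (hQ : SimpleCycle n Q) {a b : ℕ}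
    (hab : a ≤ b) {γ : Path (Q a) (Q b)} (hγ : IsShortestPathIn (regionOf (bd Q)) γ) :
    ∃ l, Link (regionOf (bd Q)) (Q a) (Q b) l ∧ carrier l = range γ := by
  obtain ⟨i, rfl⟩ := Nat.exists_eq_add_of_le hab
  obtain ⟨δ, hδ, hfin⟩ := exists_path_finite Q a i
  exact exists_link_of_shortest hγ
    (ne_top_of_le_ne_top hfin (hγ.2 δ (hδ.trans (subset_regionOf _))))
    fun z hz => hQ.eventually_segment_subset hz

end PlaneGeom

/-! ### Conclusion for the two shortest paths -/

open PlaneGeom in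
theorem theorem2p10 {n m : ℕ} [NeZero n] [NeZero m] (hm : 4 ≤ m)
    (P : Polygon Plane n) (hP : P.IsSimple)
    (B : Fin m → BoundaryPath n) (v : Fin m → Fin n)
    (hB : IsBoundaryPartition P B v)
    (hconvex : ∀ k, (B k).IsOutwardConvex P)
    (i j : Fin m)
    (hnonadj : (B i).carrier P ∩ (B j).carrier P = ∅)
    (hvisible : StronglyMutuallyVisible P (B i) (B j))
    (β₁ : Path ((B i).initial P) ((B j).initial P))
    (hβ₁ : IsShortestPathIn P.region β₁)
    (β₂ : Path ((B i).terminal P) ((B j).terminal P))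
    (hβ₂ : IsShortestPathIn P.region β₂) :
    ∃ p : Plane, range β₁ ∩ range β₂ = {p} ∧
      (p ∈ P.inside ∨ p ∈ range P.vertices) := by
  obtain ⟨k, p', p'', h, hk⟩ := exists_chordedArcs hP (hconvex i) (hconvex j) hnonadj hvisible
  have h0 : (B i).start = (B i).start + Fin.ofNat n 0 := by simp
  have ea := initial_boundaryPath (P := P) h0
  have eb := terminal_boundaryPath (P := P) h0
  have ec := initial_boundaryPath (P := P) hk
  have ed := terminal_boundaryPath (P := P) hk
  rw [zero_add] at eb
  rw [region_eq, ← bd_walk P (B i).start] at hβ₁ hβ₂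
  rw [inside_eq, ← bd_walk P (B i).start]
  have hvert : ∀ t, walk P (B i).start t ∈ range P.vertices := fun t => ⟨_, rfl⟩
  generalize (B i).initial P = a, (B i).terminal P = b, (B j).initial P = c,
    (B j).terminal P = d at *
  subst ea eb ec ed
  generalize walk P (B i).start = Q at *
  have hlt := h.lt
  have hadd := h.add_lt
  obtain ⟨L₁, hL₁, hc₁⟩ := exists_link_of_shortest_walk h.cycle (by omega) hβ₁
  obtain ⟨L₂, hL₂, hc₂⟩ := exists_link_of_shortest_walk h.cycle (by omega) hβ₂
  -- The first line joins indices 0 and k; since 0 < len < k < k + len' < n, the endpoints of the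
  -- second separate them on the boundary. Reversing β₂ makes it start on the arc after k.
  obtain ⟨p, hp₁, hp₂⟩ := h.cycle.crossing (by omega) (by omega) hL₁.head hL₁.last hL₁.subset
    β₂.symm (by rw [Path.symm_range]; exact hβ₂.1)
    ⟨_, by omega, by omega, SimpleCycle.left_mem_edge (k + (B j).len)⟩
    ⟨_, by omega, by omega, SimpleCycle.left_mem_edge (B i).len⟩
  rw [Path.symm_range, ← hc₂] at hp₂
  refine ⟨p, ?_, (h.mem_insideOf_or_vertex hL₁ hL₂ hp₁ hp₂).imp_right ?_⟩
  · rw [← hc₁, ← hc₂]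
    refine Subset.antisymm (fun q hq => ?_) (singleton_subset_iff.2 ⟨hp₁, hp₂⟩)
    exact h.eq_of_mem_carrier hL₁ hL₂ hq.1 hq.2 hp₁ hp₂
  · rintro ⟨t, rfl⟩
    exact hvert t
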